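/- Let $k\in\{2,3\}$. For a nondegenerate convex quadrilateral $Q\subset\mathbb R^2$ with set of vertices $\mathcal V_h(Q)$ and set of edges $\mathcal E_h(Q)$, let $\mathcal T_h^Q$ be the set of the four (closed) triangles into which $Q$ is divided by its two diagonals, and for each edge $e$ let $\bm n_e$ be a unit normal vector to $e$. For an integer $r$ let $P_r$ denote the polynomials of degree at most $r$ ($P_r=\{0\}$ if $r<0$), and let $$\Sigma_h^{k+1}(Q)=\{u\in H^2(Q):\ u|_T\in P_{k+1}(T)\ \text{for all } T\in\mathcal T_h^Q\},$$ whose members are identified with their continuous representatives on the closed quadrilateral. Let $F_Q$ be the continuous, piecewise affine map from the square $\hat Q=(-1,1)^2$ to $Q$ which maps the four triangles $\hat T$ of the criss-cross division of $\hat Q$ affinely onto the triangles $T$ of $Q$, and the edges $\hat e$ of $\hat Q$ onto the edges $e$ of $Q$. Consider the following degrees of freedom (DOFs) of $u\in\Sigma_h^{k+1}(Q)$: - $u(v),\ \partial_xu(v),\ \partial_yu(v)$ for all $v\in\mathcal V_h(Q)$; - $\int_e \partial_{n_e}u\,q\,ds$ for all $q=\hat q\circ F_Q^{-1}$ with $\hat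 q\in P_{k-2}(\hat e)$, and all $e\in\mathcal E_h(Q)$; - $\frac1{|e|}\int_e u\,q\,ds$ for all $q=\hat q\circ F_Q^{-1}$ with $\hat q\in P_{k-3}(\hat e)$, and all $e\in\mathcal E_h(Q)$; - $\frac1{|T|}\int_T u\,q\,dA$ for all $q=\hat q\circ F_Q^{-1}$ with $\hat q\in P_{k-3}(\hat T)$, and all $T\in\mathcal T_h^Q$. Then: 1. (Unisolvence.) Every $u\in\Sigma_h^{k+1}(Q)$ is $C^1$ up to the boundary of $Q$ (so that the DOFs are defined), and for every prescription of values for the DOFs (arbitrary numbers for the vertex DOFs, and an arbitrary linear functional of $q$ for the moments on each edge and on each triangle) there is exactly one $u\in\Sigma_h^{k+1}(Q)$ whose DOFs take these values. 2. ($H^2$-conformity.) Let $\Omega\subset\mathbb R^2$ be an open set with a conforming partition into finitely many convex quadrilaterals $Q_1,\dots,Q_N$: $\overline\Omega=\bigcup_j\overline{Q_j}$, and two different closed quadrilaterals are disjoint or meet exactly in a common vertex or exactly in a common edge. Fix a unit normal $\bm n_e$ for every edge $e$ of the partition. If $u_j\in\Sigma_h^{k+1}(Q_j)$, $j=1,\dots,N$,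 are such that the vertex DOFs of the $u_j$ agree at every common vertex and the edge DOFs agree on every common edge, then there is a function $w\in H^2(\Omega)$ with $w=u_j$ on $\overline{Q_j}$ for all $j$. -/

import Mathlib

open MeasureTheory Set
open scoped ContDiff

noncomputable section

namespace CrissCross

/-- The Euclidean plane `ℝ²`. -/
abbrev Plane : Type := EuclideanSpace ℝ (Fin 2)

/-! ### Sobolev space `H²` via weak derivatives -/

/-- `g` is a weak partial derivative of `u` in the `i`-th coordinate direction on the open set
`U`: `∫_U u ∂ᵢφ = - ∫_U g φ` for all smooth `φ` with compact support in `U`. -/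
def IsWeakPartial (U : Set Plane) (i : Fin 2) (u g : Plane → ℝ) : Prop :=
  ∀ φ : Plane → ℝ, ContDiff ℝ ∞ φ → HasCompactSupport φ → tsupport φ ⊆ U →
    ∫ x in U, u x * fderiv ℝ φ x (EuclideanSpace.single i 1) = - ∫ x in U, g x * φ x

/-- `u ∈ H²(U)`: `u` and its weak partial derivatives of orders one and two are
square integrable on the open set `U`. -/
def MemH2 (U : Set Plane) (u : Plane → ℝ) : Prop :=
  MemLp u 2 (volume.restrict U) ∧
  ∃ (g : Fin 2 → Plane → ℝ) (h : Fin 2 → Fin 2 → Plane → ℝ),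
    (∀ i, MemLp (g i) 2 (volume.restrict U) ∧ IsWeakPartial U i u (g i)) ∧
    (∀ i j, MemLp (h i j) 2 (volume.restrict U) ∧ IsWeakPartial U j (g i) (h i j))

/-! ### Polynomials -/

/-- `P_r`: real polynomials in two variables of total degree at most `r`.
The integer `r` may be negative, and then `P_r = 0`. -/
def Poly (r : ℤ) : Submodule ℝ (MvPolynomial (Fin 2) ℝ) :=
  MvPolynomial.restrictSupport ℝ {s | (s.degree : ℤ) ≤ r}

/-- The value of a polynomial at a point of the plane. -/
def evalAt (x : Plane) (p : MvPolynomial (Fin 2) ℝ) : ℝ :=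
  MvPolynomial.eval (fun j => x j) p

/-! ### Convex quadrilaterals and their criss-cross triangulation -/

/-- A (nondegenerate, strictly) convex quadrilateral with its vertices in cyclic order and the
intersection point `center` of its two diagonals `[v₀, v₂]` and `[v₁, v₃]`.  A quadrilateral is
convex iff its diagonals cross; `center` is determined by the vertices. -/
structure ConvexQuad where
  /-- the vertices, in cyclic order -/
  v : Fin 4 → Plane
  /-- the intersection point of the diagonals -/
  center : Plane
  center_mem_diag02 : center ∈ openSegment ℝ (v 0) (v 2)
  center_mem_diag13 : center ∈ openSegment ℝ (v 1) (v 3)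
  diag_indep : LinearIndependent ℝ ![v 2 - v 0, v 3 - v 1]

/-- The vertices `(-1,-1), (1,-1), (1,1), (-1,1)` of the reference square; its diagonals meet
at the origin. -/
def refVertex : Fin 4 → Plane :=
  ![!₂[-1, -1], !₂[1, -1], !₂[1, 1], !₂[-1, 1]]

/-- `∫_{[a,b]} f ds`, the integral of `f` over the segment `[a, b]` with respect to arc length. -/
def segIntegral (a b : Plane) (f : Plane → ℝ) : ℝ :=
  dist a b * ∫ t in (0 : ℝ)..1, f (AffineMap.lineMap a b t)

namespace ConvexQuad

variable (Q : ConvexQuad)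

/-- The closed quadrilateral. -/
def carrier : Set Plane := convexHull ℝ (range Q.v)

/-- The edge `e_i`, as a closed segment. -/
def edge (i : Fin 4) : Set Plane := segment ℝ (Q.v i) (Q.v (i + 1))

/-- The length `|e_i|`. -/
def edgeLength (i : Fin 4) : ℝ := dist (Q.v i) (Q.v (i + 1))

/-- `∫_{e_i} f ds`. -/
def edgeIntegral (i : Fin 4) (f : Plane → ℝ) : ℝ := segIntegral (Q.v i) (Q.v (i + 1)) f

/-- The four (closed) triangles into which the diagonals split the quadrilateral; the `i`-th one
has `e_i` as an edge and the center as the opposite vertex. -/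
def tri (i : Fin 4) : Set Plane := convexHull ℝ {Q.center, Q.v i, Q.v (i + 1)}

/-- `n` is a unit normal vector to the edge `e_i` (of either orientation). -/
def IsUnitNormal (i : Fin 4) (n : Plane) : Prop :=
  ‖n‖ = 1 ∧ inner ℝ n (Q.v (i + 1) - Q.v i) = 0

/-- The affine map `F_i` of the plane which takes the `i`-th triangle of the reference square
`(-1,1)²` onto the `i`-th triangle of `Q`: it maps the origin to the center, and the reference
vertices number `i` and `i+1` (which are orthogonal, of length `√2`) to the corresponding vertices
of `Q`.  The piecewise affine map `F_Q` is `F_i` on the `i`-th reference triangle. -/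
def refMap (i : Fin 4) (x : Plane) : Plane :=
  Q.center + (inner ℝ x (refVertex i) / 2) • (Q.v i - Q.center)
    + (inner ℝ x (refVertex (i + 1)) / 2) • (Q.v (i + 1) - Q.center)

/-- The space of functions `q = q̂ ∘ F_Q⁻¹` on `D`, with `q̂` a polynomial of degree at most `r`,
where `D` is a subset of the `i`-th closed triangle (it will be the triangle or the edge `e_i`).
A function on `D` is represented by its extension by zero to the plane. -/
def testSpace (i : Fin 4) (D : Set Plane) (r : ℤ) : Submodule ℝ (Plane → ℝ) where
  carrier := {q | (∀ x ∉ D, q x = 0) ∧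
    ∃ p ∈ Poly r, ∀ y : Plane, Q.refMap i y ∈ D → q (Q.refMap i y) = evalAt y p}
  zero_mem' := ⟨fun _ _ => rfl, 0, Submodule.zero_mem _, fun y _ => by simp [evalAt]⟩
  add_mem' := by
    rintro q₁ q₂ ⟨h₁, p₁, hp₁, e₁⟩ ⟨h₂, p₂, hp₂, e₂⟩
    refine ⟨fun x hx => by simp [h₁ x hx, h₂ x hx], p₁ + p₂, Submodule.add_mem _ hp₁ hp₂,
      fun y hy => ?_⟩
    have a₁ := e₁ y hy
    have a₂ := e₂ y hy
    simp only [Pi.add_apply, a₁, a₂, evalAt, map_add]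
  smul_mem' := by
    rintro c q ⟨h, p, hp, e⟩
    refine ⟨fun x hx => by simp [h x hx], c • p, Submodule.smul_mem _ c hp, fun y hy => ?_⟩
    have a := e y hy
    simp only [Pi.smul_apply, a, evalAt, smul_eq_mul, MvPolynomial.smul_eval]

/-- The test functions `q = q̂ ∘ F_Q⁻¹`, `q̂ ∈ P_r(ê_i)`, on the edge `e_i`. -/
abbrev edgeTest (i : Fin 4) (r : ℤ) : Submodule ℝ (Plane → ℝ) := Q.testSpace i (Q.edge i) r

/-- The test functions `q = q̂ ∘ F_Q⁻¹`, `q̂ ∈ P_r(T̂_i)`, on the triangle `T_i`. -/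
abbrev triTest (i : Fin 4) (r : ℤ) : Submodule ℝ (Plane → ℝ) := Q.testSpace i (Q.tri i) r

/-- The macro-element space
`Σ_h^{k+1}(Q) = {u ∈ H²(Q) : u|_T ∈ P_{k+1}(T) for the four triangles T}`.
A member is represented by its continuous representative on the closed quadrilateral (so that it is
a polynomial on each closed triangle), extended by zero to the plane. -/
def Sigma (k : ℕ) : Set (Plane → ℝ) :=
  {u | (∀ x ∉ Q.carrier, u x = 0) ∧ MemH2 (interior Q.carrier) u ∧
    ∀ i, ∃ p ∈ Poly ((k : ℤ) + 1), ∀ x ∈ Q.tri i, u x = evalAt x p}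

/-! ### Degrees of freedom -/

/-- The derivative of `u` at a point `x` of the closed quadrilateral in the direction `d`
(the derivative being taken relative to the closed quadrilateral). -/
def deriv (u : Plane → ℝ) (x d : Plane) : ℝ := fderivWithin ℝ u Q.carrier x d

/-- The moment `∫_{e_i} ∂_n u q ds` of the derivative in direction `n`. -/
def normalMoment (i : Fin 4) (n : Plane) (u q : Plane → ℝ) : ℝ :=
  Q.edgeIntegral i fun x => Q.deriv u x n * q x

/-- The moment `|e_i|⁻¹ ∫_{e_i} u q ds`. -/
def valueMoment (i : Fin 4) (u q : Plane → ℝ) : ℝ :=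
  (Q.edgeLength i)⁻¹ * Q.edgeIntegral i fun x => u x * q x

/-- The moment `|T_i|⁻¹ ∫_{T_i} u q dA`. -/
def triMoment (i : Fin 4) (u q : Plane → ℝ) : ℝ :=
  (volume.real (Q.tri i))⁻¹ * ∫ x in Q.tri i, u x * q x

/-- A choice of values for all the degrees of freedom.  The moments against a finite dimensional
space of test functions `q` amount to a linear functional on that space. -/
structure DofData (k : ℕ) where
  value : Fin 4 → ℝ
  dx : Fin 4 → ℝ
  dy : Fin 4 → ℝ
  normal : ∀ i, Module.Dual ℝ (Q.edgeTest i ((k : ℤ) - 2))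
  edgeValue : ∀ i, Module.Dual ℝ (Q.edgeTest i ((k : ℤ) - 3))
  inner : ∀ i, Module.Dual ℝ (Q.triTest i ((k : ℤ) - 3))

/-- The degrees of freedom of `u` take the prescribed values; `n i` is the chosen unit normal
of `e_i`. -/
structure HasDofs (k : ℕ) (n : Fin 4 → Plane) (u : Plane → ℝ) (d : Q.DofData k) : Prop where
  value : ∀ i, u (Q.v i) = d.value i
  dx : ∀ i, Q.deriv u (Q.v i) (EuclideanSpace.single 0 1) = d.dx i
  dy : ∀ i, Q.deriv u (Q.v i) (EuclideanSpace.single 1 1) = d.dy i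
  normal : ∀ i, ∀ q : Q.edgeTest i ((k : ℤ) - 2), Q.normalMoment i (n i) u q = d.normal i q
  edgeValue : ∀ i, ∀ q : Q.edgeTest i ((k : ℤ) - 3), Q.valueMoment i u q = d.edgeValue i q
  inner : ∀ i, ∀ q : Q.triTest i ((k : ℤ) - 3), Q.triMoment i u q = d.inner i q

end ConvexQuad

/-! ### Quadrilateral meshes and gluing by degrees of freedom -/

/-- A conforming partition of `Ω` into `N` convex quadrilaterals: the closed quadrilaterals cover
the closure of `Ω`, and two different ones are disjoint, or meet exactly in a common vertex, or meet
exactly in a common edge. -/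
structure QuadMesh (Ω : Set Plane) (N : ℕ) where
  quad : Fin N → ConvexQuad
  closure_eq : closure Ω = ⋃ j, (quad j).carrier
  conforming : ∀ j j', j ≠ j' →
    (quad j).carrier ∩ (quad j').carrier = ∅ ∨
    (∃ a b, (quad j).v a = (quad j').v b ∧
      (quad j).carrier ∩ (quad j').carrier = {(quad j).v a}) ∨
    (∃ a b, (quad j).edge a = (quad j').edge b ∧
      (quad j).carrier ∩ (quad j').carrier = (quad j).edge a)

/-- Functions `u j` on the quadrilaterals of a mesh have single-valued degrees of freedom: at a
common vertex the values and the first partial derivatives agree, and on a common edge `e` the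
moments of the normal derivative and of the value agree.  `n e` is the fixed unit normal
of the edge `e`. -/
structure SingleValuedDofs {Ω : Set Plane} {N : ℕ} (M : QuadMesh Ω N) (k : ℕ)
    (n : Set Plane → Plane) (u : Fin N → Plane → ℝ) : Prop where
  value : ∀ j j' a b, (M.quad j).v a = (M.quad j').v b →
    u j ((M.quad j).v a) = u j' ((M.quad j').v b)
  grad : ∀ j j' a b, (M.quad j).v a = (M.quad j').v b → ∀ i : Fin 2,
    (M.quad j).deriv (u j) ((M.quad j).v a) (EuclideanSpace.single i 1) =
      (M.quad j').deriv (u j') ((M.quad j').v b) (EuclideanSpace.single i 1)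
  normal : ∀ j j' a b, (M.quad j).edge a = (M.quad j').edge b →
    ∀ q ∈ (M.quad j).edgeTest a ((k : ℤ) - 2),
      (M.quad j).normalMoment a (n ((M.quad j).edge a)) (u j) q =
        (M.quad j').normalMoment b (n ((M.quad j').edge b)) (u j') q
  edgeValue : ∀ j j' a b, (M.quad j).edge a = (M.quad j').edge b →
    ∀ q ∈ (M.quad j).edgeTest a ((k : ℤ) - 3),
      (M.quad j).valueMoment a (u j) q = (M.quad j').valueMoment b (u j') q

end CrissCross

end

noncomputable section

namespace CrissCross

/-! Up to extension by zero, the members of `Sigma` are exactly the C¹ piecewise polynomials of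
degree `k + 1` on the criss-cross division. In one direction, an H² function that is smooth up to a
line from both sides has no jump of its gradient (`fderiv_eq_of_memH2`): if a first derivative
jumped by `β`, testing with `ψ / β` for a bump `ψ` centred on the line would leave, after
integration by parts, a nonzero multiple of the integral of `ψ` along the line. In the other
direction, smooth pieces with matching values and gradients, whose sides lie on finitely many lines,
form an H² function (`IsGlued.memH2`): by Fubini, integration by parts reduces to the fundamental
theorem of calculus on lines with finitely many exceptional points.

Uniqueness. Let all DOFs vanish. On an edge the value has double zeros at both ends and the normal
derivative has simple zeros there; the edge moments kill exactly what remains, so each piece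
vanishes to second order on its outer edge (`eq_zero_on_edge`). In the coordinates `(x, y)` spanned
by the two arms of a triangle, the piece is therefore `(1 - x - y)² q` with `q` of degree `k - 1`.
The C¹ conditions across the four half diagonals link the coefficients of the four cofactors `q`
cyclically, and the shape of `Q` enters only through the ratios in which the center divides the
diagonals. Together with the triangle means when `k = 3`, these relations force `q = 0`
(`quartic_eq_zero_of_homogeneous`).

Existence is a dimension count. If `s = 0` and `t = 0` are the diagonals, the functions `P + s₋² A +
t₋² B + s₋² t₋² C` are C¹ and have 16 parameters for `k = 2` and 28 for `k = 3`, at least the number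
of DOFs. By uniqueness the DOF map on the parameters is injective, hence bijective.

Conformity. `eq_zero_on_edge`, applied to the difference of two pieces sharing an edge, shows that
values and gradients agree along it. The triangles of the whole mesh then form a single glued
family, and `IsGlued.memH2` applies again. -/

/-! ### Frames of the plane -/

/-- The determinant of two vectors of the plane. -/
def cross (a b : Plane) : ℝ := a 0 * b 1 - a 1 * b 0

/-- `cross a` as a continuous linear functional. -/
def crossL (a : Plane) : Plane →L[ℝ] ℝ :=
  a 0 • EuclideanSpace.proj (𝕜 := ℝ) 1 - a 1 • EuclideanSpace.proj (𝕜 := ℝ) 0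

@[simp] lemma crossL_apply (a b : Plane) : crossL a b = cross a b := by
  simp [crossL, cross]

lemma cross_self (a : Plane) : cross a a = 0 := by simp [cross]; ring

lemma cross_swap (a b : Plane) : cross b a = -cross a b := by simp [cross]; ring

/-- The first coordinate with respect to the basis `a, b`. -/
def coordX (a b : Plane) : Plane →L[ℝ] ℝ := -(cross a b)⁻¹ • crossL b

/-- The second coordinate with respect to the basis `a, b`. -/
def coordY (a b : Plane) : Plane →L[ℝ] ℝ := (cross a b)⁻¹ • crossL a

lemma coord_spec {a b : Plane} (h : cross a b ≠ 0) (v : Plane) :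
    coordX a b v • a + coordY a b v • b = v := by
  ext i
  simp only [coordX, coordY, smul_apply, crossL_apply, smul_eq_mul, PiLp.add_apply,
    PiLp.smul_apply]
  field_simp
  fin_cases i <;> simp [cross] <;> ring

lemma coordX_comb {a b : Plane} (h : cross a b ≠ 0) (x y : ℝ) :
    coordX a b (x • a + y • b) = x := by
  simp only [coordX, smul_apply, crossL_apply, smul_eq_mul]
  field_simp
  simp [cross]; ring

lemma coordY_comb {a b : Plane} (h : cross a b ≠ 0) (x y : ℝ) :
    coordY a b (x • a + y • b) = y := by
  simp only [coordY, smul_apply, crossL_apply, smul_eq_mul]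
  field_simp
  simp [cross]; ring

/-- The linear isomorphism `(x, y) ↦ x a + y b` for a basis `a, b`. -/
def frameEquiv (a b : Plane) (h : cross a b ≠ 0) : (ℝ × ℝ) ≃L[ℝ] Plane :=
  ContinuousLinearEquiv.equivOfInverse
    ((ContinuousLinearMap.fst ℝ ℝ ℝ).smulRight a + (ContinuousLinearMap.snd ℝ ℝ ℝ).smulRight b)
    ((coordX a b).prod (coordY a b))
    (fun z => by
      have h1 := coordX_comb h z.1 z.2
      have h2 := coordY_comb h z.1 z.2
      ext
      · simpa using h1
      · simpa using h2)
    (fun v => by simpa using coord_spec h v)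

@[simp] lemma frameEquiv_apply (a b : Plane) (h : cross a b ≠ 0) (z : ℝ × ℝ) :
    frameEquiv a b h z = z.1 • a + z.2 • b := by
  simp [frameEquiv, ContinuousLinearEquiv.equivOfInverse]

/-- Uniqueness of Haar measure. The value of the constant never matters: the resulting integral
formulas only serve to decide whether an integral is zero. -/
lemma exists_volume_eq (a b : Plane) (h : cross a b ≠ 0) :
    ∃ C : ENNReal, C ≠ 0 ∧ C ≠ ⊤ ∧
      (volume : Measure Plane) = C • (volume : Measure (ℝ × ℝ)).map (frameEquiv a b h) := by
  have h1 := Measure.isAddLeftInvariant_eq_smul (volume : Measure Plane)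
    ((volume : Measure (ℝ × ℝ)).map (frameEquiv a b h))
  have h2 := Measure.addHaarScalarFactor_pos_of_isAddHaarMeasure (volume : Measure Plane)
    ((volume : Measure (ℝ × ℝ)).map (frameEquiv a b h))
  exact ⟨_, by exact_mod_cast h2.ne', ENNReal.coe_ne_top, h1⟩

/-- Integration in the coordinates of a frame. -/
lemma exists_integral_eq (a b : Plane) (h : cross a b ≠ 0) :
    ∃ C : ℝ, 0 < C ∧ ∀ f : Plane → ℝ,
      ∫ x, f x = C * ∫ z : ℝ × ℝ, f (z.1 • a + z.2 • b) := by
  obtain ⟨C, h1, h2, h3⟩ := exists_volume_eq a b h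
  refine ⟨C.toReal, ENNReal.toReal_pos h1 h2, fun f => ?_⟩
  rw [h3, integral_smul_measure]
  have := (frameEquiv a b h).toHomeomorph.measurableEmbedding.integral_map
    (μ := (volume : Measure (ℝ × ℝ))) f
  rw [smul_eq_mul]
  congr 1

lemma integrable_frame {a b : Plane} (h : cross a b ≠ 0) {f : Plane → ℝ} (hf : Integrable f) :
    Integrable fun z : ℝ × ℝ => f (z.1 • a + z.2 • b) := by
  obtain ⟨C, h1, h2, h3⟩ := exists_volume_eq a b h
  rw [h3, integrable_smul_measure h1 h2] at hf
  have := ((frameEquiv a b h).toHomeomorph.measurableEmbedding.integrable_map_iff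
    (μ := (volume : Measure (ℝ × ℝ)))).1 hf
  simpa [Function.comp_def] using this

lemma measure_line_eq_zero {l : Plane →L[ℝ] ℝ} (hl : l ≠ 0) (c : ℝ) :
    volume {x : Plane | l x = c} = 0 := by
  have h0 : ∃ v, l v ≠ 0 := by
    by_contra! h
    exact hl (by ext v; simpa using h v)
  obtain ⟨v, hv⟩ := h0
  have : {x : Plane | l x = c} =
      (AffineSubspace.mk' ((c / l v) • v) (LinearMap.ker (l : Plane →ₗ[ℝ] ℝ)) : Set Plane) := by
    ext x
    simp [AffineSubspace.mem_mk', sub_eq_zero, hv]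
  rw [this]
  apply Measure.addHaar_affineSubspace
  intro h
  have h2 := congrArg AffineSubspace.direction h
  rw [AffineSubspace.direction_mk', AffineSubspace.direction_top] at h2
  have : v ∈ LinearMap.ker (l : Plane →ₗ[ℝ] ℝ) := by rw [h2]; trivial
  exact hv (by simpa using this)

lemma ae_off_lines {κ : Type*} [Finite κ] {l : κ → Plane →L[ℝ] ℝ} (hl : ∀ i, l i ≠ 0)
    (c : κ → ℝ) : ∀ᵐ x : Plane, ∀ i, l i x ≠ c i := by
  rw [ae_all_iff]
  intro i
  rw [ae_iff]
  simpa using measure_line_eq_zero (hl i) (c i)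

/-! ### Integration of derivatives -/

lemma integral_eq_zero_of_hasDerivAt_off_countable {f f' : ℝ → ℝ} {s : Set ℝ} (hs : s.Countable)
    (hf : Continuous f) (hd : ∀ t ∉ s, HasDerivAt f (f' t) t) {R : ℝ}
    (h0 : ∀ t, R ≤ |t| → f t = 0) (h0' : ∀ t, R ≤ |t| → f' t = 0) (hi : Integrable f') :
    ∫ t, f' t = 0 := by
  -- The bound `|R|` keeps the interval correctly oriented even if `R` is negative.
  have hsub : Function.support f' ⊆ Ioc (-|R|) |R| := by
    intro t ht
    have : |t| < R := by
      by_contra! h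
      exact ht (h0' t h)
    have h2 := abs_lt.1 (this.trans_le (le_abs_self R))
    exact ⟨h2.1, h2.2.le⟩
  rw [← setIntegral_eq_integral_of_forall_compl_eq_zero
    (fun t ht => by_contra fun h => ht (hsub h)),
    ← intervalIntegral.integral_of_le (by linarith [abs_nonneg R]),
    integral_eq_of_hasDerivAt_off_countable f f' hs hf.continuousOn (fun t ht => hd t ht.2)
      hi.intervalIntegrable,
    h0 _ (by simp [le_abs_self]), h0 _ (by simp [le_abs_self]), sub_zero]

lemma exists_cross_ne_zero {e : Plane} (he : e ≠ 0) : ∃ e', cross e' e ≠ 0 := by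
  by_contra! h
  apply he
  have h0 := h (EuclideanSpace.single 0 1)
  have h1 := h (EuclideanSpace.single 1 1)
  ext i
  fin_cases i
  · simpa [cross] using h1
  · simpa [cross] using h0

lemma exists_slice_bound {a b : Plane} (h : cross a b ≠ 0) {K : Set Plane} (hK : IsCompact K) :
    ∃ R : ℝ, ∀ y t : ℝ, R ≤ |t| → y • a + t • b ∉ K := by
  obtain ⟨R, hR⟩ := (hK.image (coordY a b).continuous).isBounded.exists_norm_le
  refine ⟨R + 1, fun y t ht hmem => ?_⟩
  have := hR _ ⟨_, hmem, rfl⟩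
  rw [coordY_comb h, Real.norm_eq_abs] at this
  linarith

/-- A compactly supported continuous function which is differentiable off finitely many lines has
directional derivatives of integral zero. -/
lemma integral_fderiv_eq_zero {κ : Type*} [Finite κ] {l : κ → Plane →L[ℝ] ℝ} (hl : ∀ i, l i ≠ 0)
    {c : κ → ℝ} {f D : Plane → ℝ} {e : Plane} (he : e ≠ 0) (hf : Continuous f) {K : Set Plane}
    (hK : IsCompact K) (hfK : ∀ x ∉ K, f x = 0) (hDK : ∀ x ∉ K, D x = 0)
    (hd : ∀ x, (∀ i, l i x ≠ c i) → DifferentiableAt ℝ f x ∧ D x = fderiv ℝ f x e)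
    (hD : Integrable D) : ∫ x, D x = 0 := by
  obtain ⟨e', hcr⟩ := exists_cross_ne_zero he
  obtain ⟨C, -, hC⟩ := exists_integral_eq e' e hcr
  obtain ⟨R, hR⟩ := exists_slice_bound hcr hK
  have hint := integrable_frame hcr hD
  rw [hC, Measure.volume_eq_prod, integral_prod _ hint]
  -- An exceptional line parallel to `e` contains a whole slice, but this happens for one value of
  -- `y` only.
  have hslice : ∀ᵐ y : ℝ, ∀ i, l i e = 0 → y * l i e' ≠ c i := by
    rw [ae_all_iff]
    intro i
    by_cases h0 : l i e = 0
    · have h1 : l i e' ≠ 0 := by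
        intro h1
        apply hl i
        ext v
        rw [← coord_spec hcr v]
        simp [h0, h1]
      have : {y : ℝ | ¬ (l i e = 0 → y * l i e' ≠ c i)} ⊆ {c i / l i e'} := by
        intro y hy
        simp only [mem_ofPred_eq, Classical.not_imp, not_not] at hy
        simp [← hy.2, h1]
      exact measure_mono_null this (by simp)
    · simp [h0]
  have hzero : ∀ᵐ y : ℝ, ∫ t : ℝ, D (y • e' + t • e) = 0 := by
    have hright : ∀ᵐ y : ℝ, Integrable fun t : ℝ => D (y • e' + t • e) :=
      Integrable.prod_right_ae (f := fun z : ℝ × ℝ => D (z.1 • e' + z.2 • e)) hint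
    filter_upwards [hslice, hright] with y hy hyi
    -- Each exceptional line not parallel to `e` meets the slice in at most one point, so the
    -- fundamental theorem of calculus with a countable exceptional set applies on the slice.
    have hcount : {t : ℝ | ∃ i, l i (y • e' + t • e) = c i}.Countable := by
      have : {t : ℝ | ∃ i, l i (y • e' + t • e) = c i} = ⋃ i, {t | l i (y • e' + t • e) = c i} := by
        ext; simp
      rw [this]
      refine countable_iUnion fun i => ?_
      by_cases h0 : l i e = 0
      · have : {t : ℝ | l i (y • e' + t • e) = c i} = ∅ := by
          ext t
          simpa [h0] using hy i h0
        rw [this]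
        exact countable_empty
      · refine (countable_singleton ((c i - y * l i e') / l i e)).mono fun t ht => ?_
        simp only [map_add, map_smul, smul_eq_mul, mem_ofPred_eq] at ht
        rw [mem_singleton_iff, eq_div_iff h0]
        linarith
    refine integral_eq_zero_of_hasDerivAt_off_countable (f := fun t => f (y • e' + t • e))
      hcount (by fun_prop) ?_ (R := R) (fun t ht => hfK _ (hR y t ht))
      (fun t ht => hDK _ (hR y t ht)) hyi
    intro t ht
    simp only [mem_ofPred_eq, not_exists] at ht
    obtain ⟨h1, h2⟩ := hd _ ht
    rw [h2]
    have h3 : HasDerivAt (fun t : ℝ => y • e' + t • e) e t := by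
      simpa using ((hasDerivAt_id t).smul_const e).const_add (y • e')
    exact h1.hasFDerivAt.comp_hasDerivAt t h3
  simp only [integral_congr_ae hzero, integral_zero, mul_zero]

lemma continuous_mul_of_tsupport_subset {U : Set Plane} (hU : IsOpen U) {w φ : Plane → ℝ}
    (hw : ContinuousOn w U) (hφ : Continuous φ) (hs : tsupport φ ⊆ U) :
    Continuous fun x => w x * φ x := by
  rw [continuous_iff_continuousAt]
  intro x
  by_cases hx : x ∈ U
  · exact (hw.continuousAt (hU.mem_nhds hx)).mul hφ.continuousAt
  · have : (fun x => w x * φ x) =ᶠ[nhds x] fun _ => 0 := by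
      filter_upwards [notMem_tsupport_iff_eventuallyEq.1 fun h => hx (hs h)] with y hy
      simp [hy]
    exact continuousAt_const.congr this.symm

lemma single_ne_zero (k : Fin 2) : (EuclideanSpace.single k 1 : Plane) ≠ 0 := by
  simp

/-- A continuous function on an open set which is differentiable with bounded derivative off
finitely many lines has weak partial derivatives given by its classical ones. -/
theorem isWeakPartial_fderiv {κ : Type*} [Finite κ] {l : κ → Plane →L[ℝ] ℝ} (hl : ∀ i, l i ≠ 0)
    {c : κ → ℝ} {U : Set Plane} (hU : IsOpen U) {w : Plane → ℝ} (hw : ContinuousOn w U)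
    (hd : ∀ x ∈ U, (∀ i, l i x ≠ c i) → DifferentiableAt ℝ w x) {M : ℝ}
    (hM : ∀ x ∈ U, (∀ i, l i x ≠ c i) → ‖fderiv ℝ w x‖ ≤ M) (k : Fin 2) :
    IsWeakPartial U k w fun x => fderiv ℝ w x (EuclideanSpace.single k 1) := by
  intro φ hφ hcs hs
  set e : Plane := EuclideanSpace.single k 1 with he_def
  have hφc := hφ.continuous
  have hφ' : Continuous fun x => fderiv ℝ φ x e :=
    (hφ.continuous_fderiv (by simp)).clm_apply continuous_const
  have hcs' : HasCompactSupport fun x => fderiv ℝ φ x e := hcs.fderiv_apply ℝ e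
  have hs' : tsupport (fun x => fderiv ℝ φ x e) ⊆ tsupport φ := tsupport_fderiv_apply_subset ℝ e
  have hφ0 : ∀ x ∉ tsupport φ, φ x = 0 := fun x hx => image_eq_zero_of_notMem_tsupport hx
  have hφ0' : ∀ x ∉ tsupport φ, fderiv ℝ φ x e = 0 := fun x hx =>
    image_eq_zero_of_notMem_tsupport (f := fun x => fderiv ℝ φ x e) fun h => hx (hs' h)
  have hA : Integrable fun x => w x * fderiv ℝ φ x e :=
    (continuous_mul_of_tsupport_subset hU hw hφ' (hs'.trans hs)).integrable_of_hasCompactSupport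
      hcs'.mul_left
  have hB : Integrable fun x => fderiv ℝ w x e * φ x := by
    refine Integrable.mono' ((hφc.integrable_of_hasCompactSupport hcs).norm.const_mul (M * ‖e‖))
      ((measurable_fderiv_apply_const ℝ w e).mul hφc.measurable).aestronglyMeasurable ?_
    filter_upwards [ae_off_lines hl c] with x hx
    by_cases hxU : x ∈ U
    · rw [norm_mul]
      gcongr
      exact ((fderiv ℝ w x).le_opNorm e).trans (by gcongr; exact hM x hxU hx)
    · simp [hφ0 x fun h => hxU (hs h)]
  -- Off the lines the integrand is the derivative of `w φ`, which is continuous on the whole plane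
  -- since the support of `φ` lies inside `U`.
  have key : ∫ x, (w x * fderiv ℝ φ x e + fderiv ℝ w x e * φ x) = 0 := by
    refine integral_fderiv_eq_zero hl (c := c) (f := fun x => w x * φ x) (e := e)
      (single_ne_zero k) (continuous_mul_of_tsupport_subset hU hw hφc hs) hcs
      (fun x hx => by simp [hφ0 x hx]) (fun x hx => by simp [hφ0 x hx, hφ0' x hx]) ?_ (hA.add hB)
    intro x hx
    by_cases hxU : x ∈ U
    · have h1 := hd x hxU hx
      have h2 : DifferentiableAt ℝ φ x := hφ.differentiable (by simp) x
      refine ⟨h1.mul h2, ?_⟩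
      rw [fderiv_fun_mul h1 h2]
      simp [mul_comm]
    · have hx' : x ∉ tsupport φ := fun h => hxU (hs h)
      have : (fun x => w x * φ x) =ᶠ[nhds x] fun _ => 0 := by
        filter_upwards [notMem_tsupport_iff_eventuallyEq.1 hx'] with y hy
        simp [hy]
      refine ⟨(differentiableAt_const 0).congr_of_eventuallyEq this, ?_⟩
      rw [this.fderiv_eq]
      simp [hφ0 x hx', hφ0' x hx']
  rw [integral_add hA hB] at key
  rw [setIntegral_eq_integral_of_forall_compl_eq_zero
      (fun x hx => by simp [hφ0' x fun h => hx (hs h)]),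
    setIntegral_eq_integral_of_forall_compl_eq_zero
      (fun x hx => by simp [hφ0 x fun h => hx (hs h)])]
  linarith

/-! ### Gluing finitely many smooth functions -/

/-- Limits within `S` can be tested on each piece of a finite cover. With the next lemma, which
discards closed pieces missing `x`, this carries both continuity and differentiability of glued
functions. -/
lemma nhdsWithin_le_iSup_inter {ι : Type*} [Finite ι] {T : ι → Set Plane} {S : Set Plane}
    (hS : S ⊆ ⋃ i, T i) (x : Plane) : nhdsWithin x S ≤ ⨆ i, nhdsWithin x (S ∩ T i) := by
  rw [← nhdsWithin_iUnion, ← inter_iUnion, inter_eq_self_of_subset_left hS]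

lemma nhdsWithin_inter_eq_bot {S T : Set Plane} (hT : IsClosed T) {x : Plane} (hx : x ∉ T) :
    nhdsWithin x (S ∩ T) = ⊥ := by
  rw [← notMem_closure_iff_nhdsWithin_eq_bot]
  exact fun h => hx (hT.closure_subset (closure_mono inter_subset_right h))

lemma continuousOn_of_pieces {ι E : Type*} [Finite ι] [TopologicalSpace E] {T : ι → Set Plane}
    (hT : ∀ i, IsClosed (T i)) {S : Set Plane} (hS : S ⊆ ⋃ i, T i) {g : ι → Plane → E}
    (hg : ∀ i, Continuous (g i)) {G : Plane → E} (hG : ∀ i, ∀ x ∈ S, x ∈ T i → G x = g i x) :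
    ContinuousOn G S := by
  intro x hx
  refine Filter.Tendsto.mono_left (Filter.tendsto_iSup.2 fun i => ?_)
    (nhdsWithin_le_iSup_inter hS x)
  by_cases hxi : x ∈ T i
  · rw [hG i x hx hxi]
    refine Filter.Tendsto.congr' ?_ ((hg i).continuousAt.mono_left nhdsWithin_le_nhds)
    filter_upwards [self_mem_nhdsWithin] with y hy
    exact (hG i y hy.1 hy.2).symm
  · rw [nhdsWithin_inter_eq_bot (hT i) hxi]
    exact Filter.tendsto_bot

/-- A function given on closed pieces by smooth functions whose values and derivatives match. -/
structure IsGlued {ι : Type*} (T : ι → Set Plane) (f : ι → Plane → ℝ) (w : Plane → ℝ) : Prop where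
  isCompact : ∀ i, IsCompact (T i)
  contDiff : ∀ i, ContDiff ℝ ∞ (f i)
  eq : ∀ i, ∀ x ∈ T i, w x = f i x
  fderiv_eq : ∀ i j, ∀ x ∈ T i, x ∈ T j → fderiv ℝ (f i) x = fderiv ℝ (f j) x

namespace IsGlued

variable {ι : Type*} {T : ι → Set Plane} {f : ι → Plane → ℝ} {w : Plane → ℝ}

lemma isClosed (h : IsGlued T f w) (i : ι) : IsClosed (T i) := (h.isCompact i).isClosed

lemma continuous_fderiv (h : IsGlued T f w) (i : ι) : Continuous (fderiv ℝ (f i)) :=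
  (h.contDiff i).continuous_fderiv (by simp)

lemma contDiff_fderiv_apply (h : IsGlued T f w) (i : ι) (e : Plane) :
    ContDiff ℝ ∞ fun y => fderiv ℝ (f i) y e :=
  ((h.contDiff i).fderiv_right (m := ∞) (by simp)).clm_apply contDiff_const

variable [Finite ι]

/-- Differentiability is a limit, hence can be checked along each piece `T j` containing `x`. There
`w` is `f j`, whose derivative at `x` is the same for all such `j`. -/
lemma hasFDerivWithinAt (h : IsGlued T f w) {i : ι} {x : Plane} (hx : x ∈ T i) :
    HasFDerivWithinAt w (fderiv ℝ (f i) x) (⋃ i, T i) x := by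
  rw [hasFDerivWithinAt_iff_tendsto]
  refine Filter.Tendsto.mono_left (Filter.tendsto_iSup.2 fun j => ?_)
    (nhdsWithin_le_iSup_inter subset_rfl x)
  by_cases hxj : x ∈ T j
  · rw [← hasFDerivWithinAt_iff_tendsto, h.fderiv_eq i j x hx hxj]
    have h1 := (((h.contDiff j).differentiable (by simp)) x).hasFDerivAt.hasFDerivWithinAt
      (s := (⋃ i, T i) ∩ T j)
    exact h1.congr (fun y hy => h.eq j y hy.2) (h.eq j x hxj)
  · rw [nhdsWithin_inter_eq_bot (h.isClosed j) hxj]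
    exact Filter.tendsto_bot

lemma continuousOn (h : IsGlued T f w) : ContinuousOn w (⋃ i, T i) :=
  continuousOn_of_pieces h.isClosed subset_rfl (fun i => (h.contDiff i).continuous)
    fun i x _ hx => h.eq i x hx

lemma fderivWithin_eq (h : IsGlued T f w) (hu : UniqueDiffOn ℝ (⋃ i, T i)) {i : ι} {x : Plane}
    (hx : x ∈ T i) : fderivWithin ℝ w (⋃ i, T i) x = fderiv ℝ (f i) x :=
  (h.hasFDerivWithinAt hx).fderivWithin (hu x (mem_iUnion_of_mem i hx))

lemma contDiffOn (h : IsGlued T f w) (hu : UniqueDiffOn ℝ (⋃ i, T i)) :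
    ContDiffOn ℝ 1 w (⋃ i, T i) := by
  rw [← zero_add (1 : WithTop ℕ∞), contDiffOn_succ_iff_fderivWithin hu]
  refine ⟨fun x hx => ?_, by simp, contDiffOn_zero.2 ?_⟩
  · obtain ⟨i, hi⟩ := mem_iUnion.1 hx
    exact (h.hasFDerivWithinAt hi).differentiableWithinAt
  · exact continuousOn_of_pieces h.isClosed subset_rfl h.continuous_fderiv
      fun i x _ hx => h.fderivWithin_eq hu hx

lemma hasFDerivAt (h : IsGlued T f w) {U : Set Plane} (hU : IsOpen U) (hUT : U ⊆ ⋃ i, T i)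
    {i : ι} {x : Plane} (hxU : x ∈ U) (hx : x ∈ T i) : HasFDerivAt w (fderiv ℝ (f i) x) x :=
  (h.hasFDerivWithinAt hx).hasFDerivAt (Filter.mem_of_superset (hU.mem_nhds hxU) hUT)

lemma continuousOn_fderiv (h : IsGlued T f w) {U : Set Plane} (hU : IsOpen U)
    (hUT : U ⊆ ⋃ i, T i) : ContinuousOn (fderiv ℝ w) U :=
  continuousOn_of_pieces h.isClosed hUT h.continuous_fderiv
    fun _ _ hxU hx => (h.hasFDerivAt hU hUT hxU hx).fderiv

lemma hasFDerivAt_fderiv_apply (h : IsGlued T f w) {U : Set Plane} (hU : IsOpen U)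
    (hUT : U ⊆ ⋃ i, T i) {i : ι} {x : Plane} (hxU : x ∈ U) (hx : x ∈ interior (T i)) (e : Plane) :
    HasFDerivAt (fun y => fderiv ℝ w y e) (fderiv ℝ (fun y => fderiv ℝ (f i) y e) x) x := by
  have h1 := ((h.contDiff_fderiv_apply i e).differentiable (by simp) x).hasFDerivAt
  refine h1.congr_of_eventuallyEq ?_
  filter_upwards [hU.mem_nhds hxU, isOpen_interior.mem_nhds hx] with y hy1 hy2
  rw [(h.hasFDerivAt hU hUT hy1 (interior_subset hy2)).fderiv]

end IsGlued

lemma exists_bound_of_pieces {ι E : Type*} [Finite ι] [NormedAddCommGroup E] {T : ι → Set Plane}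
    (hT : ∀ i, IsCompact (T i)) {g : ι → Plane → E} (hg : ∀ i, Continuous (g i)) :
    ∃ M, ∀ i, ∀ x ∈ T i, ‖g i x‖ ≤ M := by
  choose M hM using fun i => (hT i).exists_bound_of_continuousOn (hg i).continuousOn
  obtain ⟨B, hB⟩ := Finite.bddAbove_range M
  exact ⟨B, fun i x hx => (hM i x hx).trans (hB ⟨i, rfl⟩)⟩

namespace IsGlued

variable {ι : Type*} [Finite ι] {T : ι → Set Plane} {f : ι → Plane → ℝ} {w : Plane → ℝ}

lemma isWeakPartial (h : IsGlued T f w) {U : Set Plane} (hU : IsOpen U)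
    (hUT : U ⊆ ⋃ i, T i) (k : Fin 2) :
    IsWeakPartial U k w fun x => fderiv ℝ w x (EuclideanSpace.single k 1) := by
  obtain ⟨M, hM⟩ := exists_bound_of_pieces h.isCompact h.continuous_fderiv
  -- A glued function is differentiable at every point of `U`, so first derivatives need no
  -- exceptional lines.
  refine isWeakPartial_fderiv (κ := Empty) (l := Empty.elim) (c := Empty.elim) (fun i => i.elim) hU
    (h.continuousOn.mono hUT) (fun x hx _ => ?_) (M := M) (fun x hx _ => ?_) k
  all_goals obtain ⟨i, hi⟩ := mem_iUnion.1 (hUT hx)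
  · exact (h.hasFDerivAt hU hUT hx hi).differentiableAt
  · rw [(h.hasFDerivAt hU hUT hx hi).fderiv]
    exact hM i x hi

/-- Glued functions whose pieces have boundaries on finitely many lines belong to `H²`. -/
theorem memH2 (h : IsGlued T f w) {U : Set Plane} (hU : IsOpen U)
    (hUT : U ⊆ ⋃ i, T i) {κ : Type*} [Finite κ] {l : κ → Plane →L[ℝ] ℝ} (hl : ∀ i, l i ≠ 0)
    {c : κ → ℝ} (hT : ∀ i, ∀ x ∈ T i, (∀ j, l j x ≠ c j) → x ∈ interior (T i)) : MemH2 U w := by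
  -- `U` is contained in a finite union of compact sets; on a set of finite measure, bounds on the
  -- function and its derivatives give square integrability.
  have hfin : IsFiniteMeasure (volume.restrict U) := by
    rw [isFiniteMeasure_restrict]
    exact ((measure_mono hUT).trans_lt (isCompact_iUnion h.isCompact).measure_lt_top).ne
  have hoff : ∀ᵐ x ∂(volume.restrict U), x ∈ U ∧ ∀ j, l j x ≠ c j := by
    filter_upwards [ae_restrict_mem hU.measurableSet, ae_restrict_of_ae (ae_off_lines hl c)]
      with x h1 h2 using ⟨h1, h2⟩
  obtain ⟨M0, hM0⟩ := exists_bound_of_pieces h.isCompact fun i => (h.contDiff i).continuous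
  obtain ⟨M1, hM1⟩ := exists_bound_of_pieces h.isCompact fun i => h.continuous_fderiv i
  have hcont : ∀ (i : ι) (k : Fin 2), Continuous
      (fderiv ℝ fun y => fderiv ℝ (f i) y (EuclideanSpace.single k 1)) := fun i k =>
    (h.contDiff_fderiv_apply i _).continuous_fderiv (by simp)
  choose M2 hM2 using fun k : Fin 2 => exists_bound_of_pieces h.isCompact fun i => hcont i k
  have hbound2 : ∀ (k : Fin 2), ∀ x ∈ U, (∀ j, l j x ≠ c j) →
      ‖fderiv ℝ (fun y => fderiv ℝ w y (EuclideanSpace.single k 1)) x‖ ≤ M2 k := by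
    intro k x hx hxl
    obtain ⟨i, hi⟩ := mem_iUnion.1 (hUT hx)
    rw [(h.hasFDerivAt_fderiv_apply hU hUT hx (hT i x hi hxl) _).fderiv]
    exact hM2 k i x hi
  refine ⟨?_, fun k x => fderiv ℝ w x (EuclideanSpace.single k 1), fun k j x =>
    fderiv ℝ (fun y => fderiv ℝ w y (EuclideanSpace.single k 1)) x (EuclideanSpace.single j 1),
    fun k => ⟨?_, h.isWeakPartial hU hUT k⟩, fun k j => ⟨?_, ?_⟩⟩
  · refine MemLp.of_bound ((h.continuousOn.mono hUT).aestronglyMeasurable hU.measurableSet) M0 ?_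
    filter_upwards [hoff] with x hx
    obtain ⟨i, hi⟩ := mem_iUnion.1 (hUT hx.1)
    rw [h.eq i x hi]
    exact hM0 i x hi
  · refine MemLp.of_bound (measurable_fderiv_apply_const ℝ w _).aestronglyMeasurable M1 ?_
    filter_upwards [hoff] with x hx
    obtain ⟨i, hi⟩ := mem_iUnion.1 (hUT hx.1)
    rw [(h.hasFDerivAt hU hUT hx.1 hi).fderiv]
    exact (ContinuousLinearMap.le_opNorm _ _).trans (by simpa using hM1 i x hi)
  · refine MemLp.of_bound (measurable_fderiv_apply_const ℝ _ _).aestronglyMeasurable (M2 k) ?_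
    filter_upwards [hoff] with x hx
    exact (ContinuousLinearMap.le_opNorm _ _).trans (by simpa using hbound2 k x hx.1 hx.2)
  -- The first derivatives of `w` are continuous across the interfaces, and off the lines every
  -- point is interior to a piece, where they are smooth with bounded gradient.
  · refine isWeakPartial_fderiv hl hU
      ((h.continuousOn_fderiv hU hUT).clm_apply continuousOn_const) (fun x hx hxl => ?_)
      (hbound2 k) j
    obtain ⟨i, hi⟩ := mem_iUnion.1 (hUT hx)
    exact (h.hasFDerivAt_fderiv_apply hU hUT hx (hT i x hi hxl) _).differentiableAt

end IsGlued

/-! ### Uniqueness and localization of weak derivatives -/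

lemma setIntegral_eq_of_tsupport {U V : Set Plane} {φ f : Plane → ℝ} (hU : tsupport φ ⊆ U)
    (hV : tsupport φ ⊆ V) (hf : ∀ x ∉ tsupport φ, f x = 0) :
    ∫ x in U, f x = ∫ x in V, f x := by
  rw [setIntegral_eq_integral_of_forall_compl_eq_zero fun x hx => hf x fun h => hx (hU h),
    setIntegral_eq_integral_of_forall_compl_eq_zero fun x hx => hf x fun h => hx (hV h)]

lemma fderiv_apply_eq_zero_of_notMem_tsupport {φ : Plane → ℝ} (e : Plane) {x : Plane}
    (hx : x ∉ tsupport φ) : fderiv ℝ φ x e = 0 :=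
  image_eq_zero_of_notMem_tsupport (f := fun x => fderiv ℝ φ x e)
    fun h => hx (tsupport_fderiv_apply_subset ℝ e h)

lemma IsWeakPartial.mono {U V : Set Plane} (hVU : V ⊆ U) {k : Fin 2} {u g : Plane → ℝ}
    (h : IsWeakPartial U k u g) : IsWeakPartial V k u g := by
  intro φ hφ hcs hs
  rw [setIntegral_eq_of_tsupport hs (hs.trans hVU) fun x hx => by
      simp [fderiv_apply_eq_zero_of_notMem_tsupport _ hx],
    setIntegral_eq_of_tsupport hs (hs.trans hVU) fun x hx => by
      simp [image_eq_zero_of_notMem_tsupport hx]]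
  exact h φ hφ hcs (hs.trans hVU)

lemma IsWeakPartial.congr_left {U : Set Plane} {k : Fin 2} {u u' g : Plane → ℝ}
    (h : IsWeakPartial U k u g) (hu : u =ᵐ[volume.restrict U] u') : IsWeakPartial U k u' g := by
  intro φ hφ hcs hs
  rw [← h φ hφ hcs hs]
  refine integral_congr_ae ?_
  filter_upwards [hu] with x hx
  rw [hx]

lemma MemH2.mono {U V : Set Plane} (hVU : V ⊆ U) {u : Plane → ℝ} (h : MemH2 U u) : MemH2 V u := by
  obtain ⟨h0, g, hh, h1, h2⟩ := h
  have hm : volume.restrict V ≤ volume.restrict U := Measure.restrict_mono hVU le_rfl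
  exact ⟨h0.mono_measure hm, g, hh, fun i => ⟨(h1 i).1.mono_measure hm, (h1 i).2.mono hVU⟩,
    fun i j => ⟨(h2 i j).1.mono_measure hm, (h2 i j).2.mono hVU⟩⟩

/-- The fundamental lemma of the calculus of variations, applied to `g - g'`. -/
lemma IsWeakPartial.ae_eq {U : Set Plane} (hU : IsOpen U) {k : Fin 2} {u g g' : Plane → ℝ}
    (h : IsWeakPartial U k u g) (h' : IsWeakPartial U k u g') (hg : IntegrableOn g U)
    (hg' : IntegrableOn g' U) : g =ᵐ[volume.restrict U] g' := by
  have key := hU.ae_eq_zero_of_integral_contDiff_smul_eq_zero (μ := volume)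
    (f := fun x => g x - g' x) (hg.sub hg').locallyIntegrableOn ?_
  · rw [Filter.EventuallyEq, ae_restrict_iff' hU.measurableSet]
    filter_upwards [key] with x hx hxU
    exact sub_eq_zero.1 (hx hxU)
  · intro φ hφ hcs hs
    obtain ⟨M, hM⟩ := hcs.exists_bound_of_continuous hφ.continuous
    have hi : ∀ {f : Plane → ℝ}, IntegrableOn f U → IntegrableOn (fun x => f x * φ x) U :=
      fun hf => hf.mul_bdd hφ.continuous.aestronglyMeasurable (Filter.Eventually.of_forall hM)
    have h0 : ∀ x ∉ U, φ x = 0 := fun x hx => image_eq_zero_of_notMem_tsupport fun h => hx (hs h)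
    have h1 := h φ hφ hcs hs
    rw [h' φ hφ hcs hs, neg_inj] at h1
    rw [← setIntegral_eq_integral_of_forall_compl_eq_zero (s := U)
      (fun x hx => by simp [h0 x hx])]
    have : ∀ x, φ x • (g x - g' x) = g x * φ x - g' x * φ x := fun x => by
      rw [smul_eq_mul]; ring
    simp_rw [this]
    rw [integral_sub (hi hg) (hi hg'), h1, sub_self]

/-! ### Jumps of weakly differentiable functions -/

/-- Integrating first along `b` over each half line leaves minus the trace of `ψ` on the boundary
line. This trace is continuous, nonnegative and nonzero at `x₀`, so its integral is positive. -/
lemma integral_halfplane_fderiv_ne_zero {a b : Plane} (hab : cross a b ≠ 0) {ψ : Plane → ℝ}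
    (hψ : ContDiff ℝ ∞ ψ) (hcs : HasCompactSupport ψ) (h0 : ∀ x, 0 ≤ ψ x) {x₀ : Plane}
    (hx₀ : ψ x₀ ≠ 0) :
    ∫ x in {x | coordY a b x₀ < coordY a b x}, fderiv ℝ ψ x b ≠ 0 := by
  set c := coordY a b x₀
  obtain ⟨C, hCpos, hC⟩ := exists_integral_eq a b hab
  have hmeas : MeasurableSet {x | c < coordY a b x} :=
    (isOpen_lt continuous_const (coordY a b).continuous).measurableSet
  have hint : Integrable ({x | c < coordY a b x}.indicator fun x => fderiv ℝ ψ x b) :=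
    (((hψ.continuous_fderiv (by simp)).clm_apply continuous_const).integrable_of_hasCompactSupport
      (hcs.fderiv_apply ℝ b)).indicator hmeas
  rw [← integral_indicator hmeas, hC, Measure.volume_eq_prod,
    integral_prod _ (integrable_frame hab hint)]
  have hslice : ∀ y : ℝ, ∫ t : ℝ, {x | c < coordY a b x}.indicator (fun x => fderiv ℝ ψ x b)
      (y • a + t • b) = -ψ (y • a + c • b) := by
    intro y
    have hd : ∀ t, HasDerivAt (fun t : ℝ => ψ (y • a + t • b)) (fderiv ℝ ψ (y • a + t • b) b) t := by
      intro t
      have h3 : HasDerivAt (fun t : ℝ => y • a + t • b) b t := by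
        simpa using ((hasDerivAt_id t).smul_const b).const_add (y • a)
      exact (hψ.differentiable (by simp) _).hasFDerivAt.comp_hasDerivAt t h3
    have hcs' : HasCompactSupport fun t : ℝ => ψ (y • a + t • b) := by
      obtain ⟨R, hR⟩ := exists_slice_bound hab hcs
      refine HasCompactSupport.intro (isCompact_Icc (a := -R) (b := R)) fun t ht => ?_
      refine image_eq_zero_of_notMem_tsupport (hR y t ?_)
      by_contra! hlt
      exact ht ⟨(abs_lt.1 hlt).1.le, (abs_lt.1 hlt).2.le⟩
    have hcd : ContDiff ℝ 1 fun t : ℝ => ψ (y • a + t • b) :=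
      (hψ.of_le (by exact_mod_cast le_top)).comp (by fun_prop)
    rw [← hcs'.integral_Ioi_deriv_eq hcd c,
      ← integral_indicator measurableSet_Ioi]
    congr 1
    ext t
    by_cases ht : c < t
    · rw [indicator_of_mem (by simpa [coordY_comb hab] using ht), indicator_of_mem (mem_Ioi.2 ht),
        (hd t).deriv]
    · rw [indicator_of_notMem (by simpa [coordY_comb hab] using ht),
        indicator_of_notMem (by simpa using ht)]
  simp only [hslice]
  rw [integral_neg, mul_ne_zero_iff, neg_ne_zero]
  refine ⟨hCpos.ne', ne_of_gt ?_⟩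
  refine Continuous.integral_pos_of_hasCompactSupport_nonneg_nonzero
    (x := coordX a b x₀) (hψ.continuous.comp (by fun_prop)) ?_ (fun y => h0 _) ?_
  · have hba : cross b a ≠ 0 := by rw [cross_swap]; simpa using hab
    obtain ⟨R, hR⟩ := exists_slice_bound hba hcs
    refine HasCompactSupport.intro (isCompact_Icc (a := -R) (b := R)) fun t ht => ?_
    rw [add_comm]
    refine image_eq_zero_of_notMem_tsupport (hR c t ?_)
    by_contra! hlt
    exact ht ⟨(abs_lt.1 hlt).1.le, (abs_lt.1 hlt).2.le⟩
  · rw [coord_spec hab]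
    exact hx₀

lemma isWeakPartial_of_contDiff {B : Set Plane} (hB : IsOpen B) {K : Set Plane} (hK : IsCompact K)
    (hBK : B ⊆ K) {F : Plane → ℝ} (hF : ContDiff ℝ ∞ F) (k : Fin 2) :
    IsWeakPartial B k F fun x => fderiv ℝ F x (EuclideanSpace.single k 1) := by
  obtain ⟨M, hM⟩ := hK.exists_bound_of_continuousOn (hF.continuous_fderiv (by simp)).continuousOn
  exact isWeakPartial_fderiv (κ := Empty) (l := Empty.elim) (c := Empty.elim) (fun i => i.elim) hB
    hF.continuous.continuousOn (fun x _ _ => hF.differentiable (by simp) x)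
    (fun x hx _ => hM x (hBK hx)) k

lemma integrableOn_of_continuous {B : Set Plane} {K : Set Plane} (hK : IsCompact K)
    (hBK : B ⊆ K) {F : Plane → ℝ} (hF : Continuous F) : IntegrableOn F B :=
  (hF.continuousOn.integrableOn_compact hK).mono_set hBK

/-- The test function is a bump divided by `β` near `x₀`, where `β` has no zero. With the jump as
`β`, the product of jump and test function then has a sign. -/
lemma exists_bump_of_ne_zero {β : Plane → ℝ} (hβ : ContDiff ℝ ∞ β) {x₀ : Plane} (h0 : β x₀ ≠ 0)
    {B : Set Plane} (hB : IsOpen B) (hx₀ : x₀ ∈ B) :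
    ∃ φ ψ : Plane → ℝ, ContDiff ℝ ∞ φ ∧ HasCompactSupport φ ∧ tsupport φ ⊆ B ∧
      ContDiff ℝ ∞ ψ ∧ HasCompactSupport ψ ∧ (∀ x, 0 ≤ ψ x) ∧ ψ x₀ ≠ 0 ∧ ∀ x, β x * φ x = ψ x := by
  have hopen : IsOpen (B ∩ {x | β x ≠ 0}) :=
    hB.inter (isOpen_ne_fun hβ.continuous continuous_const)
  obtain ⟨r, hr, hball⟩ := Metric.nhds_basis_closedBall.mem_iff.1 (hopen.mem_nhds ⟨hx₀, h0⟩)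
  let ψ : ContDiffBump x₀ := ⟨r / 2, r, by linarith, by linarith⟩
  have hts : tsupport ψ = Metric.closedBall x₀ r := ψ.tsupport_eq
  have hφs : tsupport (fun x => (β x)⁻¹ * ψ x) ⊆ tsupport ψ := tsupport_mul_subset_right
  refine ⟨fun x => (β x)⁻¹ * ψ x, ψ, ?_, ?_, ?_, ψ.contDiff, ψ.hasCompactSupport,
    fun x => ψ.nonneg, ?_, fun x => ?_⟩
  · rw [contDiff_iff_contDiffAt]
    intro x
    by_cases hx : x ∈ tsupport ψ
    · exact (hβ.contDiffAt.inv (hball (hts ▸ hx)).2).mul ψ.contDiff.contDiffAt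
    · exact contDiffAt_const (c := (0 : ℝ)) |>.congr_of_eventuallyEq
        (notMem_tsupport_iff_eventuallyEq.1 fun h => hx (hφs h))
  · exact ψ.hasCompactSupport.mul_left
  · exact hφs.trans (hts.subset.trans (hball.trans inter_subset_left))
  · rw [ψ.one_of_mem_closedBall (Metric.mem_closedBall_self (by simp [ψ]; linarith))]
    exact one_ne_zero
  · by_cases hx : x ∈ tsupport ψ
    · have : β x ≠ 0 := (hball (hts ▸ hx)).2
      field_simp
    · simp [image_eq_zero_of_notMem_tsupport hx]

lemma coordY_ne_zero {a b : Plane} (hab : cross a b ≠ 0) : coordY a b ≠ 0 := by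
  intro h
  have := coordY_comb hab 0 1
  simp [h] at this

lemma plane_decomp (v : Plane) :
    v = v 0 • (EuclideanSpace.single 0 1 : Plane) + v 1 • (EuclideanSpace.single 1 1 : Plane) := by
  ext i
  fin_cases i <;> simp

/-- A weakly differentiable function which is smooth on both sides of a line has no jump. -/
lemma eq_of_isWeakPartial {a b : Plane} (hab : cross a b ≠ 0) {x₀ : Plane} {r : ℝ} (hr : 0 < r)
    {F₁ F₂ g : Plane → ℝ} {h : Fin 2 → Plane → ℝ} (hF₁ : ContDiff ℝ ∞ F₁) (hF₂ : ContDiff ℝ ∞ F₂)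
    (h₁ : ∀ᵐ x ∂(volume.restrict (Metric.ball x₀ r)), coordY a b x₀ < coordY a b x → g x = F₁ x)
    (h₂ : ∀ᵐ x ∂(volume.restrict (Metric.ball x₀ r)), coordY a b x < coordY a b x₀ → g x = F₂ x)
    (hh : ∀ j, IntegrableOn (h j) (Metric.ball x₀ r))
    (hg : ∀ j, IsWeakPartial (Metric.ball x₀ r) j g (h j)) : F₁ x₀ = F₂ x₀ := by
  set B := Metric.ball x₀ r with hBdef
  set c := coordY a b x₀ with hc
  have hBo : IsOpen B := Metric.isOpen_ball
  have hK : IsCompact (Metric.closedBall x₀ r) := isCompact_closedBall x₀ r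
  have hBK : B ⊆ Metric.closedBall x₀ r := Metric.ball_subset_closedBall
  have hYc := (coordY a b).continuous
  set P : Set Plane := {x | c < coordY a b x} with hP
  have hPo : IsOpen P := isOpen_lt continuous_const hYc
  have hNo : IsOpen {x | coordY a b x < c} := isOpen_lt hYc continuous_const
  have hoff : ∀ᵐ x ∂(volume.restrict B), coordY a b x ≠ c :=
    ae_restrict_of_ae ((ae_off_lines (κ := Unit) (l := fun _ => coordY a b)
      (fun _ => coordY_ne_zero hab) fun _ => c).mono fun x hx => hx ())
  -- On each open side the weak derivative `h j` is the classical derivative of the smooth function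
  -- there, by localization and uniqueness of weak derivatives.
  have hside : ∀ {F : Plane → ℝ} {S : Set Plane}, ContDiff ℝ ∞ F → IsOpen S →
      (∀ᵐ x ∂(volume.restrict B), x ∈ S → g x = F x) → ∀ j, ∀ᵐ x ∂(volume.restrict B),
        x ∈ S → h j x = fderiv ℝ F x (EuclideanSpace.single j 1) := by
    intro F S hF hS hgF j
    have hBS : IsOpen (B ∩ S) := hBo.inter hS
    have e1 : g =ᵐ[volume.restrict (B ∩ S)] F := by
      rw [Filter.EventuallyEq, ae_restrict_iff' hBS.measurableSet]
      rw [ae_restrict_iff' hBo.measurableSet] at hgF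
      filter_upwards [hgF] with x hx hxs using hx hxs.1 hxs.2
    have e2 := (((hg j).mono inter_subset_left).congr_left e1).ae_eq hBS
      (isWeakPartial_of_contDiff hBS hK (inter_subset_left.trans hBK) hF j)
      ((hh j).mono_set inter_subset_left)
      (integrableOn_of_continuous hK (inter_subset_left.trans hBK)
        ((hF.continuous_fderiv (by simp)).clm_apply continuous_const))
    rw [Filter.EventuallyEq, ae_restrict_iff' hBS.measurableSet] at e2
    rw [ae_restrict_iff' hBo.measurableSet]
    filter_upwards [e2] with x hx h1 h2 using hx ⟨h1, h2⟩
  have hh₁ := hside hF₁ hPo h₁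
  have hh₂ := hside hF₂ hNo h₂
  -- Suppose that the jump is nonzero at `x₀` and choose `φ` with `(F₁ - F₂) φ = ψ`. Subtracting the
  -- identity for the smooth function `F₂` on the whole ball from the one for `g` leaves only the
  -- integral of a derivative of `ψ` over the side `P`, which must vanish for both coordinate
  -- directions.
  by_contra hne
  have hβ : ContDiff ℝ ∞ fun x => F₁ x - F₂ x := hF₁.sub hF₂
  obtain ⟨φ, ψ, hφ, hφc, hφs, hψ, hψc, hψ0, hψx, hφψ⟩ :=
    exists_bump_of_ne_zero hβ (sub_ne_zero.2 hne) hBo (Metric.mem_ball_self hr)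
  have hzero : ∀ j : Fin 2, ∫ x in P, fderiv ℝ ψ x (EuclideanSpace.single j 1) = 0 := by
    intro j
    set e : Plane := EuclideanSpace.single j 1
    obtain ⟨M, hM⟩ := hφc.exists_bound_of_continuous hφ.continuous
    have hφ' : Continuous fun x => fderiv ℝ φ x e :=
      (hφ.continuous_fderiv (by simp)).clm_apply continuous_const
    have hF₂' : Continuous fun x => fderiv ℝ F₂ x e :=
      (hF₂.continuous_fderiv (by simp)).clm_apply continuous_const
    have hψ' : Continuous fun x => fderiv ℝ ψ x e :=
      (hψ.continuous_fderiv (by simp)).clm_apply continuous_const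
    have i2 : IntegrableOn (fun x => h j x * φ x) B :=
      (hh j).mul_bdd hφ.continuous.aestronglyMeasurable (Filter.Eventually.of_forall hM)
    have k1 := hg j φ hφ hφc hφs
    have k2 := isWeakPartial_of_contDiff hBo hK hBK hF₂ j φ hφ hφc hφs
    have i3 : IntegrableOn (fun x => F₂ x * fderiv ℝ φ x e) B :=
      integrableOn_of_continuous hK hBK (hF₂.continuous.mul hφ')
    have i4 : IntegrableOn (fun x => fderiv ℝ F₂ x e * φ x) B :=
      integrableOn_of_continuous hK hBK (hF₂'.mul hφ.continuous)
    have i5 : IntegrableOn (fun x => F₂ x * fderiv ℝ φ x e + fderiv ℝ F₂ x e * φ x) B := i3.add i4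
    have i6 : IntegrableOn (fun x => F₂ x * fderiv ℝ φ x e + fderiv ℝ F₂ x e * φ x
        - h j x * φ x) B := i5.sub i2
    have hprod : ∀ x, fderiv ℝ ψ x e = (F₁ x * fderiv ℝ φ x e + fderiv ℝ F₁ x e * φ x) -
        (F₂ x * fderiv ℝ φ x e + fderiv ℝ F₂ x e * φ x) := by
      intro x
      have d1 := hF₁.differentiable (by simp) x
      have d2 := hF₂.differentiable (by simp) x
      have d3 := hφ.differentiable (by simp) x
      rw [show ψ = fun x => (F₁ x - F₂ x) * φ x from funext fun x => (hφψ x).symm,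
        fderiv_fun_mul (d1.fun_sub d2) d3, fderiv_fun_sub d1 d2]
      simp
      ring
    have hae : (fun x => g x * fderiv ℝ φ x e) =ᵐ[volume.restrict B] fun x =>
        P.indicator (fun x => fderiv ℝ ψ x e) x +
          (F₂ x * fderiv ℝ φ x e + fderiv ℝ F₂ x e * φ x - h j x * φ x) := by
      filter_upwards [hoff, h₁, h₂, hh₁ j, hh₂ j] with x hx a1 a2 a3 a4
      rcases lt_or_gt_of_ne hx with hlt | hgt
      · rw [indicator_of_notMem (by simpa [hP] using hlt.le), a2 hlt, a4 hlt]
        ring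
      · rw [indicator_of_mem (by simpa [hP] using hgt), a1 hgt, a3 hgt, hprod]
        ring
    have i7 : IntegrableOn (P.indicator fun x => fderiv ℝ ψ x e) B :=
      (integrableOn_of_continuous hK hBK hψ').indicator hPo.measurableSet
    rw [integral_congr_ae hae, integral_add i7 i6,
      integral_sub i5 i2, integral_add i3 i4] at k1
    have k3 : ∫ x in B, P.indicator (fun x => fderiv ℝ ψ x e) x = 0 := by linarith
    rw [← k3, ← integral_indicator hPo.measurableSet]
    refine (setIntegral_eq_integral_of_forall_compl_eq_zero fun x hx => ?_).symm
    have hxφ : x ∉ tsupport φ := fun hxφ => hx (hφs hxφ)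
    have : fderiv ℝ ψ x e = 0 := by
      rw [hprod, fderiv_apply_eq_zero_of_notMem_tsupport e hxφ,
        image_eq_zero_of_notMem_tsupport hxφ]
      ring
    simp [indicator, this]
  -- Combining the two coordinate directions gives the direction `b`, transversal to the line, for
  -- which the integral cannot vanish.
  refine integral_halfplane_fderiv_ne_zero hab hψ hψc hψ0 hψx ?_
  have hsplit : ∀ x, fderiv ℝ ψ x b = b 0 * fderiv ℝ ψ x (EuclideanSpace.single 0 1) +
      b 1 * fderiv ℝ ψ x (EuclideanSpace.single 1 1) := by
    intro x
    conv_lhs => rw [plane_decomp b]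
    simp
  have hint : ∀ j : Fin 2, IntegrableOn (fun x => fderiv ℝ ψ x (EuclideanSpace.single j 1)) P :=
    fun j => (((hψ.continuous_fderiv (by simp)).clm_apply
      continuous_const).integrable_of_hasCompactSupport (hψc.fderiv_apply ℝ _)).integrableOn
  simp_rw [hsplit]
  rw [integral_add ((hint 0).const_mul _) ((hint 1).const_mul _), integral_const_mul,
    integral_const_mul, hzero, hzero]
  simp

/-- An `H²` function which is smooth up to a line from both sides has no jump of the gradient. -/
theorem fderiv_eq_of_memH2 {a b : Plane} (hab : cross a b ≠ 0) {x₀ : Plane} {B : Set Plane}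
    (hB : IsOpen B) (hx₀ : x₀ ∈ B) {f₁ f₂ u : Plane → ℝ} (hf₁ : ContDiff ℝ ∞ f₁)
    (hf₂ : ContDiff ℝ ∞ f₂) (h₁ : ∀ x ∈ B, coordY a b x₀ ≤ coordY a b x → u x = f₁ x)
    (h₂ : ∀ x ∈ B, coordY a b x ≤ coordY a b x₀ → u x = f₂ x) (hu : MemH2 B u) :
    fderiv ℝ f₁ x₀ = fderiv ℝ f₂ x₀ := by
  obtain ⟨r, hr, hball⟩ := Metric.nhds_basis_ball.mem_iff.1 (hB.mem_nhds hx₀)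
  have hK : IsCompact (Metric.closedBall x₀ r) := isCompact_closedBall x₀ r
  have hBK : Metric.ball x₀ r ⊆ Metric.closedBall x₀ r := Metric.ball_subset_closedBall
  have hBo : IsOpen (Metric.ball x₀ r) := Metric.isOpen_ball
  obtain ⟨-, g, h, hg, hh⟩ := hu.mono hball
  set c := coordY a b x₀
  have hYc := (coordY a b).continuous
  have hfin : IsFiniteMeasure (volume.restrict (Metric.ball x₀ r)) := by
    rw [isFiniteMeasure_restrict]
    exact measure_ball_lt_top.ne
  have hcont : ContinuousOn u (Metric.ball x₀ r) := by
    refine continuousOn_of_pieces (ι := Bool) (T := fun i => if i then {x | c ≤ coordY a b x} else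
      {x | coordY a b x ≤ c}) (g := fun i => if i then f₁ else f₂) ?_ ?_ ?_ ?_
    · rintro (_ | _)
      · exact isClosed_le hYc continuous_const
      · exact isClosed_le continuous_const hYc
    · intro x _
      rcases le_total c (coordY a b x) with h | h
      · exact mem_iUnion.2 ⟨true, h⟩
      · exact mem_iUnion.2 ⟨false, h⟩
    · rintro (_ | _)
      · exact hf₂.continuous
      · exact hf₁.continuous
    · rintro (_ | _) x hx hxi
      · exact h₂ x (hball hx) hxi
      · exact h₁ x (hball hx) hxi
  have hpos : ∀ x ∈ Metric.ball x₀ r, c < coordY a b x → u =ᶠ[nhds x] f₁ := fun x hx hlt => by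
    filter_upwards [hBo.mem_nhds hx, (isOpen_lt continuous_const hYc).mem_nhds hlt] with y h3 h4
    exact h₁ y (hball h3) (le_of_lt h4)
  have hneg : ∀ x ∈ Metric.ball x₀ r, coordY a b x < c → u =ᶠ[nhds x] f₂ := fun x hx hlt => by
    filter_upwards [hBo.mem_nhds hx, (isOpen_lt hYc continuous_const).mem_nhds hlt] with y h3 h4
    exact h₂ y (hball h3) (le_of_lt h4)
  obtain ⟨M₁, hM₁⟩ :=
    hK.exists_bound_of_continuousOn (hf₁.continuous_fderiv (by simp)).continuousOn
  obtain ⟨M₂, hM₂⟩ :=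
    hK.exists_bound_of_continuousOn (hf₂.continuous_fderiv (by simp)).continuousOn
  have hdiff : ∀ x ∈ Metric.ball x₀ r, coordY a b x ≠ c →
      DifferentiableAt ℝ u x ∧ ‖fderiv ℝ u x‖ ≤ max M₁ M₂ := by
    intro x hx hne
    rcases lt_or_gt_of_ne hne with hlt | hgt
    · refine ⟨(hf₂.differentiable (by simp) x).congr_of_eventuallyEq (hneg x hx hlt), ?_⟩
      rw [(hneg x hx hlt).fderiv_eq]
      exact (hM₂ x (hBK hx)).trans (le_max_right _ _)
    · refine ⟨(hf₁.differentiable (by simp) x).congr_of_eventuallyEq (hpos x hx hgt), ?_⟩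
      rw [(hpos x hx hgt).fderiv_eq]
      exact (hM₁ x (hBK hx)).trans (le_max_left _ _)
  have hoff : ∀ᵐ x ∂(volume.restrict (Metric.ball x₀ r)), coordY a b x ≠ c :=
    ae_restrict_of_ae ((ae_off_lines (κ := Unit) (l := fun _ => coordY a b)
      (fun _ => coordY_ne_zero hab) fun _ => c).mono fun x hx => hx ())
  -- `u` is continuous, and smooth off the line with bounded gradient, so its weak derivatives are
  -- the classical ones. Each of them is a weakly differentiable function with smooth sides, to
  -- which `eq_of_isWeakPartial` applies.
  have hgu : ∀ i, ∀ᵐ x ∂(volume.restrict (Metric.ball x₀ r)),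
      g i x = fderiv ℝ u x (EuclideanSpace.single i 1) := by
    intro i
    refine (hg i).2.ae_eq hBo (isWeakPartial_fderiv (κ := Unit) (l := fun _ => coordY a b)
      (fun _ => coordY_ne_zero hab) (c := fun _ => c) hBo hcont
      (fun x hx hne => (hdiff x hx (hne ())).1) (fun x hx hne => (hdiff x hx (hne ())).2) i)
      ((hg i).1.integrable (by norm_num)) ?_
    refine Integrable.of_bound (C := max M₁ M₂)
      (measurable_fderiv_apply_const ℝ _ _).aestronglyMeasurable ?_
    filter_upwards [hoff, ae_restrict_mem hBo.measurableSet] with x hx hxB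
    exact (ContinuousLinearMap.le_opNorm _ _).trans (by simpa using (hdiff x hxB hx).2)
  have hcomp : ∀ i : Fin 2, fderiv ℝ f₁ x₀ (EuclideanSpace.single i 1) =
      fderiv ℝ f₂ x₀ (EuclideanSpace.single i 1) := by
    intro i
    refine eq_of_isWeakPartial hab hr
      (F₁ := fun x => fderiv ℝ f₁ x (EuclideanSpace.single i 1))
      (F₂ := fun x => fderiv ℝ f₂ x (EuclideanSpace.single i 1)) (g := g i) (h := h i)
      (((hf₁).fderiv_right (m := ∞) (by simp)).clm_apply contDiff_const)
      (((hf₂).fderiv_right (m := ∞) (by simp)).clm_apply contDiff_const) ?_ ?_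
      (fun j => (hh i j).1.integrable (by norm_num)) (fun j => (hh i j).2)
    · filter_upwards [hgu i, ae_restrict_mem hBo.measurableSet] with x hx hxB hlt
      rw [hx, (hpos x hxB hlt).fderiv_eq]
    · filter_upwards [hgu i, ae_restrict_mem hBo.measurableSet] with x hx hxB hlt
      rw [hx, (hneg x hxB hlt).fderiv_eq]
  ext v
  rw [plane_decomp v]
  simp [hcomp]

/-! ### Polynomials of bounded degree -/

lemma Poly_mono {r s : ℤ} (h : r ≤ s) : Poly r ≤ Poly s :=
  MvPolynomial.restrictSupport_mono ℝ fun _ hd => le_trans (α := ℤ) hd h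

lemma mul_mem_Poly {r s : ℤ} {p q : MvPolynomial (Fin 2) ℝ} (hp : p ∈ Poly r) (hq : q ∈ Poly s) :
    p * q ∈ Poly (r + s) := by
  have h := Submodule.mul_mem_mul hp hq
  rw [Poly, Poly, ← MvPolynomial.restrictSupport_add] at h
  refine MvPolynomial.restrictSupport_mono ℝ ?_ h
  rintro _ ⟨d, hd, e, he, rfl⟩
  simp only [mem_ofPred_eq] at hd he ⊢
  simp only [map_add]
  push_cast
  linarith

lemma C_mem_Poly (c : ℝ) {r : ℤ} (hr : 0 ≤ r) : MvPolynomial.C c ∈ Poly r := by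
  rw [MvPolynomial.C_apply, Poly, MvPolynomial.monomial_mem_restrictSupport]
  left
  simpa using hr

lemma X_mem_Poly (i : Fin 2) {r : ℤ} (hr : 1 ≤ r) : MvPolynomial.X i ∈ Poly r := by
  rw [MvPolynomial.X, Poly, MvPolynomial.monomial_mem_restrictSupport]
  left
  simpa using hr

lemma pow_mem_Poly {p : MvPolynomial (Fin 2) ℝ} (hp : p ∈ Poly 1) (n : ℕ) : p ^ n ∈ Poly n := by
  induction n with
  | zero => simpa using C_mem_Poly 1 le_rfl
  | succ n ih =>
    rw [pow_succ]
    push_cast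
    exact mul_mem_Poly ih hp

lemma degree_fin_two (d : Fin 2 →₀ ℕ) : d.degree = d 0 + d 1 := by
  simp [Finsupp.degree_eq_sum, Fin.sum_univ_two]

lemma bind_mem_Poly {α : Fin 2 → MvPolynomial (Fin 2) ℝ} (hα : ∀ j, α j ∈ Poly 1) {r : ℤ}
    {p : MvPolynomial (Fin 2) ℝ} (hp : p ∈ Poly r) : MvPolynomial.bind₁ α p ∈ Poly r := by
  rw [Poly, MvPolynomial.restrictSupport_eq_span] at hp
  induction hp using Submodule.span_induction with
  | mem x hx =>
    obtain ⟨d, hd, rfl⟩ := hx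
    have h := mul_mem_Poly (pow_mem_Poly (hα 0) (d 0)) (pow_mem_Poly (hα 1) (d 1))
    simp only [MvPolynomial.bind₁_monomial, map_one, one_mul]
    rw [← Finsupp.prod, Finsupp.prod_fintype _ _ (by simp), Fin.prod_univ_two]
    refine Poly_mono ?_ h
    simp only [mem_ofPred_eq, degree_fin_two] at hd
    exact_mod_cast hd
  | zero => simp
  | add x y _ _ hx hy => simpa using Submodule.add_mem _ hx hy
  | smul c x _ hx => simpa using Submodule.smul_mem _ c hx

lemma evalAt_add (x : Plane) (p q : MvPolynomial (Fin 2) ℝ) :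
    evalAt x (p + q) = evalAt x p + evalAt x q := by simp [evalAt]

lemma evalAt_sub (x : Plane) (p q : MvPolynomial (Fin 2) ℝ) :
    evalAt x (p - q) = evalAt x p - evalAt x q := by simp [evalAt]

lemma evalAt_mul (x : Plane) (p q : MvPolynomial (Fin 2) ℝ) :
    evalAt x (p * q) = evalAt x p * evalAt x q := by simp [evalAt]

lemma evalAt_smul (x : Plane) (c : ℝ) (p : MvPolynomial (Fin 2) ℝ) :
    evalAt x (c • p) = c * evalAt x p := by simp [evalAt]

lemma evalAt_zero (x : Plane) : evalAt x 0 = 0 := by simp [evalAt]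

lemma evalAt_C (x : Plane) (c : ℝ) : evalAt x (MvPolynomial.C c) = c := by simp [evalAt]

lemma evalAt_bind (x : Plane) (α : Fin 2 → MvPolynomial (Fin 2) ℝ)
    (p : MvPolynomial (Fin 2) ℝ) :
    evalAt x (MvPolynomial.bind₁ α p) = evalAt (WithLp.toLp 2 fun j => evalAt x (α j)) p := by
  simp only [evalAt, MvPolynomial.eval, MvPolynomial.eval₂Hom_bind₁]

lemma contDiff_evalAt (p : MvPolynomial (Fin 2) ℝ) : ContDiff ℝ ∞ fun x => evalAt x p := by
  induction p using MvPolynomial.induction_on with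
  | C c => simpa [evalAt] using contDiff_const
  | add p q hp hq => simpa [evalAt] using hp.add hq
  | mul_X p i hp =>
    have : ContDiff ℝ ∞ fun x : Plane => x i := by fun_prop
    simpa [evalAt] using hp.mul this

lemma differentiableAt_evalAt (p : MvPolynomial (Fin 2) ℝ) (x : Plane) :
    DifferentiableAt ℝ (fun x => evalAt x p) x := (contDiff_evalAt p).differentiable (by simp) x

lemma continuous_evalAt (p : MvPolynomial (Fin 2) ℝ) : Continuous fun x => evalAt x p :=
  (contDiff_evalAt p).continuous

/-- The derivative of a polynomial function. -/
def grad (p : MvPolynomial (Fin 2) ℝ) (x : Plane) : Plane →L[ℝ] ℝ := fderiv ℝ (fun y => evalAt y p) x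

lemma hasFDerivAt_evalAt (p : MvPolynomial (Fin 2) ℝ) (x : Plane) :
    HasFDerivAt (fun y => evalAt y p) (grad p x) x := (differentiableAt_evalAt p x).hasFDerivAt

lemma continuous_grad (p : MvPolynomial (Fin 2) ℝ) : Continuous (grad p) :=
  (contDiff_evalAt p).continuous_fderiv (by simp)

lemma grad_add (p q : MvPolynomial (Fin 2) ℝ) (x : Plane) : grad (p + q) x = grad p x + grad q x := by
  refine HasFDerivAt.fderiv ?_
  simpa only [evalAt_add] using (hasFDerivAt_evalAt p x).fun_add (hasFDerivAt_evalAt q x)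

lemma grad_sub (p q : MvPolynomial (Fin 2) ℝ) (x : Plane) : grad (p - q) x = grad p x - grad q x := by
  refine HasFDerivAt.fderiv ?_
  simpa only [evalAt_sub] using (hasFDerivAt_evalAt p x).fun_sub (hasFDerivAt_evalAt q x)

lemma grad_smul (c : ℝ) (p : MvPolynomial (Fin 2) ℝ) (x : Plane) : grad (c • p) x = c • grad p x := by
  refine HasFDerivAt.fderiv ?_
  simpa only [evalAt_smul] using (hasFDerivAt_evalAt p x).const_mul c

lemma grad_mul (p q : MvPolynomial (Fin 2) ℝ) (x : Plane) :
    grad (p * q) x = evalAt x p • grad q x + evalAt x q • grad p x := by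
  refine HasFDerivAt.fderiv ?_
  simpa only [evalAt_mul] using (hasFDerivAt_evalAt p x).fun_mul (hasFDerivAt_evalAt q x)

/-- A polynomial of degree one which represents an affine function. -/
def affinePoly (l : Plane →L[ℝ] ℝ) (c : ℝ) : MvPolynomial (Fin 2) ℝ :=
  MvPolynomial.C c + MvPolynomial.C (l (EuclideanSpace.single 0 1)) * MvPolynomial.X 0 +
    MvPolynomial.C (l (EuclideanSpace.single 1 1)) * MvPolynomial.X 1

lemma affinePoly_mem (l : Plane →L[ℝ] ℝ) (c : ℝ) : affinePoly l c ∈ Poly 1 := by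
  refine Submodule.add_mem _ (Submodule.add_mem _ (C_mem_Poly _ (by norm_num)) ?_) ?_
  · simpa using mul_mem_Poly (C_mem_Poly (l (EuclideanSpace.single 0 1)) le_rfl)
      (X_mem_Poly 0 le_rfl)
  · simpa using mul_mem_Poly (C_mem_Poly (l (EuclideanSpace.single 1 1)) le_rfl)
      (X_mem_Poly 1 le_rfl)

@[simp] lemma evalAt_affinePoly (l : Plane →L[ℝ] ℝ) (c : ℝ) (x : Plane) :
    evalAt x (affinePoly l c) = l x + c := by
  have : l x = x 0 * l (EuclideanSpace.single 0 1) + x 1 * l (EuclideanSpace.single 1 1) := by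
    conv_lhs => rw [plane_decomp x]
    simp
  rw [this]
  simp [evalAt, affinePoly]
  ring

/-- The composition of a polynomial with an affine map. -/
lemma exists_comp_affine {r : ℤ} {p : MvPolynomial (Fin 2) ℝ} (hp : p ∈ Poly r)
    (L : Plane →L[ℝ] Plane) (o : Plane) :
    ∃ q ∈ Poly r, ∀ x, evalAt x q = evalAt (L x + o) p := by
  refine ⟨MvPolynomial.bind₁ (fun j => affinePoly ((EuclideanSpace.proj j).comp L) (o j)) p,
    bind_mem_Poly (fun j => affinePoly_mem _ _) hp, fun x => ?_⟩
  rw [evalAt_bind]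
  congr 1
  ext j
  simp

/-! ### Coefficients of a polynomial of degree at most four in an affine frame. -/

lemma evalAt_eq_sum {p : MvPolynomial (Fin 2) ℝ} (hp : p ∈ Poly 4) (x : Plane) :
    evalAt x p = ∑ z ∈ Finset.range 5 ×ˢ Finset.range 5,
      p.coeff (Finsupp.single 0 z.1 + Finsupp.single 1 z.2) * (x 0 ^ z.1 * x 1 ^ z.2) := by
  have hd : ∀ d : Fin 2 →₀ ℕ, d = Finsupp.single 0 (d 0) + Finsupp.single 1 (d 1) := by
    intro d
    ext i
    fin_cases i <;> simp
  rw [evalAt, MvPolynomial.eval_eq']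
  simp only [Fin.prod_univ_two]
  refine Finset.sum_of_injOn (fun d => (d 0, d 1)) ?_ ?_ ?_ ?_
  · intro d _ e _ h
    simp only [Prod.mk.injEq] at h
    rw [hd d, hd e, h.1, h.2]
  · intro d h
    rw [Poly, MvPolynomial.mem_restrictSupport_iff] at hp
    have := hp h
    simp only [mem_ofPred_eq, degree_fin_two] at this
    simp only [Finset.coe_product, Finset.coe_range, mem_prod, mem_Iio]
    omega
  · intro z _ hz
    have : p.coeff (Finsupp.single 0 z.1 + Finsupp.single 1 z.2) = 0 := by
      by_contra h
      apply hz
      refine ⟨_, MvPolynomial.mem_support_iff.2 h, ?_⟩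
      simp
    simp [this]
  · intro d _
    rw [← hd d]

/-- The polynomial function `∑_{m + n ≤ 4} c m n x ^ m y ^ n`. -/
def quartic (c : ℕ → ℕ → ℝ) (x y : ℝ) : ℝ :=
  c 0 0 + c 1 0 * x + c 0 1 * y + c 2 0 * x ^ 2 + c 1 1 * x * y + c 0 2 * y ^ 2 +
    c 3 0 * x ^ 3 + c 2 1 * x ^ 2 * y + c 1 2 * x * y ^ 2 + c 0 3 * y ^ 3 +
    c 4 0 * x ^ 4 + c 3 1 * x ^ 3 * y + c 2 2 * x ^ 2 * y ^ 2 + c 1 3 * x * y ^ 3 + c 0 4 * y ^ 4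

/-- The derivative of `quartic c` in the first variable. -/
def quarticX (c : ℕ → ℕ → ℝ) (x y : ℝ) : ℝ :=
  c 1 0 + 2 * c 2 0 * x + c 1 1 * y + 3 * c 3 0 * x ^ 2 + 2 * c 2 1 * x * y + c 1 2 * y ^ 2 +
    4 * c 4 0 * x ^ 3 + 3 * c 3 1 * x ^ 2 * y + 2 * c 2 2 * x * y ^ 2 + c 1 3 * y ^ 3

/-- The derivative of `quartic c` in the second variable. -/
def quarticY (c : ℕ → ℕ → ℝ) (x y : ℝ) : ℝ :=
  c 0 1 + c 1 1 * x + 2 * c 0 2 * y + c 2 1 * x ^ 2 + 2 * c 1 2 * x * y + 3 * c 0 3 * y ^ 2 +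
    c 3 1 * x ^ 3 + 2 * c 2 2 * x ^ 2 * y + 3 * c 1 3 * x * y ^ 2 + 4 * c 0 4 * y ^ 3

lemma hasDerivAt_quartic_left (c : ℕ → ℕ → ℝ) (x y : ℝ) :
    HasDerivAt (fun x => quartic c x y) (quarticX c x y) x := by
  have h := hasDerivAt_id' x
  unfold quartic quarticX
  have := ((((((((((((((hasDerivAt_const x (c 0 0)).add (h.const_mul (c 1 0))).add
    (hasDerivAt_const x (c 0 1 * y))).add ((h.pow 2).const_mul (c 2 0))).add
    ((h.const_mul (c 1 1)).mul_const y)).add (hasDerivAt_const x (c 0 2 * y ^ 2))).add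
    ((h.pow 3).const_mul (c 3 0))).add (((h.pow 2).const_mul (c 2 1)).mul_const y)).add
    ((h.const_mul (c 1 2)).mul_const (y ^ 2))).add (hasDerivAt_const x (c 0 3 * y ^ 3))).add
    ((h.pow 4).const_mul (c 4 0))).add (((h.pow 3).const_mul (c 3 1)).mul_const y)).add
    (((h.pow 2).const_mul (c 2 2)).mul_const (y ^ 2))).add
    ((h.const_mul (c 1 3)).mul_const (y ^ 3))).add (hasDerivAt_const x (c 0 4 * y ^ 4))
  refine this.congr_deriv ?_
  norm_num
  ring

lemma quartic_swap (c : ℕ → ℕ → ℝ) (x y : ℝ) : quartic c x y = quartic (fun m n => c n m) y x := by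
  unfold quartic; ring

lemma hasDerivAt_quartic_right (c : ℕ → ℕ → ℝ) (x y : ℝ) :
    HasDerivAt (fun y => quartic c x y) (quarticY c x y) y := by
  have := hasDerivAt_quartic_left (fun m n => c n m) y x
  simp only [← quartic_swap] at this
  refine this.congr_deriv ?_
  unfold quarticX quarticY
  ring

/-- `c` are the coefficients of `p` in the coordinates `(x, y)` of `o + x a + y b`. -/
structure IsExpansion (p : MvPolynomial (Fin 2) ℝ) (o a b : Plane) (c : ℕ → ℕ → ℝ) : Prop where
  eval : ∀ x y : ℝ, evalAt (o + x • a + y • b) p = quartic c x y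
  gradX : ∀ x y : ℝ, grad p (o + x • a + y • b) a = quarticX c x y
  gradY : ∀ x y : ℝ, grad p (o + x • a + y • b) b = quarticY c x y

/-- As `k + 1 ≤ 4`, fifteen explicit coefficients suffice for all later computations. The case `k =
2` is the same computation with the coefficients of degree four equal to zero, which is what the
first conclusion provides. -/
lemma exists_expansion {r : ℤ} (hr : r ≤ 4) {p : MvPolynomial (Fin 2) ℝ} (hp : p ∈ Poly r)
    (o a b : Plane) : ∃ c : ℕ → ℕ → ℝ, (∀ m n : ℕ, r < m + n → c m n = 0) ∧
      IsExpansion p o a b c := by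
  obtain ⟨q, hq, hqe⟩ := exists_comp_affine hp
    ((EuclideanSpace.proj (𝕜 := ℝ) (0 : Fin 2)).smulRight a +
      (EuclideanSpace.proj (𝕜 := ℝ) (1 : Fin 2)).smulRight b) o
  have hcoeff : ∀ m n : ℕ, r < m + n →
      q.coeff (Finsupp.single 0 m + Finsupp.single 1 n) = 0 := by
    intro m n hmn
    by_contra h
    rw [Poly, MvPolynomial.mem_restrictSupport_iff] at hq
    have := hq (MvPolynomial.mem_support_iff.2 h)
    simp [degree_fin_two] at this
    omega
  have heval : ∀ x y : ℝ, evalAt (o + x • a + y • b) p =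
      quartic (fun m n => q.coeff (Finsupp.single 0 m + Finsupp.single 1 n)) x y := by
    intro x y
    have h1 := hqe !₂[x, y]
    rw [evalAt_eq_sum (Poly_mono hr hq), Finset.sum_product] at h1
    have h2 : (o + x • a + y • b : Plane) = ((EuclideanSpace.proj (𝕜 := ℝ) (0 : Fin 2)).smulRight a +
      (EuclideanSpace.proj (𝕜 := ℝ) (1 : Fin 2)).smulRight b : Plane →L[ℝ] Plane) !₂[x, y] + o := by
      simp
      abel
    rw [h2, ← h1]
    have h3 : ∀ m n : ℕ, 4 < m + n →
        q.coeff (Finsupp.single 0 m + Finsupp.single 1 n) = 0 := fun m n h =>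
      hcoeff m n (by omega)
    simp only [Finset.sum_range_succ, Finset.sum_range_zero, quartic]
    -- Of the 25 exponents in the square, these ten have total degree above four.
    rw [h3 1 4, h3 2 3, h3 2 4, h3 3 2, h3 3 3, h3 3 4, h3 4 1, h3 4 2, h3 4 3, h3 4 4]
    · simp
      ring
    all_goals norm_num
  refine ⟨_, hcoeff, heval, fun x y => ?_, fun x y => ?_⟩
  · have h3 : HasDerivAt (fun x : ℝ => o + x • a + y • b) a x := by
      simpa using (((hasDerivAt_id x).smul_const a).const_add o).add_const (y • b)
    have h4 := (hasFDerivAt_evalAt p (o + x • a + y • b)).comp_hasDerivAt x h3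
    simp only [Function.comp_def, heval] at h4
    exact h4.unique (hasDerivAt_quartic_left _ _ _)
  · have h3 : HasDerivAt (fun y : ℝ => o + x • a + y • b) b y := by
      simpa using ((hasDerivAt_id y).smul_const b).const_add (o + x • a)
    have h4 := (hasFDerivAt_evalAt p (o + x • a + y • b)).comp_hasDerivAt y h3
    simp only [Function.comp_def, heval] at h4
    exact h4.unique (hasDerivAt_quartic_right _ _ _)

/-! ### Geometry of the criss-cross division, in coordinates centred at the crossing of the
diagonals. -/

lemma cross_ne_zero_of_linearIndependent {d e : Plane} (h : LinearIndependent ℝ ![d, e]) :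
    cross d e ≠ 0 := by
  intro h0
  rw [LinearIndependent.pair_iff] at h
  have h1 := h (e 0) (-d 0) (by
    ext i
    simp only [cross] at h0
    fin_cases i
    · simp; ring
    · simp; linarith)
  have h2 := h (e 1) (-d 1) (by
    ext i
    simp only [cross] at h0
    fin_cases i
    · simp; linarith
    · simp; ring)
  have he : e = 0 := by
    ext i
    fin_cases i
    · simpa using h1.1
    · simpa using h2.1
  have := h 0 1 (by simp [he])
  simp at this

lemma cross_smul_smul (a b : Plane) (s t : ℝ) : cross (s • a) (t • b) = s * t * cross a b := by
  simp [cross]; ring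

namespace ConvexQuad

variable (Q : ConvexQuad)

/-- The vector from the center to a vertex. -/
def arm (i : Fin 4) : Plane := Q.v i - Q.center

lemma v_eq (i : Fin 4) : Q.v i = Q.center + Q.arm i := by simp [arm]

lemma exists_arm_eq : ∃ s : Fin 4 → ℝ, (∀ i, 0 < s i) ∧
    Q.arm 0 = -s 0 • (Q.v 2 - Q.v 0) ∧ Q.arm 1 = -s 1 • (Q.v 3 - Q.v 1) ∧
    Q.arm 2 = s 2 • (Q.v 2 - Q.v 0) ∧ Q.arm 3 = s 3 • (Q.v 3 - Q.v 1) := by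
  obtain ⟨a, b, ha, hb, hab, h⟩ := Q.center_mem_diag02
  obtain ⟨c, d, hc, hd, hcd, h'⟩ := Q.center_mem_diag13
  have ha' : a = 1 - b := by linarith
  have hc' : c = 1 - d := by linarith
  -- If the center is `a • v 0 + b • v 2` with `a + b = 1`, then `v 0 - center = -b • (v 2 - v 0)`
  -- and `v 2 - center = a • (v 2 - v 0)`; likewise on the other diagonal.
  refine ⟨![b, d, a, c], ?_, ?_, ?_, ?_, ?_⟩
  · intro i
    fin_cases i <;> simpa
  · rw [arm, ← h, ha']; simp; module
  · rw [arm, ← h', hc']; simp; module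
  · rw [arm, ← h, ha']; simp; module
  · rw [arm, ← h', hc']; simp; module

/-- Opposite arms lie on the same diagonal and point in opposite directions. These ratios are the
only trace of the shape of `Q` in the linear algebra of unisolvence. -/
lemma exists_ratio : ∃ ρ : Fin 4 → ℝ, (∀ i, 0 < ρ i) ∧ ∀ i, Q.arm (i + 2) = -ρ i • Q.arm i := by
  obtain ⟨s, hs, h0, h1, h2, h3⟩ := Q.exists_arm_eq
  refine ⟨fun i => s (i + 2) / s i, fun i => div_pos (hs _) (hs _), fun i => ?_⟩
  have n0 := (hs 0).ne'
  have n1 := (hs 1).ne'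
  have n2 := (hs 2).ne'
  have n3 := (hs 3).ne'
  fin_cases i
  · change Q.arm 2 = -(s 2 / s 0) • Q.arm 0
    rw [h2, h0, smul_smul]; congr 1; field_simp
  · change Q.arm 3 = -(s 3 / s 1) • Q.arm 1
    rw [h3, h1, smul_smul]; congr 1; field_simp
  · change Q.arm 0 = -(s 0 / s 2) • Q.arm 2
    rw [h2, h0, smul_smul]; congr 1; field_simp
  · change Q.arm 1 = -(s 1 / s 3) • Q.arm 3
    rw [h3, h1, smul_smul]; congr 1; field_simp

/-- The ratio in which the center divides a diagonal. -/
def ratio : Fin 4 → ℝ := Q.exists_ratio.choose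

lemma ratio_pos (i : Fin 4) : 0 < Q.ratio i := Q.exists_ratio.choose_spec.1 i

lemma arm_add_two (i : Fin 4) : Q.arm (i + 2) = -Q.ratio i • Q.arm i :=
  Q.exists_ratio.choose_spec.2 i

lemma cross_arm (i : Fin 4) : cross (Q.arm i) (Q.arm (i + 1)) ≠ 0 := by
  obtain ⟨s, hs, h0, h1, h2, h3⟩ := Q.exists_arm_eq
  have h := cross_ne_zero_of_linearIndependent Q.diag_indep
  have h' : cross (Q.v 3 - Q.v 1) (Q.v 2 - Q.v 0) ≠ 0 := by rw [cross_swap]; simpa using h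
  have n := fun i => (hs i).ne'
  fin_cases i
  · change cross (Q.arm 0) (Q.arm 1) ≠ 0
    rw [h0, h1, cross_smul_smul]; simp [n, h]
  · change cross (Q.arm 1) (Q.arm 2) ≠ 0
    rw [h1, h2, cross_smul_smul]; simp [n, h']
  · change cross (Q.arm 2) (Q.arm 3) ≠ 0
    rw [h2, h3, cross_smul_smul]; simp [n, h]
  · change cross (Q.arm 3) (Q.arm 0) ≠ 0
    rw [h3, h0, cross_smul_smul]; simp [n, h']

/-- The barycentric coordinate of `v i` on the triangle `tri i`. -/
def bx (i : Fin 4) (x : Plane) : ℝ := coordX (Q.arm i) (Q.arm (i + 1)) (x - Q.center)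

/-- The barycentric coordinate of `v (i + 1)` on the triangle `tri i`. -/
def bary (i : Fin 4) (x : Plane) : ℝ := coordY (Q.arm i) (Q.arm (i + 1)) (x - Q.center)

lemma eq_coords (i : Fin 4) (x : Plane) :
    x = Q.center + Q.bx i x • Q.arm i + Q.bary i x • Q.arm (i + 1) := by
  rw [bx, bary, add_assoc, coord_spec (Q.cross_arm i)]
  abel

lemma bx_comb (i : Fin 4) (s t : ℝ) :
    Q.bx i (Q.center + s • Q.arm i + t • Q.arm (i + 1)) = s := by
  rw [bx, add_assoc, add_sub_cancel_left, coordX_comb (Q.cross_arm i)]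

lemma bary_comb (i : Fin 4) (s t : ℝ) :
    Q.bary i (Q.center + s • Q.arm i + t • Q.arm (i + 1)) = t := by
  rw [bary, add_assoc, add_sub_cancel_left, coordY_comb (Q.cross_arm i)]

lemma coords_unique {i : Fin 4} {s t s' t' : ℝ}
    (h : Q.center + s • Q.arm i + t • Q.arm (i + 1) = Q.center + s' • Q.arm i + t' • Q.arm (i + 1)) :
    s = s' ∧ t = t' := by
  refine ⟨?_, ?_⟩
  · rw [← Q.bx_comb i s t, h, bx_comb]
  · rw [← Q.bary_comb i s t, h, bary_comb]

lemma continuous_bx (i : Fin 4) : Continuous (Q.bx i) := by unfold bx; fun_prop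

lemma continuous_bary (i : Fin 4) : Continuous (Q.bary i) := by unfold bary; fun_prop

lemma comb_mem_tri {i : Fin 4} {s t : ℝ} (hs : 0 ≤ s) (ht : 0 ≤ t) (hst : s + t ≤ 1) :
    Q.center + s • Q.arm i + t • Q.arm (i + 1) ∈ Q.tri i := by
  have h : Q.center + s • Q.arm i + t • Q.arm (i + 1) =
      (1 - s - t) • Q.center + (s • Q.v i + t • Q.v (i + 1)) := by
    simp only [arm]; module
  rw [h, tri]
  have := (convex_convexHull ℝ {Q.center, Q.v i, Q.v (i + 1)}).sum_mem (t := Finset.univ)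
    (w := ![1 - s - t, s, t]) (z := ![Q.center, Q.v i, Q.v (i + 1)]) ?_ ?_ ?_
  · simpa [Fin.sum_univ_three, add_assoc] using this
  · intro j _
    fin_cases j
    · simp; linarith
    · simpa
    · simpa
  · simp only [Fin.sum_univ_three, Matrix.cons_val_zero, Matrix.cons_val_one, Matrix.cons_val]
    ring
  · intro j _
    apply subset_convexHull
    fin_cases j <;> simp

lemma mem_tri_iff (i : Fin 4) (x : Plane) :
    x ∈ Q.tri i ↔ 0 ≤ Q.bx i x ∧ 0 ≤ Q.bary i x ∧ Q.bx i x + Q.bary i x ≤ 1 := by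
  constructor
  · intro hx
    have hconv : Convex ℝ {x | 0 ≤ Q.bx i x ∧ 0 ≤ Q.bary i x ∧ Q.bx i x + Q.bary i x ≤ 1} := by
      intro x hx y hy a b ha hb hab
      have hc : a • x + b • y - Q.center = a • (x - Q.center) + b • (y - Q.center) := by
        rw [show a = 1 - b by linarith]; module
      simp only [bx, bary, mem_ofPred_eq, hc, map_add, map_smul, smul_eq_mul] at hx hy ⊢
      obtain ⟨h1, h2, h3⟩ := hx
      obtain ⟨g1, g2, g3⟩ := hy
      refine ⟨by positivity, by positivity, ?_⟩
      nlinarith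
    refine convexHull_min ?_ hconv hx
    rintro y (rfl | rfl | rfl)
    · have h1 := Q.bx_comb i 0 0
      have h2 := Q.bary_comb i 0 0
      simp only [zero_smul, add_zero] at h1 h2
      simp [h1, h2]
    · have h1 := Q.bx_comb i 1 0
      have h2 := Q.bary_comb i 1 0
      simp only [zero_smul, one_smul, add_zero, ← v_eq] at h1 h2
      simp [h1, h2]
    · have h1 := Q.bx_comb i 0 1
      have h2 := Q.bary_comb i 0 1
      simp only [zero_smul, one_smul, add_zero, ← v_eq] at h1 h2
      simp [h1, h2]
  · rintro ⟨h1, h2, h3⟩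
    rw [Q.eq_coords i x]
    exact Q.comb_mem_tri h1 h2 h3

lemma isCompact_tri (i : Fin 4) : IsCompact (Q.tri i) :=
  Set.Finite.isCompact_convexHull ℝ (by simp)

lemma interior_tri_of_lt {i : Fin 4} {x : Plane} (h1 : 0 < Q.bx i x) (h2 : 0 < Q.bary i x)
    (h3 : Q.bx i x + Q.bary i x < 1) : x ∈ interior (Q.tri i) := by
  refine mem_interior.2 ⟨{x | 0 < Q.bx i x ∧ 0 < Q.bary i x ∧ Q.bx i x + Q.bary i x < 1}, ?_, ?_,
    h1, h2, h3⟩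
  · rintro y ⟨g1, g2, g3⟩
    exact (Q.mem_tri_iff i y).2 ⟨g1.le, g2.le, g3.le⟩
  · exact (isOpen_lt continuous_const (Q.continuous_bx i)).inter
      ((isOpen_lt continuous_const (Q.continuous_bary i)).inter
        (isOpen_lt ((Q.continuous_bx i).add (Q.continuous_bary i)) continuous_const))

/-- The linear parts of the equations of the sides of the four triangles. -/
def sideForm (z : Fin 4 × Fin 3) : Plane →L[ℝ] ℝ :=
  ![coordX (Q.arm z.1) (Q.arm (z.1 + 1)), coordY (Q.arm z.1) (Q.arm (z.1 + 1)),
    coordX (Q.arm z.1) (Q.arm (z.1 + 1)) + coordY (Q.arm z.1) (Q.arm (z.1 + 1))] z.2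

/-- The right hand sides of the equations of the sides of the four triangles. -/
def sideConst (z : Fin 4 × Fin 3) : ℝ := Q.sideForm z Q.center + ![0, 0, 1] z.2

lemma sideForm_ne_zero (z : Fin 4 × Fin 3) : Q.sideForm z ≠ 0 := by
  obtain ⟨i, j⟩ := z
  have h1 := coordX_comb (Q.cross_arm i) 1 1
  have h2 := coordY_comb (Q.cross_arm i) 1 1
  intro h
  have := congrArg (fun l => l ((1 : ℝ) • Q.arm i + (1 : ℝ) • Q.arm (i + 1))) h
  fin_cases j
  · simp only [sideForm] at this
    erw [h1] at this
    simp at this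
  · simp only [sideForm] at this
    erw [h2] at this
    simp at this
  · simp only [sideForm] at this
    erw [add_apply, h1, h2] at this
    norm_num at this

lemma mem_interior_tri {i : Fin 4} {x : Plane} (hx : x ∈ Q.tri i)
    (h : ∀ j, Q.sideForm (i, j) x ≠ Q.sideConst (i, j)) : x ∈ interior (Q.tri i) := by
  obtain ⟨h1, h2, h3⟩ := (Q.mem_tri_iff i x).1 hx
  have g1 := h 0
  have g2 := h 1
  have g3 := h 2
  simp only [sideForm, sideConst, Matrix.cons_val_zero, Matrix.cons_val_one, Matrix.cons_val,
    add_apply] at g1 g2 g3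
  simp only [bx, bary, map_sub] at h1 h2 h3
  refine Q.interior_tri_of_lt ?_ ?_ ?_ <;> simp only [bx, bary, map_sub]
  · exact lt_of_le_of_ne h1 fun h => g1 (by linarith)
  · exact lt_of_le_of_ne h2 fun h => g2 (by linarith)
  · exact lt_of_le_of_ne h3 fun h => g3 (by linarith)

lemma center_mem_carrier : Q.center ∈ Q.carrier :=
  (convex_convexHull ℝ _).segment_subset (subset_convexHull ℝ _ (mem_range_self 0))
    (subset_convexHull ℝ _ (mem_range_self 2)) (openSegment_subset_segment ℝ _ _ Q.center_mem_diag02)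

lemma tri_subset_carrier (i : Fin 4) : Q.tri i ⊆ Q.carrier := by
  refine convexHull_min ?_ (convex_convexHull ℝ _)
  rintro y (rfl | rfl | rfl)
  · exact Q.center_mem_carrier
  · exact subset_convexHull ℝ _ ⟨_, rfl⟩
  · exact subset_convexHull ℝ _ ⟨_, rfl⟩

/-- Write a point as the center plus a convex combination of the four arms. Opposite arms cancel
until at most one arm of each diagonal is left, with nonnegative weight no larger than before. The
surviving pair of arms names the triangle. -/
lemma carrier_eq : Q.carrier = ⋃ i, Q.tri i := by
  refine Subset.antisymm ?_ (iUnion_subset Q.tri_subset_carrier)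
  have hsub : Q.carrier ⊆ {x | ∃ w : Fin 4 → ℝ, (∀ i, 0 ≤ w i) ∧ ∑ i, w i = 1 ∧
      x = Q.center + ∑ i, w i • Q.arm i} := by
    refine convexHull_min ?_ ?_
    · rintro _ ⟨i, rfl⟩
      refine ⟨Pi.single i 1, fun j => ?_, by simp, ?_⟩
      · by_cases h : j = i <;> simp [h]
      · simp [Pi.single_apply, ite_smul, v_eq]
    · rintro _ ⟨w, h1, h2, rfl⟩ _ ⟨w', h1', h2', rfl⟩ a b ha hb hab
      refine ⟨fun i => a * w i + b * w' i, fun i => ?_, ?_, ?_⟩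
      · have := h1 i
        have := h1' i
        positivity
      · rw [Finset.sum_add_distrib, ← Finset.mul_sum, ← Finset.mul_sum, h2, h2']
        simpa using hab
      · simp only [add_smul, mul_smul, Finset.sum_add_distrib, ← Finset.smul_sum]
        rw [show a = 1 - b by linarith]
        module
  intro x hx
  obtain ⟨w, hw, hsum, hxw⟩ := hsub hx
  have a2 : Q.arm 2 = -Q.ratio 0 • Q.arm 0 := Q.arm_add_two 0
  have a3 : Q.arm 3 = -Q.ratio 1 • Q.arm 1 := Q.arm_add_two 1
  have p0 := Q.ratio_pos 0
  have p1 := Q.ratio_pos 1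
  have n0 := p0.ne'
  have n1 := p1.ne'
  have w0 := hw 0
  have w1 := hw 1
  have w2 := hw 2
  have w3 := hw 3
  rw [Fin.sum_univ_four] at hsum hxw
  have hx2 : x = Q.center + (w 0 - Q.ratio 0 * w 2) • Q.arm 0 +
      (w 1 - Q.ratio 1 * w 3) • Q.arm 1 := by
    rw [hxw, a2, a3]; module
  have q0 : w 2 - w 0 / Q.ratio 0 ≤ w 2 := sub_le_self _ (div_nonneg w0 p0.le)
  have q1 : w 3 - w 1 / Q.ratio 1 ≤ w 3 := sub_le_self _ (div_nonneg w1 p1.le)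
  have q0' : w 0 - Q.ratio 0 * w 2 ≤ w 0 := sub_le_self _ (mul_nonneg p0.le w2)
  have q1' : w 1 - Q.ratio 1 * w 3 ≤ w 1 := sub_le_self _ (mul_nonneg p1.le w3)
  have r0 : (w 2 - w 0 / Q.ratio 0) • Q.arm 2 = (w 0 - Q.ratio 0 * w 2) • Q.arm 0 := by
    rw [a2, smul_smul]; congr 1; field_simp; ring
  have r1 : (w 3 - w 1 / Q.ratio 1) • Q.arm 3 = (w 1 - Q.ratio 1 * w 3) • Q.arm 1 := by
    rw [a3, smul_smul]; congr 1; field_simp; ring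
  have s0 : w 0 - Q.ratio 0 * w 2 ≤ 0 → 0 ≤ w 2 - w 0 / Q.ratio 0 := fun h => by
    rw [sub_nonneg, div_le_iff₀ p0]; linarith
  have s1 : w 1 - Q.ratio 1 * w 3 ≤ 0 → 0 ≤ w 3 - w 1 / Q.ratio 1 := fun h => by
    rw [sub_nonneg, div_le_iff₀ p1]; linarith
  rw [mem_iUnion]
  rcases le_total 0 (w 0 - Q.ratio 0 * w 2) with h | h <;>
  rcases le_total 0 (w 1 - Q.ratio 1 * w 3) with h' | h'
  · exact ⟨0, hx2 ▸ Q.comb_mem_tri h h' (by linarith)⟩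
  · refine ⟨3, ?_⟩
    rw [hx2, add_right_comm, ← r1]
    exact Q.comb_mem_tri (s1 h') h (by linarith)
  · refine ⟨1, ?_⟩
    rw [hx2, add_right_comm, ← r0]
    exact Q.comb_mem_tri h' (s0 h) (by linarith)
  · refine ⟨2, ?_⟩
    rw [hx2, ← r0, ← r1]
    exact Q.comb_mem_tri (s0 h) (s1 h') (by linarith)

/-- Functions which agree on the half diagonals agree on intersections of triangles. -/
lemma eq_of_mem_inter {E : Type*} {f : Fin 4 → Plane → E}
    (h : ∀ i, ∀ t ∈ Icc (0 : ℝ) 1, f i (Q.center + t • Q.arm (i + 1)) =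
      f (i + 1) (Q.center + t • Q.arm (i + 1))) {i j : Fin 4} {x : Plane} (hi : x ∈ Q.tri i)
    (hj : x ∈ Q.tri j) : f i x = f j x := by
  -- In the frame of triangle `i`, membership in the next triangle makes the coordinate along `arm
  -- i` nonpositive, since `arm (i + 2)` is a negative multiple of `arm i`. So this coordinate is
  -- zero and `x` is on the common half diagonal.
  have hadj : ∀ i, x ∈ Q.tri i → x ∈ Q.tri (i + 1) → f i x = f (i + 1) x := by
    intro i hi hj
    obtain ⟨h1, h2, h3⟩ := (Q.mem_tri_iff _ _).1 hi
    obtain ⟨g1, g2, g3⟩ := (Q.mem_tri_iff _ _).1 hj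
    have e1 := Q.eq_coords i x
    have e2 := Q.eq_coords (i + 1) x
    rw [add_assoc i 1 1, show (1 + 1 : Fin 4) = 2 from rfl, arm_add_two] at e2
    have e3 : Q.center + Q.bx i x • Q.arm i + Q.bary i x • Q.arm (i + 1) =
        Q.center + (-(Q.bary (i + 1) x * Q.ratio i)) • Q.arm i + Q.bx (i + 1) x • Q.arm (i + 1) := by
      rw [← e1]
      nth_rewrite 1 [e2]
      module
    obtain ⟨k1, k2⟩ := Q.coords_unique e3
    have h0 : Q.bx i x = 0 :=
      le_antisymm (by rw [k1]; have := mul_nonneg g2 (Q.ratio_pos i).le; linarith) h1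
    rw [h0, zero_smul, add_zero] at e1
    rw [e1]
    exact h i _ ⟨h2, by linarith⟩
  -- For opposite triangles both coordinates vanish, so `x` is the center, which is reached through
  -- two adjacent steps.
  have hopp : ∀ i, x ∈ Q.tri i → x ∈ Q.tri (i + 2) → f i x = f (i + 2) x := by
    intro i hi hj
    obtain ⟨h1, h2, h3⟩ := (Q.mem_tri_iff _ _).1 hi
    obtain ⟨g1, g2, g3⟩ := (Q.mem_tri_iff _ _).1 hj
    have e1 := Q.eq_coords i x
    have e2 := Q.eq_coords (i + 2) x
    rw [add_right_comm i 2 1, arm_add_two, arm_add_two] at e2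
    have e3 : Q.center + Q.bx i x • Q.arm i + Q.bary i x • Q.arm (i + 1) =
        Q.center + (-(Q.bx (i + 2) x * Q.ratio i)) • Q.arm i +
          (-(Q.bary (i + 2) x * Q.ratio (i + 1))) • Q.arm (i + 1) := by
      rw [← e1]
      nth_rewrite 1 [e2]
      module
    obtain ⟨k1, k2⟩ := Q.coords_unique e3
    have h0 : Q.bx i x = 0 :=
      le_antisymm (by rw [k1]; have := mul_nonneg g1 (Q.ratio_pos i).le; linarith) h1
    have h0' : Q.bary i x = 0 :=
      le_antisymm (by rw [k2]; have := mul_nonneg g2 (Q.ratio_pos (i + 1)).le; linarith) h2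
    rw [h0, h0', zero_smul, zero_smul, add_zero, add_zero] at e1
    have hc := fun i => h i 0 (by simp)
    simp only [zero_smul, add_zero, ← e1] at hc
    rw [hc i, hc (i + 1), add_assoc]
    rfl
  have hcase : j = i ∨ j = i + 1 ∨ j = i + 2 ∨ i = j + 1 := by
    clear hi hj; revert i j; decide
  rcases hcase with rfl | rfl | rfl | rfl
  · rfl
  · exact hadj _ hi hj
  · exact hopp _ hi hj
  · exact (hadj _ hj hi).symm

lemma interior_tri_nonempty (i : Fin 4) : (interior (Q.tri i)).Nonempty :=
  ⟨_, Q.interior_tri_of_lt (x := Q.center + (1 / 3 : ℝ) • Q.arm i + (1 / 3 : ℝ) • Q.arm (i + 1))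
    (by rw [bx_comb]; norm_num) (by rw [bary_comb]; norm_num)
    (by rw [bx_comb, bary_comb]; norm_num)⟩

lemma uniqueDiffOn_carrier : UniqueDiffOn ℝ Q.carrier :=
  uniqueDiffOn_convex (convex_convexHull ℝ _)
    ((Q.interior_tri_nonempty 0).mono (interior_mono (Q.tri_subset_carrier 0)))

/-- Points of the open half diagonals are interior, and the two adjacent triangles cover the two
sides of the diagonal near such a point. -/
lemma exists_nhds_diag (i : Fin 4) {t : ℝ} (h0 : 0 < t) (h1 : t < 1) :
    ∃ B : Set Plane, IsOpen B ∧ Q.center + t • Q.arm (i + 1) ∈ B ∧ B ⊆ interior Q.carrier ∧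
      (∀ x ∈ B, 0 ≤ Q.bary (i + 1) x → x ∈ Q.tri (i + 1)) ∧
      ∀ x ∈ B, Q.bary (i + 1) x ≤ 0 → x ∈ Q.tri i := by
  -- The second inequality is the outer edge of `tri (i + 1)`; the third is the outer edge of `tri
  -- i`, expressed in the coordinates of `tri (i + 1)` by means of `arm (i + 2) = -ρ i • arm i`.
  set B : Set Plane := {x | 0 < Q.bx (i + 1) x ∧ Q.bx (i + 1) x + Q.bary (i + 1) x < 1 ∧
    Q.bx (i + 1) x - Q.ratio i * Q.bary (i + 1) x < 1}
  have hX := Q.continuous_bx (i + 1)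
  have hY := Q.continuous_bary (i + 1)
  have hBo : IsOpen B := (isOpen_lt continuous_const hX).inter
    ((isOpen_lt (hX.add hY) continuous_const).inter
      (isOpen_lt (hX.sub (continuous_const.mul hY)) continuous_const))
  have hp : ∀ x ∈ B, 0 ≤ Q.bary (i + 1) x → x ∈ Q.tri (i + 1) := fun x hx hxy =>
    (Q.mem_tri_iff _ _).2 ⟨hx.1.le, hxy, hx.2.1.le⟩
  have hn : ∀ x ∈ B, Q.bary (i + 1) x ≤ 0 → x ∈ Q.tri i := by
    intro x hx hxy
    have e2 := Q.eq_coords (i + 1) x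
    rw [add_assoc i 1 1, show (1 + 1 : Fin 4) = 2 from rfl, arm_add_two] at e2
    have e3 : x = Q.center + (-(Q.ratio i * Q.bary (i + 1) x)) • Q.arm i +
        Q.bx (i + 1) x • Q.arm (i + 1) := by
      nth_rewrite 1 [e2]
      module
    rw [e3]
    refine Q.comb_mem_tri ?_ hx.1.le (by linarith [hx.2.2])
    have := mul_nonneg (Q.ratio_pos i).le (neg_nonneg.2 hxy)
    linarith
  refine ⟨B, hBo, ?_, ?_, hp, hn⟩
  · have h2 := Q.bx_comb (i + 1) t 0
    have h3 := Q.bary_comb (i + 1) t 0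
    rw [zero_smul, add_zero] at h2 h3
    simp [B, h2, h3, h0, h1]
  · refine interior_maximal (fun x hx => ?_) hBo
    rcases le_total 0 (Q.bary (i + 1) x) with h | h
    · exact Q.tri_subset_carrier _ (hp x hx h)
    · exact Q.tri_subset_carrier _ (hn x hx h)

end ConvexQuad

/-! ### The macro-element space as a space of C¹ piecewise polynomials. -/

namespace ConvexQuad

variable (Q : ConvexQuad)

/-- The polynomials `p i` are the pieces of the `C¹` function `u` on the quadrilateral. -/
abbrev IsPieces (p : Fin 4 → MvPolynomial (Fin 2) ℝ) (u : Plane → ℝ) : Prop :=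
  IsGlued Q.tri (fun i x => evalAt x (p i)) u

variable {Q}

lemma memH2_of_isPieces {p : Fin 4 → MvPolynomial (Fin 2) ℝ} {u : Plane → ℝ}
    (h : Q.IsPieces p u) : MemH2 (interior Q.carrier) u :=
  h.memH2 isOpen_interior (interior_subset.trans Q.carrier_eq.subset) Q.sideForm_ne_zero
    (c := Q.sideConst) fun _ _ hx hl => Q.mem_interior_tri hx fun j => hl (_, j)

lemma eqOn_Icc_of_eqOn_Ioo {E : Type*} [TopologicalSpace E] [T2Space E] {f g : ℝ → E}
    (hf : Continuous f) (hg : Continuous g) (h : ∀ t, 0 < t → t < 1 → f t = g t) :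
    ∀ t ∈ Icc (0 : ℝ) 1, f t = g t := by
  have h1 : EqOn f g (Ioo 0 1) := fun t ht => h t ht.1 ht.2
  have h2 := h1.closure hf hg
  rw [closure_Ioo (by norm_num)] at h2
  exact h2

/-- Membership in H² excludes a jump of the gradient at points of the open half diagonals.
Continuity of the polynomial gradients carries the match to the center and the vertices. The values
match because every piece equals `u` on its closed triangle. -/
lemma exists_isPieces {k : ℕ} {u : Plane → ℝ} (hu : u ∈ Q.Sigma k) :
    ∃ p : Fin 4 → MvPolynomial (Fin 2) ℝ, (∀ i, p i ∈ Poly ((k : ℤ) + 1)) ∧ Q.IsPieces p u := by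
  obtain ⟨-, h2, h⟩ := hu
  choose p hp hpu using h
  refine ⟨p, hp, Q.isCompact_tri, fun i => contDiff_evalAt _, hpu, ?_⟩
  intro i j x hi hj
  refine Q.eq_of_mem_inter (f := fun i => grad (p i)) (fun i => ?_) hi hj
  refine eqOn_Icc_of_eqOn_Ioo ((continuous_grad _).comp (by fun_prop))
    ((continuous_grad _).comp (by fun_prop)) fun t h0 h1 => ?_
  obtain ⟨B, hB, hx, hBc, hpos, hneg⟩ := Q.exists_nhds_diag i h0 h1
  -- The sign of `bary` tells on which side of the half diagonal a point lies, in the form required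
  -- by `fderiv_eq_of_memH2`.
  have hY : ∀ x, coordY (Q.arm (i + 1)) (Q.arm (i + 1 + 1)) x -
      coordY (Q.arm (i + 1)) (Q.arm (i + 1 + 1)) (Q.center + t • Q.arm (i + 1)) =
      Q.bary (i + 1) x := by
    intro x
    have := Q.bary_comb (i + 1) t 0
    rw [zero_smul, add_zero, bary, map_sub] at this
    rw [bary, map_sub]
    linarith
  refine (fderiv_eq_of_memH2 (Q.cross_arm (i + 1)) hB hx (contDiff_evalAt _) (contDiff_evalAt _)
    (fun x hxB hle => ?_) (fun x hxB hle => ?_) (h2.mono hBc)).symm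
  · exact hpu _ _ (hpos x hxB (by linarith [hY x]))
  · exact hpu _ _ (hneg x hxB (by linarith [hY x]))

lemma mem_Sigma_of_isPieces {k : ℕ} {u : Plane → ℝ} (h0 : ∀ x ∉ Q.carrier, u x = 0)
    {p : Fin 4 → MvPolynomial (Fin 2) ℝ} (hp : ∀ i, p i ∈ Poly ((k : ℤ) + 1))
    (h : Q.IsPieces p u) : u ∈ Q.Sigma k :=
  ⟨h0, memH2_of_isPieces h, fun i => ⟨p i, hp i, h.eq i⟩⟩

lemma IsPieces.contDiffOn {p : Fin 4 → MvPolynomial (Fin 2) ℝ} {u : Plane → ℝ}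
    (h : Q.IsPieces p u) : ContDiffOn ℝ 1 u Q.carrier := by
  have hu := Q.uniqueDiffOn_carrier
  rw [carrier_eq] at hu ⊢
  exact IsGlued.contDiffOn h hu

lemma IsPieces.deriv_eq {p : Fin 4 → MvPolynomial (Fin 2) ℝ} {u : Plane → ℝ}
    (h : Q.IsPieces p u) {i : Fin 4} {x : Plane} (hx : x ∈ Q.tri i) (d : Plane) :
    Q.deriv u x d = grad (p i) x d := by
  have hu := Q.uniqueDiffOn_carrier
  rw [ConvexQuad.deriv]
  rw [carrier_eq] at hu ⊢
  rw [IsGlued.fderivWithin_eq h hu hx]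
  rfl

end ConvexQuad

/-! ### Polynomial identities and integrals -/

lemma coeff_eq_zero_of_quartic {a₀ a₁ a₂ a₃ a₄ : ℝ}
    (h : ∀ t ∈ Icc (0 : ℝ) 1, a₀ + a₁ * t + a₂ * t ^ 2 + a₃ * t ^ 3 + a₄ * t ^ 4 = 0) :
    a₀ = 0 ∧ a₁ = 0 ∧ a₂ = 0 ∧ a₃ = 0 ∧ a₄ = 0 := by
  have h0 := h 0 (by norm_num)
  have h1 := h (1 / 4) (by norm_num)
  have h2 := h (1 / 2) (by norm_num)
  have h3 := h (3 / 4) (by norm_num)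
  have h4 := h 1 (by norm_num)
  norm_num at h0 h1 h2 h3 h4
  subst h0
  refine ⟨rfl, ?_, ?_, ?_, ?_⟩ <;> linarith

/-- Degree five is what a quartic leaves as a function of `x` after integration over `0 ≤ y ≤ 1 -
x`. -/
lemma integral_quintic (b₀ b₁ b₂ b₃ b₄ b₅ s : ℝ) :
    ∫ t in (0 : ℝ)..s, (b₀ + b₁ * t + b₂ * t ^ 2 + b₃ * t ^ 3 + b₄ * t ^ 4 + b₅ * t ^ 5) =
      b₀ * s + b₁ / 2 * s ^ 2 + b₂ / 3 * s ^ 3 + b₃ / 4 * s ^ 4 + b₄ / 5 * s ^ 5 +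
        b₅ / 6 * s ^ 6 := by
  have hd : ∀ t : ℝ, HasDerivAt (fun s => b₀ * s + b₁ / 2 * s ^ 2 + b₂ / 3 * s ^ 3 +
      b₃ / 4 * s ^ 4 + b₄ / 5 * s ^ 5 + b₅ / 6 * s ^ 6)
      (b₀ + b₁ * t + b₂ * t ^ 2 + b₃ * t ^ 3 + b₄ * t ^ 4 + b₅ * t ^ 5) t := by
    intro t
    have h := hasDerivAt_id' t
    refine ((((((h.const_mul b₀).add ((h.pow 2).const_mul (b₁ / 2))).add
      ((h.pow 3).const_mul (b₂ / 3))).add ((h.pow 4).const_mul (b₃ / 4))).add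
      ((h.pow 5).const_mul (b₄ / 5))).add ((h.pow 6).const_mul (b₅ / 6))).congr_deriv ?_
    norm_num
    ring
  rw [intervalIntegral.integral_eq_sub_of_hasDerivAt (fun t _ => hd t)
    (Continuous.intervalIntegrable (by fun_prop) _ _)]
  ring

/-- The weights are the moments `m! n! / (m + n + 2)!` of the monomials on the unit triangle. -/
lemma integral_quartic_triangle (c : ℕ → ℕ → ℝ) :
    ∫ x in (0 : ℝ)..1, ∫ y in (0 : ℝ)..(1 - x), quartic c x y =
      c 0 0 / 2 + c 1 0 / 6 + c 0 1 / 6 + c 2 0 / 12 + c 1 1 / 24 + c 0 2 / 12 + c 3 0 / 20 +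
      c 2 1 / 60 + c 1 2 / 60 + c 0 3 / 20 + c 4 0 / 30 + c 3 1 / 120 + c 2 2 / 180 +
      c 1 3 / 120 + c 0 4 / 30 := by
  have hin : ∀ x : ℝ, ∫ y in (0 : ℝ)..(1 - x), quartic c x y =
      (c 0 0 + (1 / 2) * c 0 1 + (1 / 3) * c 0 2 + (1 / 4) * c 0 3 + (1 / 5) * c 0 4) +
      (-c 0 0 - c 0 1 - c 0 2 - c 0 3 - c 0 4 + c 1 0 + (1 / 2) * c 1 1 + (1 / 3) * c 1 2 +
        (1 / 4) * c 1 3) * x +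
      ((1 / 2) * c 0 1 + c 0 2 + (3 / 2) * c 0 3 + 2 * c 0 4 - c 1 0 - c 1 1 - c 1 2 - c 1 3 +
        c 2 0 + (1 / 2) * c 2 1 + (1 / 3) * c 2 2) * x ^ 2 +
      ((-1 / 3) * c 0 2 - c 0 3 - 2 * c 0 4 + (1 / 2) * c 1 1 + c 1 2 + (3 / 2) * c 1 3 - c 2 0 -
        c 2 1 - c 2 2 + c 3 0 + (1 / 2) * c 3 1) * x ^ 3 +
      ((1 / 4) * c 0 3 + c 0 4 + (-1 / 3) * c 1 2 - c 1 3 + (1 / 2) * c 2 1 + c 2 2 - c 3 0 -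
        c 3 1 + c 4 0) * x ^ 4 +
      ((-1 / 5) * c 0 4 + (1 / 4) * c 1 3 + (-1 / 3) * c 2 2 + (1 / 2) * c 3 1 - c 4 0) * x ^ 5 := by
    intro x
    have : ∀ y, quartic c x y =
        (c 0 0 + c 1 0 * x + c 2 0 * x ^ 2 + c 3 0 * x ^ 3 + c 4 0 * x ^ 4) +
        (c 0 1 + c 1 1 * x + c 2 1 * x ^ 2 + c 3 1 * x ^ 3) * y +
        (c 0 2 + c 1 2 * x + c 2 2 * x ^ 2) * y ^ 2 + (c 0 3 + c 1 3 * x) * y ^ 3 +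
        c 0 4 * y ^ 4 + 0 * y ^ 5 := by
      intro y
      unfold quartic
      ring
    simp_rw [this]
    rw [integral_quintic]
    ring
  simp_rw [hin]
  rw [integral_quintic]
  ring

lemma lineMap_eq_comb (a b n : Plane) (t : ℝ) :
    AffineMap.lineMap a b t = a + t • (b - a) + (0 : ℝ) • n := by
  rw [AffineMap.lineMap_apply]
  simp [add_comm]

lemma clm_eq_zero {a b : Plane} (h : cross a b ≠ 0) {l : Plane →L[ℝ] ℝ} (ha : l a = 0)
    (hb : l b = 0) : l = 0 := by
  ext v
  rw [← coord_spec h v]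
  simp [ha, hb]

/-- A polynomial whose degrees of freedom on an edge vanish is zero on the edge together with its
gradient. -/
theorem eq_zero_on_edge {k : ℕ} (hk : k = 2 ∨ k = 3) {p : MvPolynomial (Fin 2) ℝ}
    (hp : p ∈ Poly ((k : ℤ) + 1)) {a b n : Plane} (hn : cross (b - a) n ≠ 0)
    (ha : evalAt a p = 0) (hb : evalAt b p = 0) (ha' : grad p a = 0) (hb' : grad p b = 0)
    (hN : ∀ q ∈ Poly ((k : ℤ) - 2), ∫ t in (0 : ℝ)..1,
      grad p (AffineMap.lineMap a b t) n * evalAt (AffineMap.lineMap a b t) q = 0)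
    (hV : ∀ q ∈ Poly ((k : ℤ) - 3), ∫ t in (0 : ℝ)..1,
      evalAt (AffineMap.lineMap a b t) p * evalAt (AffineMap.lineMap a b t) q = 0) (t : ℝ) :
    evalAt (AffineMap.lineMap a b t) p = 0 ∧ grad p (AffineMap.lineMap a b t) = 0 := by
  -- In the frame `(b - a, n)` at `a` the edge is `y = 0`, where the value is a polynomial of degree
  -- `k + 1` in `t` and the normal derivative one of degree `k`.
  obtain ⟨c, hc, he⟩ := exists_expansion (by omega) hp a (b - a) n
  have hv : ∀ t, evalAt (AffineMap.lineMap a b t) p = quartic c t 0 := fun t => by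
    rw [lineMap_eq_comb a b n, he.eval]
  have hx : ∀ t, grad p (AffineMap.lineMap a b t) (b - a) = quarticX c t 0 := fun t => by
    rw [lineMap_eq_comb a b n, he.gradX]
  have hy : ∀ t, grad p (AffineMap.lineMap a b t) n = quarticY c t 0 := fun t => by
    rw [lineMap_eq_comb a b n, he.gradY]
  have v0 := hv 0
  have v1 := hv 1
  have x0 := hx 0
  have x1 := hx 1
  have y0 := hy 0
  have y1 := hy 1
  simp only [AffineMap.lineMap_apply_zero, AffineMap.lineMap_apply_one, ha, hb, ha', hb',
    zero_apply] at v0 v1 x0 x1 y0 y1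
  simp only [quartic, quarticX, quarticY] at v0 v1 x0 x1 y0 y1
  norm_num at v0 v1 x0 x1 y0 y1
  have hN1 : (∫ t in (0 : ℝ)..1, quarticY c t 0) = 0 := by
    have := hN (MvPolynomial.C 1) (C_mem_Poly 1 (by omega))
    simpa only [evalAt_C, mul_one, hy] using this
  have hN1' : c 0 1 + c 1 1 / 2 + c 2 1 / 3 + c 3 1 / 4 = 0 := by
    have h2 := integral_quintic (c 0 1) (c 1 1) (c 2 1) (c 3 1) 0 0 1
    have h3 : ∀ t, quarticY c t 0 =
        c 0 1 + c 1 1 * t + c 2 1 * t ^ 2 + c 3 1 * t ^ 3 + 0 * t ^ 4 + 0 * t ^ 5 := fun t => by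
      unfold quarticY; ring
    simp_rw [h3] at hN1
    linarith
  -- A double zero at each end annihilates a cubic and leaves a multiple of `t² (1 - t)²` of a
  -- quartic, which has zero mean only if it is zero.
  have hvz : c 2 0 = 0 ∧ c 3 0 = 0 ∧ c 4 0 = 0 := by
    rcases hk with rfl | rfl
    · have h4 := hc 4 0 (by norm_num)
      refine ⟨?_, ?_, h4⟩ <;> linarith
    · have h1 := hV (MvPolynomial.C 1) (C_mem_Poly 1 (by norm_num))
      simp only [evalAt_C, mul_one, hv] at h1
      have h2 := integral_quintic (c 0 0) (c 1 0) (c 2 0) (c 3 0) (c 4 0) 0 1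
      have h3 : c 0 0 + c 1 0 / 2 + c 2 0 / 3 + c 3 0 / 4 + c 4 0 / 5 = 0 := by
        rw [← h1]
        simpa [quartic] using h2.symm
      refine ⟨?_, ?_, ?_⟩ <;> linarith
  -- The normal derivative is `t (1 - t)` times a polynomial of degree `k - 2` and is orthogonal to
  -- all polynomials of that degree on the edge.
  have hyz : c 1 1 = 0 ∧ c 2 1 = 0 ∧ c 3 1 = 0 := by
    rcases hk with rfl | rfl
    · have h4 := hc 3 1 (by norm_num)
      refine ⟨?_, ?_, h4⟩ <;> linarith
    -- This affine test function takes the value `t` at the point of parameter `t`.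
    · have h1 := hN (affinePoly (coordX (b - a) n) (-coordX (b - a) n a)) (affinePoly_mem _ _)
      have hq : ∀ t : ℝ, evalAt (AffineMap.lineMap a b t)
          (affinePoly (coordX (b - a) n) (-coordX (b - a) n a)) = t := by
        intro t
        have h5 := coordX_comb hn t 0
        rw [evalAt_affinePoly, lineMap_eq_comb a b n, add_assoc, map_add, h5]
        ring
      simp only [hq, hy] at h1
      have h2 := integral_quintic 0 (c 0 1) (c 1 1) (c 2 1) (c 3 1) 0 1
      have h3 : c 0 1 / 2 + c 1 1 / 3 + c 2 1 / 4 + c 3 1 / 5 = 0 := by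
        rw [← h1]
        norm_num at h2
        rw [← h2]
        congr 1
        ext t
        simp only [quarticY]
        ring
      refine ⟨?_, ?_, ?_⟩ <;> linarith
  obtain ⟨z1, z2, z3⟩ := hvz
  obtain ⟨z4, z5, z6⟩ := hyz
  refine ⟨?_, clm_eq_zero hn ?_ ?_⟩
  · rw [hv]
    simp [quartic, ← v0, ← x0, z1, z2, z3]
  · rw [hx]
    simp [quarticX, ← x0, z1, z2, z3]
  · rw [hy]
    simp [quarticY, ← y0, z4, z5, z6]

/-! ### The linear algebra of unisolvence -/

/-- The coefficients of a quartic which vanishes to second order on the line `x + y = 1`. -/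
lemma coeff_of_double_zero {c : ℕ → ℕ → ℝ} (h : ∀ t : ℝ, quartic c (1 - t) t = 0)
    (hx : ∀ t : ℝ, quarticX c (1 - t) t = 0) :
    ∃ e X Y A B C : ℝ, c 0 0 = e ∧ c 1 0 = X - 2 * e ∧ c 0 1 = Y - 2 * e ∧
      c 2 0 = A - 2 * X + e ∧ c 1 1 = B - 2 * X - 2 * Y + 2 * e ∧ c 0 2 = C - 2 * Y + e ∧
      c 3 0 = X - 2 * A ∧ c 2 1 = Y + 2 * X - 2 * (A + B) ∧ c 1 2 = X + 2 * Y - 2 * (B + C) ∧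
      c 0 3 = Y - 2 * C ∧ c 4 0 = A ∧ c 3 1 = B + 2 * A ∧ c 2 2 = A + 2 * B + C ∧
      c 1 3 = B + 2 * C ∧ c 0 4 = C := by
  -- On the line the value is a quartic in `t`, fixed by five samples, and the derivative a cubic,
  -- fixed by four: nine conditions on fifteen coefficients leave six parameters.
  have h0 := h 0
  have h1 := h 1
  have h2 := h 2
  have h3 := h (-1)
  have h4 := h (1 / 2)
  have g0 := hx 0
  have g1 := hx 1
  have g2 := hx 2
  have g3 := hx (-1)
  simp only [quartic, quarticX] at h0 h1 h2 h3 h4 g0 g1 g2 g3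
  norm_num at h0 h1 h2 h3 h4 g0 g1 g2 g3
  -- The parameters are the coefficients of the cofactor `e + X x + Y y + A x² + B x y + C y²` of
  -- `(1 - x - y)²`, read off by multiplying the quartic with `1 + 2 (x + y) + 3 (x + y)² + ⋯`.
  refine ⟨c 0 0, c 1 0 + 2 * c 0 0, c 0 1 + 2 * c 0 0, c 2 0 + 2 * c 1 0 + 3 * c 0 0,
    c 1 1 + 2 * c 1 0 + 2 * c 0 1 + 6 * c 0 0, c 0 2 + 2 * c 0 1 + 3 * c 0 0, rfl, by ring,
    by ring, by ring, by ring, by ring, ?_, ?_, ?_, ?_, ?_, ?_, ?_, ?_, ?_⟩ <;> linarith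

/-- Write each piece as `(1 - x - y)²` times a quadratic cofactor with coefficients `e, X, Y, A, B,
C`. Matching across the half diagonals makes `e` common to all triangles and shows that the
cofactors vanish at the vertices; what remains is a small cyclic system in which `1 + ρ i > 0` can
always be cancelled. -/
lemma quartic_eq_zero_of_homogeneous {k : ℕ} (hk : k = 2 ∨ k = 3) {c : Fin 4 → ℕ → ℕ → ℝ}
    {ρ : Fin 4 → ℝ} (hρ : ∀ i, 0 < ρ i) (hdeg : ∀ i, ∀ m n : ℕ, k + 1 < m + n → c i m n = 0)
    (hedge : ∀ i, ∀ t : ℝ, quartic (c i) (1 - t) t = 0)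
    (hedgeX : ∀ i, ∀ t : ℝ, quarticX (c i) (1 - t) t = 0)
    (hval : ∀ i, ∀ t ∈ Icc (0 : ℝ) 1, quartic (c i) 0 t = quartic (c (i + 1)) t 0)
    (hder : ∀ i, ∀ t ∈ Icc (0 : ℝ) 1, quarticY (c (i + 1)) t 0 = -ρ i * quarticX (c i) 0 t)
    (hint : k = 3 → ∀ i, ∫ x in (0 : ℝ)..1, ∫ y in (0 : ℝ)..(1 - x), quartic (c i) x y = 0)
    (i : Fin 4) (x y : ℝ) : quartic (c i) x y = 0 := by
  choose e X Y A B C e00 e10 e01 e20 e11 e02 e30 e21 e12 e03 e40 e31 e22 e13 e04 using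
    fun i => coeff_of_double_zero (hedge i) (hedgeX i)
  -- Equality of values on the common half diagonal means equality of the two cofactors there.
  have hmatch : ∀ i, e (i + 1) = e i ∧ X (i + 1) = Y i ∧ A (i + 1) = C i := by
    intro i
    have := coeff_eq_zero_of_quartic (a₀ := c i 0 0 - c (i + 1) 0 0)
      (a₁ := c i 0 1 - c (i + 1) 1 0) (a₂ := c i 0 2 - c (i + 1) 2 0)
      (a₃ := c i 0 3 - c (i + 1) 3 0) (a₄ := c i 0 4 - c (i + 1) 4 0) fun t ht => by
        have := hval i t ht
        simp only [quartic] at this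
        linarith
    obtain ⟨h0, h1, h2, h3, h4⟩ := this
    rw [e00, e00] at h0
    rw [e01, e10] at h1
    rw [e04, e40] at h4
    refine ⟨by linarith, by linarith, by linarith⟩
  -- Matching of the transversal derivatives, compared in the powers 0, 1 and 3 of `t`. Eliminating
  -- the other two relations from the linear one leaves `Y + C + e = 0`: the cofactor vanishes at
  -- the vertex `y = 1`.
  have hrel : ∀ i, Y i = -C i - e i ∧ Y (i + 1) + ρ i * X i = 2 * e i * (1 + ρ i) ∧
      B (i + 1) + ρ i * B i = -2 * C i * (1 + ρ i) := by
    intro i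
    have := coeff_eq_zero_of_quartic (a₀ := c (i + 1) 0 1 + ρ i * c i 1 0)
      (a₁ := c (i + 1) 1 1 + ρ i * c i 1 1) (a₂ := c (i + 1) 2 1 + ρ i * c i 1 2)
      (a₃ := c (i + 1) 3 1 + ρ i * c i 1 3) (a₄ := 0) fun t ht => by
        have := hder i t ht
        simp only [quarticX, quarticY] at this
        linarith
    obtain ⟨h0, h1, h2, h3, -⟩ := this
    obtain ⟨m1, m2, m3⟩ := hmatch i
    rw [e01, e10, m1] at h0
    rw [e11, e11, m1, m2] at h1
    rw [e31, e13, m3] at h3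
    have hp : (1 + ρ i) ≠ 0 := by have := hρ i; positivity
    have h5 : (1 + ρ i) * (Y i + C i + e i) = 0 := by linarith
    have h6 := (mul_eq_zero.1 h5).resolve_left hp
    exact ⟨by linarith, by linarith, by linarith⟩
  have hp : ∀ i, (1 + ρ i) ≠ 0 := fun i => by have := hρ i; positivity
  have hprev : ∀ i : Fin 4, X i = -A i - e i ∧ A i = C (i - 1) ∧ e (i - 1) = e i := by
    intro i
    have h1 := hmatch (i - 1)
    have h2 := (hrel (i - 1)).1
    rw [sub_add_cancel] at h1
    exact ⟨by linarith, by linarith, by linarith⟩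
  have hzero : ∀ i, e i = 0 ∧ B i = 0 ∧ C i = 0 := by
    rcases hk with rfl | rfl
    · intro i
      -- For `k = 2` the cofactors are affine, so `X = Y = -e`, and the relation for `Y (i + 1) + ρ
      -- i * X i` turns into `3 (1 + ρ i) e = 0`.
      have hC : ∀ i, C i = 0 := fun i => (e04 i).symm.trans (hdeg i 0 4 (by norm_num))
      have hA : A i = 0 := (e40 i).symm.trans (hdeg i 4 0 (by norm_num))
      have hB : B i = 0 := by
        have := (e31 i).symm.trans (hdeg i 3 1 (by norm_num))
        linarith
      refine ⟨?_, hB, hC i⟩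
      obtain ⟨-, r2, -⟩ := hrel i
      rw [(hrel (i + 1)).1, (hprev i).1, hA, hC, (hmatch i).1] at r2
      have : (1 + ρ i) * e i = 0 := by linarith
      exact (mul_eq_zero.1 this).resolve_left (hp i)
    · have hmom : ∀ i, B i = -18 * e i + 4 * (A i + C i) := by
        intro i
        have h1 := hint rfl i
        have h2 := (hrel i).1
        have h3 := (hprev i).1
        rw [integral_quartic_triangle, e00, e10, e01, e20, e11, e02, e30, e21, e12, e03, e40,
          e31, e22, e13, e04, h2, h3] at h1
        linarith
      -- The second relation reads `C (i + 1) + ρ i * A i = -3 (1 + ρ i) e`; inserted into the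
      -- third, with `B` eliminated by the mean, it gives `6 C = 30 e`.
      have hC : ∀ i, C i = 5 * e i := by
        intro i
        obtain ⟨-, r2, r3⟩ := hrel i
        obtain ⟨m1, m2, m3⟩ := hmatch i
        rw [(hrel (i + 1)).1, (hprev i).1, m1] at r2
        rw [hmom, hmom, m1, m3] at r3
        have : (1 + ρ i) * (C i - 5 * e i) = 0 := by linarith
        linarith [(mul_eq_zero.1 this).resolve_left (hp i)]
      -- With `A = C = 5 e` throughout, the second relation becomes `5 (1 + ρ i) e = -3 (1 + ρ i)
      -- e`.
      have he : ∀ i, e i = 0 := by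
        intro i
        obtain ⟨-, r2, -⟩ := hrel i
        obtain ⟨m1, m2, m3⟩ := hmatch i
        obtain ⟨q1, q2, q3⟩ := hprev i
        rw [(hrel (i + 1)).1, q1, q2, hC, hC, m1, q3] at r2
        have : (1 + ρ i) * e i = 0 := by linarith
        exact (mul_eq_zero.1 this).resolve_left (hp i)
      intro i
      refine ⟨he i, ?_, by rw [hC, he, mul_zero]⟩
      rw [hmom, (hprev i).2.1, hC, hC, he, he]
      norm_num
  obtain ⟨z1, z2, z3⟩ := hzero i
  have z4 : A i = 0 := (hprev i).2.1.trans (hzero (i - 1)).2.2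
  have z5 : X i = 0 := by rw [(hprev i).1, z4, z1]; norm_num
  have z6 : Y i = 0 := by rw [(hrel i).1, z3, z1]; norm_num
  rw [quartic, e00, e10, e01, e20, e11, e02, e30, e21, e12, e03, e40, e31, e22, e13, e04, z1, z2,
    z3, z4, z5, z6]
  ring

/-! ### Edges and their normals. -/

lemma cross_ne_zero_of_orthogonal {d n : Plane} (hd : d ≠ 0) (hn : ‖n‖ = 1)
    (h : inner ℝ n d = 0) : cross d n ≠ 0 := by
  intro hc
  have hn2 : n 0 ^ 2 + n 1 ^ 2 = 1 := by
    have := EuclideanSpace.real_norm_sq_eq n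
    rw [hn, Fin.sum_univ_two] at this
    linarith
  have hi : n 0 * d 0 + n 1 * d 1 = 0 := by
    simp [PiLp.inner_apply, Fin.sum_univ_two] at h
    linarith
  simp only [cross] at hc
  apply hd
  ext i
  fin_cases i
  · have : d 0 = d 0 * (n 0 ^ 2 + n 1 ^ 2) := by rw [hn2, mul_one]
    have h2 : d 0 * (n 0 ^ 2 + n 1 ^ 2) =
      n 0 * (n 0 * d 0 + n 1 * d 1) + n 1 * (d 0 * n 1 - d 1 * n 0) := by ring
    rw [hi, hc] at h2
    simp
    linarith
  · have : d 1 = d 1 * (n 0 ^ 2 + n 1 ^ 2) := by rw [hn2, mul_one]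
    have h2 : d 1 * (n 0 ^ 2 + n 1 ^ 2) =
      n 1 * (n 0 * d 0 + n 1 * d 1) - n 0 * (d 0 * n 1 - d 1 * n 0) := by ring
    rw [hi, hc] at h2
    simp
    linarith

namespace ConvexQuad

variable (Q : ConvexQuad)

lemma arm_ne_arm (i : Fin 4) : Q.arm (i + 1) - Q.arm i ≠ 0 := by
  intro h
  have := Q.cross_arm i
  rw [sub_eq_zero.1 h, cross_self] at this
  exact this rfl

lemma v_ne_v (i : Fin 4) : Q.v i ≠ Q.v (i + 1) := by
  intro h
  exact Q.arm_ne_arm i (by simp [arm, h])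

lemma cross_normal {i : Fin 4} {n : Plane} (hn : Q.IsUnitNormal i n) :
    cross (Q.v (i + 1) - Q.v i) n ≠ 0 :=
  cross_ne_zero_of_orthogonal (sub_ne_zero.2 (Q.v_ne_v i).symm) hn.1 hn.2

lemma lineMap_eq (i : Fin 4) (t : ℝ) : AffineMap.lineMap (Q.v i) (Q.v (i + 1)) t =
    Q.center + (1 - t) • Q.arm i + t • Q.arm (i + 1) := by
  rw [AffineMap.lineMap_apply]
  simp only [arm, vsub_eq_sub, vadd_eq_add]
  module

lemma lineMap_mem_edge (i : Fin 4) {t : ℝ} (ht : t ∈ Icc (0 : ℝ) 1) :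
    AffineMap.lineMap (Q.v i) (Q.v (i + 1)) t ∈ Q.edge i := by
  rw [edge, segment_eq_image_lineMap]
  exact mem_image_of_mem _ ht

lemma edge_subset_tri (i : Fin 4) : Q.edge i ⊆ Q.tri i := by
  intro x hx
  rw [edge, segment_eq_image_lineMap] at hx
  obtain ⟨t, ht, rfl⟩ := hx
  rw [lineMap_eq]
  exact Q.comb_mem_tri (by linarith [ht.2]) ht.1 (by linarith)

lemma v_mem_edge (i : Fin 4) : Q.v i ∈ Q.edge i := left_mem_segment ℝ _ _

lemma v_mem_tri (i : Fin 4) : Q.v i ∈ Q.tri i := Q.edge_subset_tri i (Q.v_mem_edge i)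

lemma v_succ_mem_tri (i : Fin 4) : Q.v (i + 1) ∈ Q.tri i :=
  Q.edge_subset_tri i (right_mem_segment ℝ _ _)

/-! ### Test functions -/

lemma inner_refVertex (i : Fin 4) : inner ℝ (refVertex i) (refVertex i) = 2 ∧
    inner ℝ (refVertex i) (refVertex (i + 1)) = 0 ∧
    inner ℝ (refVertex (i + 1)) (refVertex (i + 1)) = 2 := by
  fin_cases i <;> simp [refVertex, PiLp.inner_apply, Fin.sum_univ_two,
    EuclideanSpace.real_norm_sq_eq] <;> norm_num

lemma refMap_comb (i : Fin 4) (s t : ℝ) :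
    Q.refMap i (s • refVertex i + t • refVertex (i + 1)) =
      Q.center + s • Q.arm i + t • Q.arm (i + 1) := by
  obtain ⟨h1, h2, h3⟩ := inner_refVertex i
  have h2' : inner ℝ (refVertex (i + 1)) (refVertex i) = 0 := by rw [real_inner_comm, h2]
  simp only [refMap, inner_add_left, real_inner_smul_left, h1, h2, h3, h2', arm]
  congr 3
  · ring
  · ring

/-- The map `refMap i` is an affine bijection of the plane, and affine substitution preserves the
degree. Hence the reference square can be forgotten: the test functions depend only on `D` and `r`,
not on the quadrilateral. -/
lemma mem_testSpace_iff {i : Fin 4} {D : Set Plane} {r : ℤ} {q : Plane → ℝ} :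
    q ∈ Q.testSpace i D r ↔ ∃ g ∈ Poly r, q = D.indicator fun x => evalAt x g := by
  constructor
  · rintro ⟨h0, p, hp, hq⟩
    set L : Plane →L[ℝ] Plane :=
      (coordX (Q.arm i) (Q.arm (i + 1))).smulRight (refVertex i) +
        (coordY (Q.arm i) (Q.arm (i + 1))).smulRight (refVertex (i + 1))
    obtain ⟨g, hg, hge⟩ := exists_comp_affine hp L (-L Q.center)
    refine ⟨g, hg, ?_⟩
    ext x
    by_cases hx : x ∈ D
    · rw [indicator_of_mem hx, hge]
      have h1 : L x + -L Q.center =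
          Q.bx i x • refVertex i + Q.bary i x • refVertex (i + 1) := by
        rw [← sub_eq_add_neg, ← map_sub]
        simp [L, bx, bary]
      have h2 : Q.refMap i (Q.bx i x • refVertex i + Q.bary i x • refVertex (i + 1)) = x := by
        rw [refMap_comb, ← eq_coords]
      rw [h1, ← hq _ (by rwa [h2]), h2]
    · rw [indicator_of_notMem hx, h0 x hx]
  · rintro ⟨g, hg, rfl⟩
    refine ⟨fun x hx => indicator_of_notMem hx _, ?_⟩
    obtain ⟨p, hp, hpe⟩ := exists_comp_affine hg
      (((1 / 2 : ℝ) • innerSL ℝ (refVertex i)).smulRight (Q.arm i) +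
        ((1 / 2 : ℝ) • innerSL ℝ (refVertex (i + 1))).smulRight (Q.arm (i + 1))) Q.center
    refine ⟨p, hp, fun y hy => ?_⟩
    rw [indicator_of_mem hy, hpe]
    congr 1
    simp [refMap, arm, real_inner_comm, div_eq_inv_mul]
    abel

lemma indicator_mem_testSpace (i : Fin 4) (D : Set Plane) {r : ℤ} {g : MvPolynomial (Fin 2) ℝ}
    (hg : g ∈ Poly r) : (D.indicator fun x => evalAt x g) ∈ Q.testSpace i D r :=
  Q.mem_testSpace_iff.2 ⟨g, hg, rfl⟩

/-! ### Integrals over edges and triangles -/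

lemma segIntegral_congr {a b : Plane} {f g : Plane → ℝ} (h : ∀ x ∈ segment ℝ a b, f x = g x) :
    segIntegral a b f = segIntegral a b g := by
  rw [segIntegral, segIntegral]
  congr 1
  refine intervalIntegral.integral_congr fun t ht => ?_
  rw [uIcc_of_le zero_le_one] at ht
  refine h _ ?_
  rw [segment_eq_image_lineMap]
  exact mem_image_of_mem _ ht

lemma edgeIntegral_indicator (i : Fin 4) (F : Plane → ℝ) (g : MvPolynomial (Fin 2) ℝ) :
    Q.edgeIntegral i (fun x => F x * (Q.edge i).indicator (fun x => evalAt x g) x) =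
      Q.edgeIntegral i fun x => F x * evalAt x g :=
  segIntegral_congr fun x hx => by
    rw [indicator_of_mem (show x ∈ Q.edge i from hx)]

lemma setIntegral_tri_indicator (i : Fin 4) (F : Plane → ℝ) (g : MvPolynomial (Fin 2) ℝ) :
    ∫ x in Q.tri i, F x * (Q.tri i).indicator (fun x => evalAt x g) x =
      ∫ x in Q.tri i, F x * evalAt x g :=
  setIntegral_congr_fun (Q.isCompact_tri i).measurableSet fun x hx => by
    simp only [indicator_of_mem hx]

lemma exists_integral_tri (i : Fin 4) : ∃ C : ℝ, 0 < C ∧ ∀ f : Plane → ℝ, Continuous f →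
    ∫ x in Q.tri i, f x = C * ∫ x in (0 : ℝ)..1, ∫ y in (0 : ℝ)..(1 - x),
      f (Q.center + x • Q.arm i + y • Q.arm (i + 1)) := by
  obtain ⟨C, hC, h⟩ := exists_integral_eq _ _ (Q.cross_arm i)
  refine ⟨C, hC, fun f hf => ?_⟩
  have hmeas := (Q.isCompact_tri i).measurableSet
  have hint : Integrable ((Q.tri i).indicator f) :=
    (integrable_indicator_iff hmeas).2 (hf.continuousOn.integrableOn_compact (Q.isCompact_tri i))
  have hint' := integrable_frame (Q.cross_arm i) (hint.comp_add_left Q.center)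
  rw [← integral_indicator hmeas, ← integral_add_left_eq_self _ Q.center, h,
    Measure.volume_eq_prod, integral_prod _ hint']
  congr 1
  have hind : ∀ x y : ℝ, (Q.tri i).indicator f (Q.center + (x • Q.arm i + y • Q.arm (i + 1))) =
      if 0 ≤ x ∧ 0 ≤ y ∧ x + y ≤ 1 then f (Q.center + x • Q.arm i + y • Q.arm (i + 1)) else 0 := by
    intro x y
    classical
    rw [← add_assoc, indicator_apply]
    simp only [mem_tri_iff, bx_comb, bary_comb]
  simp only [hind]
  rw [intervalIntegral.integral_of_le zero_le_one, ← integral_Icc_eq_integral_Ioc,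
    ← integral_indicator measurableSet_Icc]
  congr 1
  ext x
  by_cases hx : x ∈ Icc (0 : ℝ) 1
  · rw [indicator_of_mem hx, intervalIntegral.integral_of_le (by linarith [hx.2]),
      ← integral_Icc_eq_integral_Ioc, ← integral_indicator measurableSet_Icc]
    congr 1
    ext y
    by_cases hy : y ∈ Icc (0 : ℝ) (1 - x)
    · rw [indicator_of_mem hy, if_pos ⟨hx.1, hy.1, by linarith [hy.2]⟩]
    · rw [indicator_of_notMem hy, if_neg fun h => hy ⟨h.2.1, by linarith [h.2.2]⟩]
  · rw [indicator_of_notMem hx]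
    have : ∀ y : ℝ, ¬ (0 ≤ x ∧ 0 ≤ y ∧ x + y ≤ 1) := fun y h =>
      hx ⟨h.1, by linarith [h.2.1, h.2.2]⟩
    simp [this]

/-- Pieces of a function of the macro-element space are zero if the degrees of freedom are. -/
theorem pieces_eq_zero {k : ℕ} (hk : k = 2 ∨ k = 3) {p : Fin 4 → MvPolynomial (Fin 2) ℝ}
    (hp : ∀ i, p i ∈ Poly ((k : ℤ) + 1)) {u : Plane → ℝ} (hu : Q.IsPieces p u) {n : Fin 4 → Plane}
    (hn : ∀ i, Q.IsUnitNormal i (n i)) (hv : ∀ i, evalAt (Q.v i) (p i) = 0)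
    (hg : ∀ i, grad (p i) (Q.v i) = 0)
    (hN : ∀ i, ∀ q ∈ Poly ((k : ℤ) - 2),
      Q.edgeIntegral i (fun x => grad (p i) x (n i) * evalAt x q) = 0)
    (hV : ∀ i, ∀ q ∈ Poly ((k : ℤ) - 3),
      Q.edgeIntegral i (fun x => evalAt x (p i) * evalAt x q) = 0)
    (hT : ∀ i, ∀ q ∈ Poly ((k : ℤ) - 3), ∫ x in Q.tri i, evalAt x (p i) * evalAt x q = 0)
    (i : Fin 4) (x : Plane) : evalAt x (p i) = 0 := by
  have hdist : ∀ i, dist (Q.v i) (Q.v (i + 1)) ≠ 0 := fun i => dist_ne_zero.2 (Q.v_ne_v i)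
  -- The hypotheses give zero data only at the first end `v i`; at `v (i + 1)` they come from the
  -- next piece through the C¹ match.
  have hedge : ∀ (i : Fin 4) (t : ℝ), evalAt (Q.center + (1 - t) • Q.arm i + t • Q.arm (i + 1)) (p i) = 0 ∧
      grad (p i) (Q.center + (1 - t) • Q.arm i + t • Q.arm (i + 1)) = 0 := by
    intro i t
    rw [← lineMap_eq]
    refine eq_zero_on_edge hk (hp i) (Q.cross_normal (hn i)) (hv i) ?_ (hg i) ?_
      (fun q hq => (mul_eq_zero.1 (hN i q hq)).resolve_left (hdist i))
      (fun q hq => (mul_eq_zero.1 (hV i q hq)).resolve_left (hdist i)) t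
    · rw [← hv (i + 1), ← hu.eq i _ (Q.v_succ_mem_tri i), ← hu.eq (i + 1) _ (Q.v_mem_tri _)]
    · rw [← hg (i + 1)]
      exact hu.fderiv_eq i (i + 1) _ (Q.v_succ_mem_tri i) (Q.v_mem_tri _)
  choose c hc he using fun i => exists_expansion (show (k : ℤ) + 1 ≤ 4 by omega) (hp i) Q.center
    (Q.arm i) (Q.arm (i + 1))
  have hline : ∀ (i : Fin 4) (t : ℝ), Q.center + (0 : ℝ) • Q.arm i + t • Q.arm (i + 1) =
      Q.center + t • Q.arm (i + 1) + (0 : ℝ) • Q.arm (i + 1 + 1) := by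
    intro i t
    simp
  have hm1 : ∀ (i : Fin 4), ∀ t ∈ Icc (0 : ℝ) 1,
      Q.center + t • Q.arm (i + 1) + (0 : ℝ) • Q.arm (i + 1 + 1) ∈ Q.tri i := by
    intro i t ht
    rw [← hline]
    exact Q.comb_mem_tri le_rfl ht.1 (by linarith [ht.2])
  have hm2 : ∀ (i : Fin 4), ∀ t ∈ Icc (0 : ℝ) 1,
      Q.center + t • Q.arm (i + 1) + (0 : ℝ) • Q.arm (i + 1 + 1) ∈ Q.tri (i + 1) :=
    fun i t ht => Q.comb_mem_tri ht.1 le_rfl (by linarith [ht.2])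
  rw [Q.eq_coords i x, (he i).eval]
  refine quartic_eq_zero_of_homogeneous hk Q.ratio_pos
    (fun i m n hmn => hc i m n (by exact_mod_cast hmn)) (fun i t => ?_) (fun i t => ?_)
    (fun i t ht => ?_) (fun i t ht => ?_) (fun hk3 i => ?_) i _ _
  · rw [← (he i).eval, (hedge i t).1]
  · rw [← (he i).gradX, (hedge i t).2, zero_apply]
  · rw [← (he i).eval, ← (he (i + 1)).eval, hline, ← hu.eq i _ (hm1 i t ht),
      ← hu.eq (i + 1) _ (hm2 i t ht)]
  · rw [← (he (i + 1)).gradY, ← (he i).gradX, hline]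
    have h1 : grad (p (i + 1)) (Q.center + t • Q.arm (i + 1) + (0 : ℝ) • Q.arm (i + 1 + 1)) =
        grad (p i) (Q.center + t • Q.arm (i + 1) + (0 : ℝ) • Q.arm (i + 1 + 1)) :=
      hu.fderiv_eq (i + 1) i _ (hm2 i t ht) (hm1 i t ht)
    rw [h1]
    -- The second frame vector of triangle `i + 1` is `-ρ i` times the first one of triangle `i`, so
    -- equality of gradients becomes the relation between `quarticY` and `quarticX`.
    have h2 : Q.arm (i + 1 + 1) = -Q.ratio i • Q.arm i := by
      rw [add_assoc, show (1 + 1 : Fin 4) = 2 from rfl, arm_add_two]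
    conv_lhs => rw [h2]
    rw [map_smul, smul_eq_mul, h2]
  · subst hk3
    obtain ⟨C, hC, hCf⟩ := Q.exists_integral_tri i
    have h1 := hT i (MvPolynomial.C 1) (C_mem_Poly 1 (by norm_num))
    simp only [evalAt_C, mul_one] at h1
    rw [hCf _ (continuous_evalAt _)] at h1
    simpa only [(he i).eval] using (mul_eq_zero.1 h1).resolve_left hC.ne'

end ConvexQuad

/-! ### Moments of polynomial pieces and uniqueness. -/

lemma clm_ext_single {l l' : Plane →L[ℝ] ℝ}
    (h0 : l (EuclideanSpace.single 0 1) = l' (EuclideanSpace.single 0 1))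
    (h1 : l (EuclideanSpace.single 1 1) = l' (EuclideanSpace.single 1 1)) : l = l' := by
  ext v
  rw [plane_decomp v]
  simp [h0, h1]

/-- Evaluation of polynomials as a linear map. -/
def evalL : MvPolynomial (Fin 2) ℝ →ₗ[ℝ] Plane → ℝ where
  toFun p x := evalAt x p
  map_add' p q := funext fun x => evalAt_add x p q
  map_smul' c p := funext fun x => evalAt_smul x c p

/-- The directional derivative of polynomials as a linear map. -/
def gradL (d : Plane) : MvPolynomial (Fin 2) ℝ →ₗ[ℝ] Plane → ℝ where
  toFun p x := grad p x d
  map_add' p q := funext fun x => by simp [grad_add]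
  map_smul' c p := funext fun x => by simp [grad_smul]

@[simp] lemma evalL_apply (p : MvPolynomial (Fin 2) ℝ) (x : Plane) : evalL p x = evalAt x p := rfl

@[simp] lemma gradL_apply (d : Plane) (p : MvPolynomial (Fin 2) ℝ) (x : Plane) :
    gradL d p x = grad p x d := rfl

lemma continuous_evalL (p : MvPolynomial (Fin 2) ℝ) : Continuous (evalL p) := continuous_evalAt p

lemma continuous_gradL (d : Plane) (p : MvPolynomial (Fin 2) ℝ) : Continuous (gradL d p) :=
  (continuous_grad p).clm_apply continuous_const

lemma IsGlued.sub {ι : Type*} {T : ι → Set Plane} {f g : ι → Plane → ℝ} {w z : Plane → ℝ}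
    (h : IsGlued T f w) (h' : IsGlued T g z) : IsGlued T (fun i x => f i x - g i x) (w - z) where
  isCompact := h.isCompact
  contDiff i := (h.contDiff i).sub (h'.contDiff i)
  eq i x hx := by rw [Pi.sub_apply, h.eq i x hx, h'.eq i x hx]
  fderiv_eq i j x hi hj := by
    have d1 := fun i => (h.contDiff i).differentiable (by simp) x
    have d2 := fun i => (h'.contDiff i).differentiable (by simp) x
    rw [fderiv_fun_sub (d1 i) (d2 i), fderiv_fun_sub (d1 j) (d2 j), h.fderiv_eq i j x hi hj,
      h'.fderiv_eq i j x hi hj]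

lemma segIntegral_sub {a b : Plane} {F G : Plane → ℝ} (hF : Continuous F) (hG : Continuous G) :
    segIntegral a b (fun x => F x - G x) = segIntegral a b F - segIntegral a b G := by
  have hl : Continuous fun t : ℝ => (AffineMap.lineMap a b t : Plane) :=
    AffineMap.lineMap_continuous
  have h := intervalIntegral.integral_sub (μ := volume) ((hF.comp hl).intervalIntegrable 0 1)
    ((hG.comp hl).intervalIntegrable 0 1)
  simp only [Function.comp_apply] at h
  rw [segIntegral, h, mul_sub, segIntegral, segIntegral]

namespace ConvexQuad

variable (Q : ConvexQuad)

section Moments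

variable {Q} {p : Fin 4 → MvPolynomial (Fin 2) ℝ} {u : Plane → ℝ}

lemma IsPieces.normalMoment_eq (h : Q.IsPieces p u) (i : Fin 4) (n : Plane) (q : Plane → ℝ) :
    Q.normalMoment i n u q = Q.edgeIntegral i fun x => gradL n (p i) x * q x :=
  segIntegral_congr (f := fun x => Q.deriv u x n * q x) fun x hx => by
    rw [h.deriv_eq (Q.edge_subset_tri i hx), gradL_apply]

lemma IsPieces.valueMoment_eq (h : Q.IsPieces p u) (i : Fin 4) (q : Plane → ℝ) :
    Q.valueMoment i u q = (Q.edgeLength i)⁻¹ * Q.edgeIntegral i fun x => evalL (p i) x * q x := by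
  rw [valueMoment]
  congr 1
  exact segIntegral_congr fun x hx => by rw [h.eq i x (Q.edge_subset_tri i hx), evalL_apply]

lemma IsPieces.triMoment_eq (h : Q.IsPieces p u) (i : Fin 4) (q : Plane → ℝ) :
    Q.triMoment i u q =
      (volume.real (Q.tri i))⁻¹ * ∫ x in Q.tri i, evalL (p i) x * q x := by
  rw [triMoment]
  congr 1
  exact setIntegral_congr_fun (Q.isCompact_tri i).measurableSet fun x hx => by
    simp only [h.eq i x hx, evalL_apply]

end Moments

lemma edgeLength_ne_zero (i : Fin 4) : Q.edgeLength i ≠ 0 := dist_ne_zero.2 (Q.v_ne_v i)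

lemma volume_tri_ne_zero (i : Fin 4) : volume.real (Q.tri i) ≠ 0 := by
  rw [Measure.real, ENNReal.toReal_ne_zero]
  refine ⟨fun h => ?_, (Q.isCompact_tri i).measure_lt_top.ne⟩
  exact (isOpen_interior.measure_pos volume (Q.interior_tri_nonempty i)).ne'
    (measure_mono_null interior_subset h)

lemma IsPieces.sub {Q : ConvexQuad} {p p' : Fin 4 → MvPolynomial (Fin 2) ℝ} {u u' : Plane → ℝ}
    (h : Q.IsPieces p u) (h' : Q.IsPieces p' u') : Q.IsPieces (fun i => p i - p' i) (u - u') := by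
  have := IsGlued.sub h h'
  simpa only [IsPieces, evalAt_sub] using this

/-- The difference has polynomial pieces with vanishing DOFs, hence zero pieces by `pieces_eq_zero`;
outside the quadrilateral both functions are zero by the convention in `Sigma`. -/
theorem hasDofs_unique {k : ℕ} (hk : k = 2 ∨ k = 3) {n : Fin 4 → Plane}
    (hn : ∀ i, Q.IsUnitNormal i (n i)) {d : Q.DofData k} {u u' : Plane → ℝ} (hu : u ∈ Q.Sigma k)
    (hu' : u' ∈ Q.Sigma k) (h : Q.HasDofs k n u d) (h' : Q.HasDofs k n u' d) : u = u' := by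
  obtain ⟨p, hp, hpu⟩ := exists_isPieces hu
  obtain ⟨p', hp', hpu'⟩ := exists_isPieces hu'
  have key := Q.pieces_eq_zero hk (fun i => Submodule.sub_mem _ (hp i) (hp' i)) (hpu.sub hpu') hn
    (fun i => ?_) (fun i => ?_) (fun i q hq => ?_) (fun i q hq => ?_) (fun i q hq => ?_)
  · ext x
    by_cases hx : x ∈ Q.carrier
    · rw [carrier_eq] at hx
      obtain ⟨i, hi⟩ := mem_iUnion.1 hx
      have := key i x
      rw [evalAt_sub, sub_eq_zero] at this
      rw [hpu.eq i x hi, hpu'.eq i x hi, this]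
    · rw [hu.1 x hx, hu'.1 x hx]
  · rw [evalAt_sub, ← hpu.eq i _ (Q.v_mem_tri i), ← hpu'.eq i _ (Q.v_mem_tri i), h.value,
      h'.value, sub_self]
  · rw [grad_sub, sub_eq_zero]
    refine clm_ext_single ?_ ?_
    · rw [← hpu.deriv_eq (Q.v_mem_tri i), ← hpu'.deriv_eq (Q.v_mem_tri i), h.dx, h'.dx]
    · rw [← hpu.deriv_eq (Q.v_mem_tri i), ← hpu'.deriv_eq (Q.v_mem_tri i), h.dy, h'.dy]
  · have e1 := h.normal i ⟨_, Q.indicator_mem_testSpace i (Q.edge i) hq⟩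
    rw [← h'.normal i, hpu.normalMoment_eq, hpu'.normalMoment_eq, edgeIntegral_indicator,
      edgeIntegral_indicator] at e1
    simp only [grad_sub, sub_apply, sub_mul]
    exact (segIntegral_sub ((continuous_gradL _ _).mul (continuous_evalAt q))
      ((continuous_gradL _ _).mul (continuous_evalAt q))).trans (sub_eq_zero.2 e1)
  · have e1 := h.edgeValue i ⟨_, Q.indicator_mem_testSpace i (Q.edge i) hq⟩
    rw [← h'.edgeValue i, hpu.valueMoment_eq, hpu'.valueMoment_eq, edgeIntegral_indicator,
      edgeIntegral_indicator] at e1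
    have e2 := mul_left_cancel₀ (inv_ne_zero (Q.edgeLength_ne_zero i)) e1
    simp only [evalAt_sub, sub_mul]
    exact (segIntegral_sub ((continuous_evalL _).mul (continuous_evalAt q))
      ((continuous_evalL _).mul (continuous_evalAt q))).trans (sub_eq_zero.2 e2)
  · have e1 := h.inner i ⟨_, Q.indicator_mem_testSpace i (Q.tri i) hq⟩
    rw [← h'.inner i, hpu.triMoment_eq, hpu'.triMoment_eq, setIntegral_tri_indicator,
      setIntegral_tri_indicator] at e1
    have e2 := mul_left_cancel₀ (inv_ne_zero (Q.volume_tri_ne_zero i)) e1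
    simp only [evalAt_sub, sub_mul]
    have hi : ∀ p, IntegrableOn (fun x => evalAt x p * evalAt x q) (Q.tri i) := fun p =>
      (((continuous_evalAt p).mul (continuous_evalAt q)).continuousOn).integrableOn_compact
        (Q.isCompact_tri i)
    rw [integral_sub (hi _) (hi _)]
    exact sub_eq_zero.2 e2

/-! ### The degrees of freedom as linear maps -/

lemma intervalIntegrable_mul_edgeTest {i : Fin 4} {r : ℤ} {F q : Plane → ℝ} (hF : Continuous F)
    (hq : q ∈ Q.edgeTest i r) : IntervalIntegrable (fun t : ℝ =>
      F (AffineMap.lineMap (Q.v i) (Q.v (i + 1)) t) *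
        q (AffineMap.lineMap (Q.v i) (Q.v (i + 1)) t)) volume 0 1 := by
  obtain ⟨g, -, rfl⟩ := Q.mem_testSpace_iff.1 hq
  have hl : Continuous fun t : ℝ => (AffineMap.lineMap (Q.v i) (Q.v (i + 1)) t : Plane) :=
    AffineMap.lineMap_continuous
  refine (((hF.mul (continuous_evalAt g)).comp hl).intervalIntegrable 0 1).congr_ae ?_
  filter_upwards [ae_restrict_mem measurableSet_uIoc] with t ht
  rw [uIoc_of_le zero_le_one] at ht
  rw [indicator_of_mem (Q.lineMap_mem_edge i ⟨ht.1.le, ht.2⟩)]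
  rfl

lemma integrableOn_mul_triTest {i : Fin 4} {r : ℤ} {F q : Plane → ℝ} (hF : Continuous F)
    (hq : q ∈ Q.triTest i r) : IntegrableOn (fun x => F x * q x) (Q.tri i) := by
  obtain ⟨g, -, rfl⟩ := Q.mem_testSpace_iff.1 hq
  refine ((hF.mul (continuous_evalAt g)).continuousOn.integrableOn_compact
    (Q.isCompact_tri i)).congr_fun (fun x hx => ?_) (Q.isCompact_tri i).measurableSet
  simp only [indicator_of_mem hx, Pi.mul_apply]

/-- The moments on an edge as a bilinear form. -/
def edgeForm (i : Fin 4) (r : ℤ) (A : MvPolynomial (Fin 2) ℝ →ₗ[ℝ] Plane → ℝ)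
    (hA : ∀ p, Continuous (A p)) :
    MvPolynomial (Fin 2) ℝ →ₗ[ℝ] Module.Dual ℝ (Q.edgeTest i r) :=
  LinearMap.mk₂ ℝ (fun p q => Q.edgeIntegral i fun x => A p x * q.1 x)
    (fun p p' q => by
      simp only [edgeIntegral, segIntegral, map_add, Pi.add_apply, add_mul]
      rw [intervalIntegral.integral_add (Q.intervalIntegrable_mul_edgeTest (hA p) q.2)
        (Q.intervalIntegrable_mul_edgeTest (hA p') q.2), mul_add])
    (fun c p q => by
      simp only [edgeIntegral, segIntegral, map_smul, Pi.smul_apply, smul_eq_mul, mul_assoc]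
      rw [intervalIntegral.integral_const_mul]
      ring)
    (fun p q q' => by
      simp only [edgeIntegral, segIntegral, Submodule.coe_add, Pi.add_apply, mul_add]
      rw [intervalIntegral.integral_add (Q.intervalIntegrable_mul_edgeTest (hA p) q.2)
        (Q.intervalIntegrable_mul_edgeTest (hA p) q'.2), mul_add])
    (fun c p q => by
      simp only [edgeIntegral, segIntegral, Submodule.coe_smul, Pi.smul_apply, smul_eq_mul,
        mul_left_comm _ c]
      rw [intervalIntegral.integral_const_mul]
      ring)

/-- The moments on a triangle as a bilinear form. -/
def triForm (i : Fin 4) (r : ℤ) :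
    MvPolynomial (Fin 2) ℝ →ₗ[ℝ] Module.Dual ℝ (Q.triTest i r) :=
  LinearMap.mk₂ ℝ (fun p q => ∫ x in Q.tri i, evalL p x * q.1 x)
    (fun p p' q => by
      simp only [map_add, Pi.add_apply, add_mul]
      exact integral_add (Q.integrableOn_mul_triTest (continuous_evalL p) q.2)
        (Q.integrableOn_mul_triTest (continuous_evalL p') q.2))
    (fun c p q => by
      simp only [map_smul, Pi.smul_apply, smul_eq_mul, mul_assoc]
      rw [integral_const_mul])
    (fun p q q' => by
      simp only [Submodule.coe_add, Pi.add_apply, mul_add]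
      exact integral_add (Q.integrableOn_mul_triTest (continuous_evalL p) q.2)
        (Q.integrableOn_mul_triTest (continuous_evalL p) q'.2))
    (fun c p q => by
      simp only [Submodule.coe_smul, Pi.smul_apply, smul_eq_mul, mul_left_comm _ c]
      rw [integral_const_mul])

end ConvexQuad

/-! ### Dimensions -/

lemma finite_Poly (r : ℤ) : Module.Finite ℝ (Poly r) := by
  have : Finite {s : Fin 2 →₀ ℕ | (s.degree : ℤ) ≤ r} := by
    refine Set.Finite.subset (Set.Finite.preimage (f := fun s : Fin 2 →₀ ℕ => (s 0, s 1))
      (fun s _ t _ h => ?_) ((Set.finite_Iic r.toNat).prod (Set.finite_Iic r.toNat))) fun s hs => ?_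
    · simp only [Prod.mk.injEq] at h
      ext i
      fin_cases i
      · exact h.1
      · exact h.2
    · simp only [mem_ofPred_eq, degree_fin_two] at hs
      simp only [mem_preimage, mem_prod, mem_Iic]
      omega
  exact Module.Finite.of_basis (MvPolynomial.basisRestrictSupport ℝ _)

/-- A decidable count of exponents, from which the needed dimensions are computed. -/
lemma finrank_Poly {r : ℤ} (hr : r ≤ 4) : Module.finrank ℝ (Poly r) =
    (((Finset.range 5 ×ˢ Finset.range 5).filter fun z => ((z.1 + z.2 : ℕ) : ℤ) ≤ r).card) := by
  rw [Poly, Module.finrank_eq_nat_card_basis (MvPolynomial.basisRestrictSupport ℝ _),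
    ← Nat.card_eq_finsetCard]
  refine Nat.card_congr
    { toFun := fun s => ⟨(s.1 0, s.1 1), ?_⟩
      invFun := fun z => ⟨Finsupp.single 0 z.1.1 + Finsupp.single 1 z.1.2, ?_⟩
      left_inv := fun s => ?_
      right_inv := fun z => ?_ }
  · have hs := s.2
    simp only [mem_ofPred_eq, degree_fin_two] at hs
    simp only [Finset.mem_filter, Finset.mem_product, Finset.mem_range]
    omega
  · have hz := z.2
    simp only [Finset.mem_filter, Finset.mem_product, Finset.mem_range] at hz
    simpa [degree_fin_two] using hz.2
  · ext i
    fin_cases i <;> simp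
  · ext <;> simp

namespace ConvexQuad

variable (Q : ConvexQuad)

/-- Restriction of polynomials to test functions. -/
def polyToTest (i : Fin 4) (D : Set Plane) (r : ℤ) : Poly r →ₗ[ℝ] Q.testSpace i D r where
  toFun g := ⟨D.indicator fun x => evalAt x g.1, Q.indicator_mem_testSpace i D g.2⟩
  map_add' g g' := by
    ext x
    by_cases hx : x ∈ D <;> simp [hx, evalAt_add]
  map_smul' c g := by
    ext x
    by_cases hx : x ∈ D <;> simp [hx, evalAt_smul]

lemma polyToTest_surjective (i : Fin 4) (D : Set Plane) (r : ℤ) :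
    Function.Surjective (Q.polyToTest i D r) := by
  rintro ⟨q, hq⟩
  obtain ⟨g, hg, rfl⟩ := Q.mem_testSpace_iff.1 hq
  exact ⟨⟨g, hg⟩, rfl⟩

instance finite_testSpace (i : Fin 4) (D : Set Plane) (r : ℤ) :
    Module.Finite ℝ (Q.testSpace i D r) :=
  have := finite_Poly r
  Module.Finite.of_surjective _ (Q.polyToTest_surjective i D r)

lemma finrank_testSpace_le (i : Fin 4) (D : Set Plane) (r : ℤ) :
    Module.finrank ℝ (Q.testSpace i D r) ≤ Module.finrank ℝ (Poly r) :=
  have := finite_Poly r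
  LinearMap.finrank_le_finrank_of_surjective (Q.polyToTest_surjective i D r)

/-- The bound 3 coming from `Poly 1` would be too weak for the dimension count. An affine function
on a segment is determined by its two end values. -/
lemma finrank_edgeTest_one_le (i : Fin 4) : Module.finrank ℝ (Q.edgeTest i 1) ≤ 2 := by
  let L : Q.edgeTest i 1 →ₗ[ℝ] ℝ × ℝ :=
    { toFun := fun q => (q.1 (Q.v i), q.1 (Q.v (i + 1)))
      map_add' := fun q q' => by simp
      map_smul' := fun c q => by simp }
  have hL : Function.Injective L := by
    rw [injective_iff_map_eq_zero]
    rintro ⟨q, hq⟩ hz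
    obtain ⟨g, hg, rfl⟩ := Q.mem_testSpace_iff.1 hq
    obtain ⟨c, hc, he⟩ := exists_expansion (by norm_num) hg Q.center (Q.arm i) (Q.arm (i + 1))
    have hv : ∀ t : ℝ, evalAt (AffineMap.lineMap (Q.v i) (Q.v (i + 1)) t) g =
        c 0 0 + c 1 0 * (1 - t) + c 0 1 * t := by
      intro t
      rw [lineMap_eq, he.eval, quartic]
      rw [hc 2 0, hc 1 1, hc 0 2, hc 3 0, hc 2 1, hc 1 2, hc 0 3, hc 4 0, hc 3 1, hc 2 2, hc 1 3,
        hc 0 4]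
      · ring
      all_goals norm_num
    have h1 := congrArg Prod.fst hz
    have h2 := congrArg Prod.snd hz
    simp only [L, LinearMap.coe_mk, AddHom.coe_mk, Prod.fst_zero, Prod.snd_zero] at h1 h2
    rw [indicator_of_mem (Q.v_mem_edge i)] at h1
    rw [indicator_of_mem (show Q.v (i + 1) ∈ Q.edge i from right_mem_segment ℝ _ _)] at h2
    have h3 := hv 0
    have h4 := hv 1
    rw [AffineMap.lineMap_apply_zero, h1] at h3
    rw [AffineMap.lineMap_apply_one, h2] at h4
    ext x
    by_cases hx : x ∈ Q.edge i
    · have hx' := hx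
      rw [edge, segment_eq_image_lineMap] at hx'
      obtain ⟨t, -, rfl⟩ := hx'
      simp only [indicator_of_mem hx, hv]
      simp only [Submodule.coe_zero, Pi.zero_apply]
      have e1 : c 1 0 = -c 0 0 := by linarith
      have e2 : c 0 1 = -c 0 0 := by linarith
      rw [e1, e2]; ring
    · simp [hx]
  have := LinearMap.finrank_le_finrank_of_injective hL
  simpa using this

/-! ### A parametrization of the macro-element space -/

/-- The polynomial of degree one which vanishes on the diagonal through `v 1` and `v 3`. -/
def diagS : MvPolynomial (Fin 2) ℝ :=
  affinePoly (coordX (Q.arm 0) (Q.arm 1)) (-coordX (Q.arm 0) (Q.arm 1) Q.center)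

/-- The polynomial of degree one which vanishes on the diagonal through `v 0` and `v 2`. -/
def diagT : MvPolynomial (Fin 2) ℝ :=
  affinePoly (coordY (Q.arm 0) (Q.arm 1)) (-coordY (Q.arm 0) (Q.arm 1) Q.center)

lemma evalAt_diagS (x : Plane) : evalAt x Q.diagS = Q.bx 0 x := by
  simp [diagS, bx, sub_eq_add_neg]

lemma evalAt_diagT (x : Plane) : evalAt x Q.diagT = Q.bary 0 x := by
  simp [diagT, bary, sub_eq_add_neg]

lemma evalAt_diag_comb (s t : ℝ) :
    evalAt (Q.center + s • Q.arm 0 + t • Q.arm 1) Q.diagS = s ∧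
      evalAt (Q.center + s • Q.arm 0 + t • Q.arm 1) Q.diagT = t :=
  ⟨(Q.evalAt_diagS _).trans (Q.bx_comb 0 s t), (Q.evalAt_diagT _).trans (Q.bary_comb 0 s t)⟩

lemma diagS_ne_zero : Q.diagS ≠ 0 := by
  intro h
  have := (Q.evalAt_diag_comb 1 0).1
  rw [h, evalAt_zero] at this
  norm_num at this

lemma diagT_ne_zero : Q.diagT ≠ 0 := by
  intro h
  have := (Q.evalAt_diag_comb 0 1).2
  rw [h, evalAt_zero] at this
  norm_num at this

/-- The parameters: an element of the macro-element space is
`P + s₋² A + t₋² B + s₋² t₋² C` with polynomials `P, A, B, C`. -/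
abbrev Param (k : ℕ) : Type :=
  Poly ((k : ℤ) + 1) × Poly ((k : ℤ) - 1) × Poly ((k : ℤ) - 1) × Poly ((k : ℤ) - 3)

/-- The pieces of the function with given parameters. -/
def piece (k : ℕ) (i : Fin 4) : Param k →ₗ[ℝ] MvPolynomial (Fin 2) ℝ where
  -- Triangles 1 and 2 lie where `s ≤ 0` and triangles 2 and 3 where `t ≤ 0`, so the product term
  -- lives on triangle 2 alone.
  toFun z := z.1.1 + (![0, 1, 1, 0] i : ℝ) • (Q.diagS ^ 2 * z.2.1.1) +
    (![0, 0, 1, 1] i : ℝ) • (Q.diagT ^ 2 * z.2.2.1.1) +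
    (![0, 0, 1, 0] i : ℝ) • (Q.diagS ^ 2 * (Q.diagT ^ 2 * z.2.2.2.1))
  map_add' z z' := by
    simp only [Prod.fst_add, Prod.snd_add, Submodule.coe_add, mul_add, smul_add]
    abel
  map_smul' c z := by
    simp only [Prod.smul_fst, Prod.smul_snd, Submodule.coe_smul, mul_smul_comm, smul_add,
      RingHom.id_apply, smul_comm c]

lemma diagS_mem : Q.diagS ^ 2 ∈ Poly 2 := pow_mem_Poly (affinePoly_mem _ _) 2

lemma diagT_mem : Q.diagT ^ 2 ∈ Poly 2 := pow_mem_Poly (affinePoly_mem _ _) 2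

lemma piece_mem (k : ℕ) (i : Fin 4) (z : Param k) : Q.piece k i z ∈ Poly ((k : ℤ) + 1) := by
  refine Submodule.add_mem _ (Submodule.add_mem _ (Submodule.add_mem _ z.1.2
    (Submodule.smul_mem _ _ ?_)) (Submodule.smul_mem _ _ ?_)) (Submodule.smul_mem _ _ ?_)
  · exact Poly_mono (by omega) (mul_mem_Poly Q.diagS_mem z.2.1.2)
  · exact Poly_mono (by omega) (mul_mem_Poly Q.diagT_mem z.2.2.1.2)
  · exact Poly_mono (by omega) (mul_mem_Poly Q.diagS_mem (mul_mem_Poly Q.diagT_mem z.2.2.2.2))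

lemma sq_mul_eq_zero {s A : MvPolynomial (Fin 2) ℝ} {x : Plane} (h : evalAt x s = 0) :
    evalAt x (s ^ 2 * A) = 0 ∧ grad (s ^ 2 * A) x = 0 := by
  rw [pow_two, mul_assoc]
  refine ⟨by rw [evalAt_mul, h, zero_mul], ?_⟩
  rw [grad_mul, evalAt_mul, h]
  simp

/-- Two pieces which differ by a multiple of the square of `s` match on the line `s = 0`. -/
lemma match_of_sub_eq {s A p q : MvPolynomial (Fin 2) ℝ} {x : Plane} (h : evalAt x s = 0)
    (hpq : q = p + s ^ 2 * A) : evalAt x p = evalAt x q ∧ grad p x = grad q x := by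
  obtain ⟨h1, h2⟩ := sq_mul_eq_zero (A := A) h
  rw [hpq, evalAt_add, grad_add, h1, h2]
  simp

/-- Consecutive pieces differ by a multiple of the square of the equation of the diagonal between
them, so values and gradients agree along it. -/
lemma piece_match (k : ℕ) (z : Param k) (i : Fin 4) (t : ℝ) :
    evalAt (Q.center + t • Q.arm (i + 1)) (Q.piece k i z) =
      evalAt (Q.center + t • Q.arm (i + 1)) (Q.piece k (i + 1) z) ∧
    grad (Q.piece k i z) (Q.center + t • Q.arm (i + 1)) =
      grad (Q.piece k (i + 1) z) (Q.center + t • Q.arm (i + 1)) := by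
  have a2 : Q.arm 2 = -Q.ratio 0 • Q.arm 0 := Q.arm_add_two 0
  have a3 : Q.arm 3 = -Q.ratio 1 • Q.arm 1 := Q.arm_add_two 1
  have hS : ∀ t : ℝ, evalAt (Q.center + t • Q.arm 1) Q.diagS = 0 := fun t => by
    simpa using (Q.evalAt_diag_comb 0 t).1
  have hT : ∀ t : ℝ, evalAt (Q.center + t • Q.arm 0) Q.diagT = 0 := fun t => by
    simpa using (Q.evalAt_diag_comb t 0).2
  fin_cases i
  · refine match_of_sub_eq (s := Q.diagS) (A := z.2.1.1) (hS t) ?_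
    simp [piece]
  · refine match_of_sub_eq (s := Q.diagT) (A := z.2.2.1.1 + Q.diagS ^ 2 * z.2.2.2.1) ?_ ?_
    · change evalAt (Q.center + t • Q.arm 2) Q.diagT = 0
      rw [a2, smul_smul]
      exact hT _
    · simp [piece]
      ring
  · refine match_of_sub_eq (s := Q.diagS) (A := -(z.2.1.1 + Q.diagT ^ 2 * z.2.2.2.1)) ?_ ?_
    · change evalAt (Q.center + t • Q.arm 3) Q.diagS = 0
      rw [a3, smul_smul]
      exact hS _
    · simp [piece]
      ring
  · refine match_of_sub_eq (s := Q.diagT) (A := -z.2.2.1.1) (hT t) ?_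
    simp [piece]

/-- The function with given pieces. -/
def glue (p : Fin 4 → MvPolynomial (Fin 2) ℝ) (x : Plane) : ℝ :=
  open Classical in if h : ∃ i, x ∈ Q.tri i then evalAt x (p h.choose) else 0

lemma isPieces_glue {p : Fin 4 → MvPolynomial (Fin 2) ℝ} (h : ∀ (i : Fin 4) (t : ℝ),
    evalAt (Q.center + t • Q.arm (i + 1)) (p i) = evalAt (Q.center + t • Q.arm (i + 1)) (p (i + 1)) ∧
    grad (p i) (Q.center + t • Q.arm (i + 1)) = grad (p (i + 1)) (Q.center + t • Q.arm (i + 1))) :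
    Q.IsPieces p (Q.glue p) where
  isCompact := Q.isCompact_tri
  contDiff i := contDiff_evalAt _
  eq i x hx := by
    have hex : ∃ i, x ∈ Q.tri i := ⟨i, hx⟩
    rw [glue, dif_pos hex]
    exact Q.eq_of_mem_inter (f := fun i x => evalAt x (p i)) (fun i t _ => (h i t).1)
      hex.choose_spec hx
  fderiv_eq i j x hi hj :=
    Q.eq_of_mem_inter (f := fun i => grad (p i)) (fun i t _ => (h i t).2) hi hj

lemma glue_eq_zero {p : Fin 4 → MvPolynomial (Fin 2) ℝ} {x : Plane} (hx : x ∉ Q.carrier) :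
    Q.glue p x = 0 := by
  rw [carrier_eq, mem_iUnion] at hx
  rw [glue, dif_neg hx]

lemma eq_zero_of_evalAt {p : MvPolynomial (Fin 2) ℝ} (h : ∀ x, evalAt x p = 0) : p = 0 :=
  MvPolynomial.funext fun x => by simpa [evalAt] using h (WithLp.toLp 2 x)

/-- Triangle 0 sees only `P`; triangles 1 and 3 then isolate `A` and `B`, and triangle 2 gives `C`.
-/
lemma param_eq_zero {k : ℕ} {z : Param k} (h : ∀ i x, evalAt x (Q.piece k i z) = 0) : z = 0 := by
  have h' := fun i => eq_zero_of_evalAt (h i)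
  have h0 := h' 0
  have h1 := h' 1
  have h2 := h' 2
  have h3 := h' 3
  have hS := pow_ne_zero 2 Q.diagS_ne_zero
  have hT := pow_ne_zero 2 Q.diagT_ne_zero
  obtain ⟨P, A, B, C⟩ := z
  simp [piece] at h0 h1 h2 h3
  have hP : P = 0 := by simpa using h0
  subst hP
  simp [Q.diagS_ne_zero, Q.diagT_ne_zero] at h1 h3
  subst h1
  subst h3
  simp [Q.diagS_ne_zero, Q.diagT_ne_zero] at h2
  subst h2
  rfl

/-! ### Dimension count and existence. -/

/-- The values of all degrees of freedom, as a vector space. -/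
abbrev DofSpace (k : ℕ) : Type :=
  (Fin 4 → ℝ) × (Fin 4 → ℝ) × (Fin 4 → ℝ) × (∀ i, Module.Dual ℝ (Q.edgeTest i ((k : ℤ) - 2))) ×
    (∀ i, Module.Dual ℝ (Q.edgeTest i ((k : ℤ) - 3))) ×
    (∀ i, Module.Dual ℝ (Q.triTest i ((k : ℤ) - 3)))

/-- For `k = 2`: `12 + 4 ≤ 10 + 3 + 3`. For `k = 3`: `12 + 8 + 4 + 4 ≤ 15 + 6 + 6 + 1`. Upper bounds
on the test spaces suffice, as injectivity of the DOF map yields the reverse inequality. -/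
lemma finrank_dofSpace_le {k : ℕ} (hk : k = 2 ∨ k = 3) :
    Module.finrank ℝ (Q.DofSpace k) ≤ Module.finrank ℝ (Param k) := by
  have f := finite_Poly
  simp only [DofSpace, Param, Module.finrank_prod, Module.finrank_pi_fintype,
    Subspace.dual_finrank_eq, Module.finrank_self]
  rcases hk with rfl | rfl
  · have h1 : ∀ i, Module.finrank ℝ (Q.edgeTest i (((2 : ℕ) : ℤ) - 2)) ≤ 1 := fun i =>
      (Q.finrank_testSpace_le _ _ _).trans (by rw [finrank_Poly (by norm_num)]; decide)
    have h2 : ∀ i, Module.finrank ℝ (Q.edgeTest i (((2 : ℕ) : ℤ) - 3)) ≤ 0 := fun i =>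
      (Q.finrank_testSpace_le _ _ _).trans (by rw [finrank_Poly (by norm_num)]; decide)
    have h3 : ∀ i, Module.finrank ℝ (Q.triTest i (((2 : ℕ) : ℤ) - 3)) ≤ 0 := fun i =>
      (Q.finrank_testSpace_le _ _ _).trans (by rw [finrank_Poly (by norm_num)]; decide)
    have e1 : Module.finrank ℝ (Poly (((2 : ℕ) : ℤ) + 1)) = 10 := by
      rw [finrank_Poly (by norm_num)]; decide
    have e2 : Module.finrank ℝ (Poly (((2 : ℕ) : ℤ) - 1)) = 3 := by
      rw [finrank_Poly (by norm_num)]; decide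
    rw [e1, e2]
    simp only [Fin.sum_univ_four]
    have := h1 0; have := h1 1; have := h1 2; have := h1 3
    have := h2 0; have := h2 1; have := h2 2; have := h2 3
    have := h3 0; have := h3 1; have := h3 2; have := h3 3
    omega
  · have h1 : ∀ i, Module.finrank ℝ (Q.edgeTest i (((3 : ℕ) : ℤ) - 2)) ≤ 2 := fun i => by
      simpa using Q.finrank_edgeTest_one_le i
    have h2 : ∀ i, Module.finrank ℝ (Q.edgeTest i (((3 : ℕ) : ℤ) - 3)) ≤ 1 := fun i =>
      (Q.finrank_testSpace_le _ _ _).trans (by rw [finrank_Poly (by norm_num)]; decide)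
    have h3 : ∀ i, Module.finrank ℝ (Q.triTest i (((3 : ℕ) : ℤ) - 3)) ≤ 1 := fun i =>
      (Q.finrank_testSpace_le _ _ _).trans (by rw [finrank_Poly (by norm_num)]; decide)
    have e1 : Module.finrank ℝ (Poly (((3 : ℕ) : ℤ) + 1)) = 15 := by
      rw [finrank_Poly (by norm_num)]; decide
    have e2 : Module.finrank ℝ (Poly (((3 : ℕ) : ℤ) - 1)) = 6 := by
      rw [finrank_Poly (by norm_num)]; decide
    have e3 : Module.finrank ℝ (Poly (((3 : ℕ) : ℤ) - 3)) = 1 := by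
      rw [finrank_Poly (by norm_num)]; decide
    rw [e1, e2, e3]
    simp only [Fin.sum_univ_four]
    have := h1 0; have := h1 1; have := h1 2; have := h1 3
    have := h2 0; have := h2 1; have := h2 2; have := h2 3
    have := h3 0; have := h3 1; have := h3 2; have := h3 3
    omega

/-- The degrees of freedom of the function with given parameters. -/
def dofMap (k : ℕ) (n : Fin 4 → Plane) : Param k →ₗ[ℝ] Q.DofSpace k :=
  (LinearMap.pi fun i => LinearMap.proj (Q.v i) ∘ₗ evalL ∘ₗ Q.piece k i).prod <|
  (LinearMap.pi fun i => LinearMap.proj (Q.v i) ∘ₗ gradL (EuclideanSpace.single 0 1) ∘ₗ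
    Q.piece k i).prod <|
  (LinearMap.pi fun i => LinearMap.proj (Q.v i) ∘ₗ gradL (EuclideanSpace.single 1 1) ∘ₗ
    Q.piece k i).prod <|
  (LinearMap.pi fun i => Q.edgeForm i _ (gradL (n i)) (continuous_gradL (n i)) ∘ₗ
    Q.piece k i).prod <|
  (LinearMap.pi fun i => (Q.edgeLength i)⁻¹ • (Q.edgeForm i _ evalL continuous_evalL ∘ₗ
    Q.piece k i)).prod <|
  (LinearMap.pi fun i => (volume.real (Q.tri i))⁻¹ • (Q.triForm i _ ∘ₗ Q.piece k i))

lemma dofMap_injective {k : ℕ} (hk : k = 2 ∨ k = 3) {n : Fin 4 → Plane}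
    (hn : ∀ i, Q.IsUnitNormal i (n i)) : Function.Injective (Q.dofMap k n) := by
  rw [injective_iff_map_eq_zero]
  intro z hz
  have h1 := congrArg (fun w => w.1) hz
  have h2 := congrArg (fun w => w.2.1) hz
  have h3 := congrArg (fun w => w.2.2.1) hz
  have h4 := congrArg (fun w => w.2.2.2.1) hz
  have h5 := congrArg (fun w => w.2.2.2.2.1) hz
  have h6 := congrArg (fun w => w.2.2.2.2.2) hz
  refine Q.param_eq_zero (Q.pieces_eq_zero hk (fun i => Q.piece_mem k i z)
    (Q.isPieces_glue (Q.piece_match k z)) hn (fun i => congrFun h1 i)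
    (fun i => clm_ext_single (congrFun h2 i) (congrFun h3 i)) (fun i q hq => ?_)
    (fun i q hq => ?_) (fun i q hq => ?_))
  · have := LinearMap.congr_fun (congrFun h4 i) ⟨_, Q.indicator_mem_testSpace i (Q.edge i) hq⟩
    exact (Q.edgeIntegral_indicator i _ q).symm.trans this
  · have := LinearMap.congr_fun (congrFun h5 i) ⟨_, Q.indicator_mem_testSpace i (Q.edge i) hq⟩
    exact (Q.edgeIntegral_indicator i _ q).symm.trans
      ((mul_eq_zero.1 this).resolve_left (inv_ne_zero (Q.edgeLength_ne_zero i)))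
  · have := LinearMap.congr_fun (congrFun h6 i) ⟨_, Q.indicator_mem_testSpace i (Q.tri i) hq⟩
    exact (Q.setIntegral_tri_indicator i _ q).symm.trans
      ((mul_eq_zero.1 this).resolve_left (inv_ne_zero (Q.volume_tri_ne_zero i)))

/-- An injective linear map between spaces of equal finite dimension is onto. Whether every member
of `Sigma` has such parameters need not be known. -/
lemma dofMap_surjective {k : ℕ} (hk : k = 2 ∨ k = 3) {n : Fin 4 → Plane}
    (hn : ∀ i, Q.IsUnitNormal i (n i)) : Function.Surjective (Q.dofMap k n) := by
  have f := finite_Poly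
  have hinj := Q.dofMap_injective hk hn
  exact (LinearMap.injective_iff_surjective_of_finrank_eq_finrank
    (le_antisymm (LinearMap.finrank_le_finrank_of_injective hinj) (Q.finrank_dofSpace_le hk))).1 hinj

theorem exists_hasDofs {k : ℕ} (hk : k = 2 ∨ k = 3) {n : Fin 4 → Plane}
    (hn : ∀ i, Q.IsUnitNormal i (n i)) (d : Q.DofData k) :
    ∃ u, u ∈ Q.Sigma k ∧ Q.HasDofs k n u d := by
  obtain ⟨z, hz⟩ := Q.dofMap_surjective hk hn (d.value, d.dx, d.dy, d.normal, d.edgeValue, d.inner)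
  have hp := Q.isPieces_glue (Q.piece_match k z)
  have h1 := congrArg (fun w => w.1) hz
  have h2 := congrArg (fun w => w.2.1) hz
  have h3 := congrArg (fun w => w.2.2.1) hz
  have h4 := congrArg (fun w => w.2.2.2.1) hz
  have h5 := congrArg (fun w => w.2.2.2.2.1) hz
  have h6 := congrArg (fun w => w.2.2.2.2.2) hz
  refine ⟨_, mem_Sigma_of_isPieces (fun x hx => Q.glue_eq_zero hx) (fun i => Q.piece_mem k i z) hp,
    ⟨fun i => ?_, fun i => ?_, fun i => ?_, fun i q => ?_, fun i q => ?_, fun i q => ?_⟩⟩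
  · exact (hp.eq i _ (Q.v_mem_tri i)).trans (congrFun h1 i)
  · exact (hp.deriv_eq (Q.v_mem_tri i) _).trans (congrFun h2 i)
  · exact (hp.deriv_eq (Q.v_mem_tri i) _).trans (congrFun h3 i)
  · exact (hp.normalMoment_eq i _ _).trans (LinearMap.congr_fun (congrFun h4 i) q)
  · exact (hp.valueMoment_eq i _).trans (LinearMap.congr_fun (congrFun h5 i) q)
  · exact (hp.triMoment_eq i _).trans (LinearMap.congr_fun (congrFun h6 i) q)

end ConvexQuad

/-! ### Gluing over a mesh -/

/-- A mesh compares edges as sets. This recovers the vertices of a common edge, which the two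
quadrilaterals may list in opposite orders. -/
lemma endpoints_of_segment_eq {a b c d : Plane} (hab : a ≠ b)
    (h : segment ℝ a b = segment ℝ c d) : (a = c ∧ b = d) ∨ (a = d ∧ b = c) := by
  have hc : c ∈ segment ℝ a b := h ▸ left_mem_segment ℝ c d
  have hd : d ∈ segment ℝ a b := h ▸ right_mem_segment ℝ c d
  have ha : a ∈ segment ℝ c d := h ▸ left_mem_segment ℝ a b
  have hb : b ∈ segment ℝ c d := h ▸ right_mem_segment ℝ a b
  rw [segment_eq_image_lineMap] at hc hd ha hb
  obtain ⟨s, hs, rfl⟩ := hc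
  obtain ⟨t, ht, rfl⟩ := hd
  obtain ⟨s', hs', e1⟩ := ha
  obtain ⟨t', ht', e2⟩ := hb
  have hinj := AffineMap.lineMap_injective ℝ hab
  have hcomp : ∀ r : ℝ, AffineMap.lineMap (AffineMap.lineMap a b s : Plane)
      (AffineMap.lineMap a b t) r = AffineMap.lineMap a b ((1 - r) * s + r * t) := by
    intro r
    simp only [AffineMap.lineMap_apply, vsub_eq_sub, vadd_eq_add]
    module
  have k1 : (1 - s') * s + s' * t = 0 := hinj (by rw [← hcomp, e1, AffineMap.lineMap_apply_zero])
  have k2 : (1 - t') * s + t' * t = 1 := hinj (by rw [← hcomp, e2, AffineMap.lineMap_apply_one])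
  -- The parameter 0 of `a` is a convex combination of `s, t ≥ 0`, so both terms vanish; the
  -- parameter 1 of `b` then decides which of `s, t` is 1.
  have m1 : 0 ≤ (1 - s') * s := mul_nonneg (by linarith [hs'.2]) hs.1
  have m2 : 0 ≤ s' * t := mul_nonneg hs'.1 ht.1
  have m3 : (1 - s') * s = 0 := by linarith
  rcases mul_eq_zero.1 m3 with h1 | h1
  · have h2 : t = 0 := by
      have : s' = 1 := by linarith
      rw [this] at k1
      linarith
    have h3 : s = 1 := by
      rw [h2] at k2
      have : (1 - t') * s ≤ 1 * s := mul_le_mul_of_nonneg_right (by linarith [ht'.1]) hs.1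
      linarith [hs.2]
    right
    simp [h2, h3]
  · have h3 : t = 1 := by
      rw [h1] at k2
      have : t' * t ≤ 1 * t := mul_le_mul_of_nonneg_right ht'.2 ht.1
      linarith [ht.2]
    left
    simp [h1, h3]

lemma segIntegral_symm (a b : Plane) (f : Plane → ℝ) : segIntegral a b f = segIntegral b a f := by
  rw [segIntegral, segIntegral, dist_comm]
  congr 1
  have := intervalIntegral.integral_comp_sub_left (a := 0) (b := 1)
    (fun t : ℝ => f (AffineMap.lineMap b a t)) 1
  simp only [sub_self, sub_zero] at this
  rw [← this]
  refine intervalIntegral.integral_congr fun t _ => ?_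
  rw [AffineMap.lineMap_apply_one_sub]

/-- Polynomial pieces with the same degrees of freedom on a segment match on the segment. -/
lemma match_on_segment {k : ℕ} (hk : k = 2 ∨ k = 3) {p p' : MvPolynomial (Fin 2) ℝ}
    (hp : p ∈ Poly ((k : ℤ) + 1)) (hp' : p' ∈ Poly ((k : ℤ) + 1)) {a b n : Plane} (hab : a ≠ b)
    (hn : cross (b - a) n ≠ 0) (ha : evalAt a p = evalAt a p' ∧ grad p a = grad p' a)
    (hb : evalAt b p = evalAt b p' ∧ grad p b = grad p' b)
    (hN : ∀ q ∈ Poly ((k : ℤ) - 2), segIntegral a b (fun x => gradL n p x * evalAt x q) =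
      segIntegral a b fun x => gradL n p' x * evalAt x q)
    (hV : ∀ q ∈ Poly ((k : ℤ) - 3), segIntegral a b (fun x => evalL p x * evalAt x q) =
      segIntegral a b fun x => evalL p' x * evalAt x q) {x : Plane} (hx : x ∈ segment ℝ a b) :
    evalAt x p = evalAt x p' ∧ grad p x = grad p' x := by
  rw [segment_eq_image_lineMap] at hx
  obtain ⟨t, -, rfl⟩ := hx
  have hd : dist a b ≠ 0 := dist_ne_zero.2 hab
  have := eq_zero_on_edge hk (Submodule.sub_mem _ hp hp') hn
    (by rw [evalAt_sub, ha.1, sub_self]) (by rw [evalAt_sub, hb.1, sub_self])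
    (by rw [grad_sub, ha.2, sub_self]) (by rw [grad_sub, hb.2, sub_self])
    (fun q hq => ?_) (fun q hq => ?_) t
  · rw [evalAt_sub, grad_sub, sub_eq_zero, sub_eq_zero] at this
    exact this
  · have h1 := (segIntegral_sub (a := a) (b := b)
      ((continuous_gradL n p).mul (continuous_evalAt q))
      ((continuous_gradL n p').mul (continuous_evalAt q))).trans (sub_eq_zero.2 (hN q hq))
    simp only [Pi.mul_apply, gradL_apply, ← sub_mul] at h1
    simp only [grad_sub, sub_apply]
    exact (mul_eq_zero.1 h1).resolve_left hd
  · have h1 := (segIntegral_sub (a := a) (b := b)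
      ((continuous_evalL p).mul (continuous_evalAt q))
      ((continuous_evalL p').mul (continuous_evalAt q))).trans (sub_eq_zero.2 (hV q hq))
    simp only [Pi.mul_apply, evalL_apply, ← sub_mul] at h1
    simp only [evalAt_sub]
    exact (mul_eq_zero.1 h1).resolve_left hd

section Mesh

variable {Ω : Set Plane} {N : ℕ} {M : QuadMesh Ω N} {k : ℕ} {n : Set Plane → Plane}
  {u : Fin N → Plane → ℝ} {p : Fin N → Fin 4 → MvPolynomial (Fin 2) ℝ}

lemma match_at_vertex (hs : SingleValuedDofs M k n u) (hpu : ∀ j, (M.quad j).IsPieces (p j) (u j))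
    {j j' : Fin N} {a b i i' : Fin 4} (hv : (M.quad j).v a = (M.quad j').v b)
    (hi : (M.quad j).v a ∈ (M.quad j).tri i) (hi' : (M.quad j).v a ∈ (M.quad j').tri i') :
    evalAt ((M.quad j).v a) (p j i) = evalAt ((M.quad j).v a) (p j' i') ∧
      grad (p j i) ((M.quad j).v a) = grad (p j' i') ((M.quad j).v a) := by
  have h1 := hs.value j j' a b hv
  have h2 := hs.grad j j' a b hv
  rw [← hv] at h1 h2
  refine ⟨by rw [← (hpu j).eq i _ hi, ← (hpu j').eq i' _ hi', h1], clm_ext_single ?_ ?_⟩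
  · rw [← (hpu j).deriv_eq hi, ← (hpu j').deriv_eq hi', h2]
  · rw [← (hpu j).deriv_eq hi, ← (hpu j').deriv_eq hi', h2]

lemma match_on_edge (hk : k = 2 ∨ k = 3)
    (hn : ∀ j i, (M.quad j).IsUnitNormal i (n ((M.quad j).edge i)))
    (hs : SingleValuedDofs M k n u) (hp : ∀ j i, p j i ∈ Poly ((k : ℤ) + 1))
    (hpu : ∀ j, (M.quad j).IsPieces (p j) (u j)) {j j' : Fin N} {a b : Fin 4}
    (he : (M.quad j).edge a = (M.quad j').edge b) {x : Plane} (hx : x ∈ (M.quad j).edge a) :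
    evalAt x (p j a) = evalAt x (p j' b) ∧ grad (p j a) x = grad (p j' b) x := by
  have hends := endpoints_of_segment_eq ((M.quad j).v_ne_v a) he
  have hseg : ∀ f, (M.quad j').edgeIntegral b f = (M.quad j).edgeIntegral a f := by
    intro f
    rcases hends with ⟨e1, e2⟩ | ⟨e1, e2⟩
    · rw [ConvexQuad.edgeIntegral, ConvexQuad.edgeIntegral, e1, e2]
    · rw [ConvexQuad.edgeIntegral, ConvexQuad.edgeIntegral, e1, e2, segIntegral_symm]
  have hlen : (M.quad j').edgeLength b = (M.quad j).edgeLength a := by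
    rcases hends with ⟨e1, e2⟩ | ⟨e1, e2⟩
    · rw [ConvexQuad.edgeLength, ConvexQuad.edgeLength, e1, e2]
    · rw [ConvexQuad.edgeLength, ConvexQuad.edgeLength, e1, e2, dist_comm]
  refine match_on_segment hk (hp j a) (hp j' b) ((M.quad j).v_ne_v a)
    ((M.quad j).cross_normal (hn j a)) ?_ ?_ (fun q hq => ?_) (fun q hq => ?_) hx
  · have h1 := (M.quad j).v_mem_tri a
    rcases hends with ⟨e1, -⟩ | ⟨e1, -⟩
    · exact match_at_vertex hs hpu e1 h1 (e1 ▸ (M.quad j').v_mem_tri b)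
    · exact match_at_vertex hs hpu e1 h1 (e1 ▸ (M.quad j').v_succ_mem_tri b)
  · have h1 := (M.quad j).v_succ_mem_tri a
    rcases hends with ⟨-, e2⟩ | ⟨-, e2⟩
    · exact match_at_vertex hs hpu e2 h1 (e2 ▸ (M.quad j').v_succ_mem_tri b)
    · exact match_at_vertex hs hpu e2 h1 (e2 ▸ (M.quad j').v_mem_tri b)
  · have h1 := hs.normal j j' a b he _ ((M.quad j).indicator_mem_testSpace a _ hq)
    rw [(hpu j).normalMoment_eq, (hpu j').normalMoment_eq, hseg, ← he,
      ConvexQuad.edgeIntegral_indicator, ConvexQuad.edgeIntegral_indicator] at h1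
    exact h1
  · have h1 := hs.edgeValue j j' a b he _ ((M.quad j).indicator_mem_testSpace a _ hq)
    rw [(hpu j).valueMoment_eq, (hpu j').valueMoment_eq, hseg, hlen,
      ConvexQuad.edgeIntegral_indicator, ConvexQuad.edgeIntegral_indicator] at h1
    exact mul_left_cancel₀ (inv_ne_zero ((M.quad j).edgeLength_ne_zero a)) h1

/-- The triangles need not be those adjacent to the common edge. The chain goes from `tri i` to the
triangle at the edge inside the first quadrilateral, across the edge, and on to `tri i'` inside the
second. -/
lemma match_on_mesh (hk : k = 2 ∨ k = 3)
    (hn : ∀ j i, (M.quad j).IsUnitNormal i (n ((M.quad j).edge i)))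
    (hs : SingleValuedDofs M k n u) (hp : ∀ j i, p j i ∈ Poly ((k : ℤ) + 1))
    (hpu : ∀ j, (M.quad j).IsPieces (p j) (u j)) {j j' : Fin N} {i i' : Fin 4} {x : Plane}
    (hx : x ∈ (M.quad j).tri i) (hx' : x ∈ (M.quad j').tri i') :
    evalAt x (p j i) = evalAt x (p j' i') ∧ grad (p j i) x = grad (p j' i') x := by
  by_cases hjj : j = j'
  · subst hjj
    exact ⟨by rw [← (hpu j).eq i x hx, ← (hpu j).eq i' x hx'], (hpu j).fderiv_eq i i' x hx hx'⟩
  have hmem : x ∈ (M.quad j).carrier ∩ (M.quad j').carrier :=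
    ⟨(M.quad j).tri_subset_carrier i hx, (M.quad j').tri_subset_carrier i' hx'⟩
  rcases M.conforming j j' hjj with h | ⟨a, b, hv, h⟩ | ⟨a, b, he, h⟩
  · rw [h] at hmem
    exact hmem.elim
  · rw [h, mem_singleton_iff] at hmem
    subst hmem
    exact match_at_vertex hs hpu hv hx hx'
  · rw [h] at hmem
    have t1 := (M.quad j).edge_subset_tri a hmem
    have t2 := (M.quad j').edge_subset_tri b (he ▸ hmem)
    obtain ⟨h1, h2⟩ := match_on_edge hk hn hs hp hpu he hmem
    refine ⟨?_, ?_⟩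
    · rw [← (hpu j).eq i x hx, ← (hpu j').eq i' x hx', (hpu j).eq a x t1, (hpu j').eq b x t2, h1]
    · exact ((hpu j).fderiv_eq i a x hx t1).trans (h2.trans ((hpu j').fderiv_eq b i' x t2 hx'))

/-- All triangles of the mesh form one glued family whose sides lie on finitely many lines. On the
mesh the choice of triangle in the definition of `w` is immaterial because the pieces agree on
intersections. -/
theorem exists_memH2_of_singleValuedDofs (hk : k = 2 ∨ k = 3) (hΩ : IsOpen Ω)
    (hn : ∀ j i, (M.quad j).IsUnitNormal i (n ((M.quad j).edge i)))
    (hu : ∀ j, u j ∈ (M.quad j).Sigma k) (hs : SingleValuedDofs M k n u) :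
    ∃ w : Plane → ℝ, (∀ j, ∀ x ∈ (M.quad j).carrier, w x = u j x) ∧ MemH2 Ω w := by
  classical
  choose p hp hpu using fun j => ConvexQuad.exists_isPieces (hu j)
  let w : Plane → ℝ := fun x =>
    if h : ∃ z : Fin N × Fin 4, x ∈ (M.quad z.1).tri z.2 then u h.choose.1 x else 0
  have hw : ∀ z : Fin N × Fin 4, ∀ x ∈ (M.quad z.1).tri z.2, w x = evalAt x (p z.1 z.2) := by
    intro z x hx
    have hex : ∃ z : Fin N × Fin 4, x ∈ (M.quad z.1).tri z.2 := ⟨z, hx⟩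
    simp only [w, dif_pos hex]
    rw [(hpu _).eq _ x hex.choose_spec]
    exact (match_on_mesh hk hn hs hp hpu hex.choose_spec hx).1
  have hglued : IsGlued (fun z : Fin N × Fin 4 => (M.quad z.1).tri z.2)
      (fun z x => evalAt x (p z.1 z.2)) w :=
    ⟨fun z => (M.quad z.1).isCompact_tri z.2, fun z => contDiff_evalAt _, hw,
      fun z z' x hx hx' => (match_on_mesh hk hn hs hp hpu hx hx').2⟩
  refine ⟨w, fun j x hx => ?_, hglued.memH2 hΩ (fun x hx => ?_)
    (κ := Fin N × Fin 4 × Fin 3) (l := fun z => (M.quad z.1).sideForm z.2)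
    (fun z => (M.quad z.1).sideForm_ne_zero z.2) (c := fun z => (M.quad z.1).sideConst z.2)
    fun z x hx hl => (M.quad z.1).mem_interior_tri hx fun j => hl (z.1, z.2, j)⟩
  · rw [ConvexQuad.carrier_eq] at hx
    obtain ⟨i, hi⟩ := mem_iUnion.1 hx
    rw [hw (j, i) x hi, (hpu j).eq i x hi]
  · have := subset_closure hx
    rw [M.closure_eq] at this
    obtain ⟨j, hj⟩ := mem_iUnion.1 this
    rw [ConvexQuad.carrier_eq] at hj
    obtain ⟨i, hi⟩ := mem_iUnion.1 hj
    exact mem_iUnion.2 ⟨(j, i), hi⟩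

end Mesh

end CrissCross

end

theorem mainTheorem10 (k : ℕ) (hk : k = 2 ∨ k = 3) :
    -- the members of the local space are `C¹` up to the boundary, and the DOFs are unisolvent
    (∀ (Q : CrissCross.ConvexQuad) (n : Fin 4 → CrissCross.Plane),
      (∀ i, Q.IsUnitNormal i (n i)) →
        (∀ u ∈ Q.Sigma k, ContDiffOn ℝ 1 u Q.carrier) ∧
        ∀ d : Q.DofData k, ∃! u : CrissCross.Plane → ℝ, u ∈ Q.Sigma k ∧ Q.HasDofs k n u d) ∧
    -- functions glued by the DOFs belong to `H²`
    (∀ (Ω : Set CrissCross.Plane) (N : ℕ) (M : CrissCross.QuadMesh Ω N)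
      (n : Set CrissCross.Plane → CrissCross.Plane) (u : Fin N → CrissCross.Plane → ℝ),
      IsOpen Ω →
      (∀ j i, (M.quad j).IsUnitNormal i (n ((M.quad j).edge i))) →
      (∀ j, u j ∈ (M.quad j).Sigma k) →
      CrissCross.SingleValuedDofs M k n u →
        ∃ w : CrissCross.Plane → ℝ,
          (∀ j, ∀ x ∈ (M.quad j).carrier, w x = u j x) ∧ CrissCross.MemH2 Ω w) := by
  refine ⟨fun Q n hn => ⟨fun u hu => ?_, fun d => ?_⟩,
    fun Ω N M n u hΩ hn hu hs => CrissCross.exists_memH2_of_singleValuedDofs hk hΩ hn hu hs⟩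
  · obtain ⟨p, -, hpu⟩ := CrissCross.ConvexQuad.exists_isPieces hu
    exact hpu.contDiffOn
  · obtain ⟨u, hu, hd⟩ := Q.exists_hasDofs hk hn d
    exact ⟨u, ⟨hu, hd⟩, fun u' hu' => Q.hasDofs_unique hk hn hu'.1 hu hu'.2 hd⟩
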